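/- Let $N\ge 2$ be an integer, let $q,t\in(0,1)$, $b<0<a$, and let $c=\bar d\in\mathbb C\setminus\mathbb R$. **Configuration space.** Let $\widetilde\Omega_N$ be the set of pairs $\omega=((k_i)_{i\ge1},(l_i)_{i\ge1})$ of weakly increasing sequences in $\{1,2,\dots\}\cup\{\infty\}$ with at most $N$ coordinates (in total) different from $\infty$, with the topology induced by the product topology, $\{1,2,\dots\}\cup\{\infty\}$ being the one-point compactification of $\{1,2,\dots\}$. To $\omega$ one assigns the $N$-particle configuration $X(\omega)$ (a multiset of $N$ real numbers) consisting of the nonzero ones among the numbers $a^{-1}q^{k_i}t^{i-1}$ and $b^{-1}q^{l_i}t^{i-1}$, $i\ge1$ (with $q^\infty:=0$), completed by zeros. The map $\omega\mapsto X(\omega)$ is injective; its image with the transported topology is the compact space $\widetilde\Omega_N(q,t;a,b)$. A symmetric polynomial $f\in\mathrm{Sym}(N)$ (in $N$ variables, with real coefficients) is regarded as the function $\omega\mapsto f(X(\omega))$ on it. **Operator.** Let $V(X)=\prod_{i<j}(x_i-x_j)$, let $S^{\pm}_{r,i}$ replace $x_i$ by $x_ir^{\pm1}$, and set $$\sigma^+_N(x)=-\frac{qt^{N-1}}{ab}(c-x^{-1})(d-x^{-1}),\qquad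 \sigma^-_N(x)=-\frac{q^2t^{N-1}}{ab}(aq^{-1}-x^{-1})(bq^{-1}-x^{-1}),$$ $$D_N=\sum_{i=1}^N\left(\frac{S^+_{t,i}V}{V}\,\sigma^+_N(x_i)(S^+_{q,i}-1)+\frac{S^-_{t,i}V}{V}\,\sigma^-_N(x_i)(S^-_{q,i}-1)\right).$$ **Theorem.** 1. The map $\mathrm{Sym}(N)\to C(\widetilde\Omega_N(q,t;a,b))$ (real continuous functions with the supremum norm) is injective and has dense image. 2. $D_N$ is a correctly defined linear operator on $\mathrm{Sym}(N)$: there is exactly one linear operator on $\mathrm{Sym}(N)$ that is given by the above formula at all points of $\mathbb R^N$ with nonzero, pairwise distinct coordinates. 3. If $f\in\mathrm{Sym}(N)$ attains its minimum on $\widetilde\Omega_N(q,t;a,b)$ at a configuration $\widetilde X$ (possibly with particles at $0$), then $D_Nf(\widetilde X)\ge0$. 4. $D_N$ is triangular in the basis of monomial symmetric polynomials $m_\lambda$, where $\lambda=(\lambda_1\ge\dots\ge\lambda_N\ge0)$, with nonpositive diagonal entries: for every $\lambda$ there is a real $\mu_\lambda\le0$ such that $D_Nm_\lambda-\mu_\lambda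 m_\lambda$ is a linear combination of polynomials $m_\nu$ with $\nu$ strictly smaller than $\lambda$ in the lexicographic order. 5. The operator $D_N$ on $C(\widetilde\Omega_N(q,t;a,b))$ with domain $\mathrm{Sym}(N)$ is a pre-generator of a Feller semigroup: it is closable, and its closure is the generator of a strongly continuous contraction semigroup $\{T(s)\}_{s\ge0}$ on $C(\widetilde\Omega_N(q,t;a,b))$ that is positive ($f\ge0$ implies $T(s)f\ge0$) and conservative ($T(s)1=1$). 6. This semigroup gives rise to a continuous time Markov process on $\widetilde\Omega_N(q,t;a,b)$: there are Markov kernels $p(s;x,dy)$, $s\ge0$, with $T(s)f(x)=\int f(y)\,p(s;x,dy)$ for all $f\in C(\widetilde\Omega_N(q,t;a,b))$, and for every initial probability distribution there is a time-homogeneous Markov process on $\widetilde\Omega_N(q,t;a,b)$ with that initial distribution and transition function $p$. -/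

import Mathlib

open Filter Topology MeasureTheory ProbabilityTheory
open scoped NNReal

noncomputable section

namespace QJacobi

/-! ## Contraction semigroups, Feller semigroups, generators, pre-generators -/

/-- A strongly continuous one-parameter semigroup of contractions on a real Banach space. -/
structure ContractionSemigroup (F : Type*) [NormedAddCommGroup F] [NormedSpace ℝ F] where
  /-- the operator at time `s` -/
  op : ℝ≥0 → F →L[ℝ] F
  op_zero : op 0 = ContinuousLinearMap.id ℝ F
  op_add : ∀ r s, op (r + s) = (op r).comp (op s)
  norm_op_le : ∀ s, ‖op s‖ ≤ 1
  continuous_op : ∀ f, Continuous fun s => op s f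

/-- `A` is the generator of `T`: the pair `(f, g)` lies in the graph of `A` exactly when
`(T(s) f - f) / s` converges in norm to `g` as `s → +0`. -/
def IsGenerator {F : Type*} [NormedAddCommGroup F] [NormedSpace ℝ F]
    (A : F →ₗ.[ℝ] F) (T : ContractionSemigroup F) : Prop :=
  ∀ f g : F, (f, g) ∈ A.graph ↔
    Tendsto (fun s : ℝ≥0 => (s : ℝ)⁻¹ • (T.op s f - f)) (𝓝[>] 0) (𝓝 g)

/-- `A` is a pre-generator of `T`: it is closable and its closure is the generator of `T`. -/
def IsPregenerator {F : Type*} [NormedAddCommGroup F] [NormedSpace ℝ F]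
    (A : F →ₗ.[ℝ] F) (T : ContractionSemigroup F) : Prop :=
  A.IsClosable ∧ IsGenerator A.closure T

/-- A contraction semigroup on `C(E)` (with `E` compact) is Feller when it is positive and
conservative. -/
def IsFeller {E : Type*} [TopologicalSpace E] [CompactSpace E]
    (T : ContractionSemigroup C(E, ℝ)) : Prop :=
  (∀ s (f : C(E, ℝ)), (∀ x, 0 ≤ f x) → ∀ x, 0 ≤ T.op s f x) ∧ ∀ s, T.op s 1 = 1

/-- A family of Markov kernels `p s` on `E` is the transition function of the Markov semigroup
`T` on `C(E)`. -/
def IsTransitionFunction {E : Type*} [TopologicalSpace E] [CompactSpace E] [MeasurableSpace E]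
    (p : ℝ≥0 → Kernel E E) (T : ContractionSemigroup C(E, ℝ)) : Prop :=
  (∀ s, IsMarkovKernel (p s)) ∧
    ∀ s (f : C(E, ℝ)) (x : E), T.op s f x = ∫ y, f y ∂(p s x)

/-- `X` is a continuous time, time-homogeneous Markov process (with respect to its own past),
with transition function `p` and initial distribution `ν`. -/
structure IsMarkovProcess {E : Type*} [MeasurableSpace E] {S : Type*} [MeasurableSpace S]
    (P : Measure S) (X : ℝ≥0 → S → E) (p : ℝ≥0 → Kernel E E) (ν : Measure E) : Prop where
  measurable : ∀ s, Measurable (X s)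
  initial : P.map (X 0) = ν
  markov : ∀ (s u : ℝ≥0) (B : Set E), MeasurableSet B →
    P[(X (s + u) ⁻¹' B).indicator (fun _ => (1 : ℝ)) |
        ⨆ r ∈ Set.Iic s, MeasurableSpace.comap (X r) inferInstance]
      =ᵐ[P] fun z => (p u (X s z)).real B

/-! ## The configuration space -/

/-- The number `|ω| = |ω⁺| + |ω⁻|` of coordinates different from `∞`. -/
def size (ω : (ℕ → ℕ∞) × (ℕ → ℕ∞)) : ℕ∞ :=
  {i | ω.1 i ≠ ⊤}.encard + {i | ω.2 i ≠ ⊤}.encard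

/-- Pairs `ω = (ω⁺, ω⁻)` of weakly increasing sequences in `{1, 2, …} ∪ {∞}` with at most `N`
coordinates different from `∞` (sequences are indexed from `0`). -/
def omegaSet (N : ℕ) : Set ((ℕ → ℕ∞) × (ℕ → ℕ∞)) :=
  {ω | Monotone ω.1 ∧ Monotone ω.2 ∧ (∀ i, 1 ≤ ω.1 i) ∧ (∀ i, 1 ≤ ω.2 i) ∧ size ω ≤ N}

/-- The space of `N`-particle configurations (particles are allowed to stick together at `0`),
in its coordinates `ω`. -/
def Omega (N : ℕ) : Type := omegaSet N

/-- The topology induced by the product topology, `ℕ∞` being the one-point compactification. -/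
instance (N : ℕ) : TopologicalSpace (Omega N) :=
  inferInstanceAs (TopologicalSpace (omegaSet N))

instance (N : ℕ) : MeasurableSpace (Omega N) := borel _

instance (N : ℕ) : BorelSpace (Omega N) := ⟨rfl⟩

theorem size_le_iff (N : ℕ) (ω : (ℕ → ℕ∞) × (ℕ → ℕ∞)) :
    size ω ≤ N ↔ ∀ A B : Finset ℕ, N < A.card + B.card →
      (∃ i ∈ A, ω.1 i = ⊤) ∨ ∃ i ∈ B, ω.2 i = ⊤ := by
  constructor
  · intro h A B hAB
    by_contra! hcon
    have hA : (A : Set ℕ) ⊆ {i | ω.1 i ≠ ⊤} := fun i hi => hcon.1 i hi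
    have hB : (B : Set ℕ) ⊆ {i | ω.2 i ≠ ⊤} := fun i hi => hcon.2 i hi
    have h1 := add_le_add (Set.encard_le_encard hA) (Set.encard_le_encard hB)
    rw [Set.encard_coe_eq_coe_finsetCard, Set.encard_coe_eq_coe_finsetCard] at h1
    have h2 : ((A.card + B.card : ℕ) : ℕ∞) ≤ N := by
      push_cast
      exact h1.trans h
    exact absurd (Nat.cast_le.mp h2) (by omega)
  · intro h
    by_cases h1 : {i | ω.1 i ≠ ⊤}.Finite
    · by_cases h2 : {i | ω.2 i ≠ ⊤}.Finite
      · by_contra hcon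
        have h3 := h h1.toFinset h2.toFinset (by
          rw [size, h1.encard_eq_coe_toFinset_card, h2.encard_eq_coe_toFinset_card] at hcon
          exact_mod_cast not_le.mp hcon)
        rcases h3 with ⟨i, hi, hi'⟩ | ⟨i, hi, hi'⟩
        · exact (h1.mem_toFinset.mp hi) hi'
        · exact (h2.mem_toFinset.mp hi) hi'
      · obtain ⟨B, hB, hc⟩ := Set.Infinite.exists_subset_card_eq h2 (N + 1)
        rcases h ∅ B (by simp [hc]) with ⟨i, hi, _⟩ | ⟨i, hi, hi'⟩
        · simp at hi
        · exact absurd hi' (hB hi)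
    · obtain ⟨A, hA, hc⟩ := Set.Infinite.exists_subset_card_eq h1 (N + 1)
      rcases h A ∅ (by simp [hc]) with ⟨i, hi, hi'⟩ | ⟨i, hi, _⟩
      · exact absurd hi' (hA hi)
      · simp at hi

theorem isClosed_omegaSet (N : ℕ) : IsClosed (omegaSet N) := by
  have c1 : ∀ i, Continuous fun ω : (ℕ → ℕ∞) × (ℕ → ℕ∞) => ω.1 i := fun i => by fun_prop
  have c2 : ∀ i, Continuous fun ω : (ℕ → ℕ∞) × (ℕ → ℕ∞) => ω.2 i := fun i => by fun_prop
  have h : omegaSet N =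
      (⋂ i : ℕ, ⋂ j : ℕ, ⋂ _ : i ≤ j, {ω | ω.1 i ≤ ω.1 j}) ∩
      ((⋂ i : ℕ, ⋂ j : ℕ, ⋂ _ : i ≤ j, {ω | ω.2 i ≤ ω.2 j}) ∩
      ((⋂ i : ℕ, {ω | 1 ≤ ω.1 i}) ∩ ((⋂ i : ℕ, {ω | 1 ≤ ω.2 i}) ∩
      (⋂ A : Finset ℕ, ⋂ B : Finset ℕ, ⋂ _ : N < A.card + B.card,
        (⋃ i ∈ A, {ω | ω.1 i = ⊤}) ∪ ⋃ i ∈ B, {ω | ω.2 i = ⊤})))) := by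
    ext ω
    simp only [omegaSet, Set.mem_ofPred_eq, size_le_iff, Set.mem_inter_iff, Set.mem_iInter,
      Set.mem_union, Set.mem_iUnion, exists_prop]
    rfl
  rw [h]
  refine IsClosed.inter ?_ (IsClosed.inter ?_ (IsClosed.inter ?_ (IsClosed.inter ?_ ?_)))
  · exact isClosed_iInter fun i => isClosed_iInter fun j => isClosed_iInter fun _ =>
      isClosed_le (c1 i) (c1 j)
  · exact isClosed_iInter fun i => isClosed_iInter fun j => isClosed_iInter fun _ =>
      isClosed_le (c2 i) (c2 j)
  · exact isClosed_iInter fun i => isClosed_le continuous_const (c1 i)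
  · exact isClosed_iInter fun i => isClosed_le continuous_const (c2 i)
  · refine isClosed_iInter fun A => isClosed_iInter fun B => isClosed_iInter fun _ =>
      IsClosed.union ?_ ?_
    · exact A.finite_toSet.isClosed_biUnion fun i _ => isClosed_eq (c1 i) continuous_const
    · exact B.finite_toSet.isClosed_biUnion fun i _ => isClosed_eq (c2 i) continuous_const

instance (N : ℕ) : CompactSpace (Omega N) :=
  isCompact_iff_compactSpace.mp (isClosed_omegaSet N).isCompact

/-- `q ^ k` for `k ∈ ℕ ∪ {∞}`, with `q ^ ∞ = 0`. -/
def qPow (q : ℝ) (k : ℕ∞) : ℝ := if k = ⊤ then 0 else q ^ k.toNat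

theorem continuous_qPow {q : ℝ} (hq : q ∈ Set.Ioo (0 : ℝ) 1) : Continuous (qPow q) := by
  rw [continuous_iff_continuousAt]
  intro k
  by_cases hk : k = ⊤
  · subst hk
    rw [ContinuousAt, Metric.tendsto_nhds]
    intro ε hε
    obtain ⟨n, hn⟩ := exists_pow_lt_of_lt_one hε hq.2
    have hev : ∀ᶠ m : ℕ∞ in 𝓝 ⊤, (n : ℕ∞) < m := lt_mem_nhds (WithTop.coe_lt_top n)
    filter_upwards [hev] with m hm
    by_cases hm' : m = ⊤
    · subst hm'
      simpa using hε
    · lift m to ℕ using hm'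
      have hnm : n ≤ m := by exact_mod_cast hm.le
      have : q ^ m ≤ q ^ n := pow_le_pow_of_le_one hq.1.le hq.2.le hnm
      have h0 : 0 ≤ q ^ m := pow_nonneg hq.1.le m
      simp only [qPow, ENat.natCast_ne_top, if_false, if_true, ENat.toNat_natCast, dist_zero_right,
        Real.norm_eq_abs, abs_of_nonneg h0]
      linarith
  · rw [ContinuousAt, ENat.nhds_eq_pure hk]
    exact tendsto_pure_nhds _ _

/-- The coordinates `x⁺_{i+1} = a⁻¹ q^{k_{i+1}} t^i`. -/
def xPlus (q t a : ℝ) {N : ℕ} (ω : Omega N) (i : ℕ) : ℝ := a⁻¹ * qPow q (ω.1.1 i) * t ^ i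

/-- The coordinates `x⁻_{i+1} = b⁻¹ q^{l_{i+1}} t^i`. -/
def xMinus (q t b : ℝ) {N : ℕ} (ω : Omega N) (i : ℕ) : ℝ := b⁻¹ * qPow q (ω.1.2 i) * t ^ i

/-- The configuration `X(ω)` as an `N`-tuple of real numbers in descending order: first the
positive particles `x⁺₁ > x⁺₂ > ⋯`, then zeros, then the negative particles `⋯ > x⁻₂ > x⁻₁`.
As at most `N` of the coordinates `x⁺`, `x⁻` are nonzero, at most one of the two summands
is nonzero for each `i`. -/
def config (q t a b : ℝ) {N : ℕ} (ω : Omega N) (i : Fin N) : ℝ :=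
  xPlus q t a ω i + xMinus q t b ω (Fin.rev i)

theorem continuous_config {q : ℝ} (hq : q ∈ Set.Ioo (0 : ℝ) 1) (t a b : ℝ) (N : ℕ) :
    Continuous fun ω : Omega N => config q t a b ω := by
  refine continuous_pi fun i => ?_
  have h1 : Continuous fun ω : Omega N => ω.1.1 (i : ℕ) :=
    (continuous_apply (i : ℕ)).comp (continuous_fst.comp continuous_subtype_val)
  have h2 : Continuous fun ω : Omega N => ω.1.2 (Fin.rev i : ℕ) :=
    (continuous_apply (Fin.rev i : ℕ)).comp (continuous_snd.comp continuous_subtype_val)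
  exact ((continuous_const.mul ((continuous_qPow hq).comp h1)).mul continuous_const).add
    ((continuous_const.mul ((continuous_qPow hq).comp h2)).mul continuous_const)

/-! ## Symmetric polynomials as functions on the configuration space -/

/-- The algebra of symmetric polynomials in `N` variables over `ℝ`. -/
abbrev SymPoly (N : ℕ) : Type := MvPolynomial.symmetricSubalgebra (Fin N) ℝ

/-- The value of a symmetric polynomial at a point of `ℝ^N`. -/
def SymPoly.value {N : ℕ} (f : SymPoly N) (X : Fin N → ℝ) : ℝ :=
  MvPolynomial.eval X (f : MvPolynomial (Fin N) ℝ)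

/-- The algebra morphism from symmetric polynomials to continuous functions: evaluation of a
symmetric polynomial at the `N` points of a configuration. -/
def embed {q : ℝ} (hq : q ∈ Set.Ioo (0 : ℝ) 1) (t a b : ℝ) (N : ℕ) :
    SymPoly N →ₐ[ℝ] C(Omega N, ℝ) where
  toFun f := ⟨fun ω => f.value (config q t a b ω),
    (MvPolynomial.continuous_eval _).comp (continuous_config hq t a b N)⟩
  map_one' := by ext; simp [SymPoly.value]
  map_mul' f g := by ext; simp [SymPoly.value]
  map_zero' := by ext; simp [SymPoly.value]
  map_add' f g := by ext; simp [SymPoly.value]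
  commutes' r := by ext; simp [SymPoly.value, MvPolynomial.algebraMap_eq]

/-- The monomial symmetric polynomial `m_lam`: the sum of all distinct monomials obtained from
`x^lam` by permuting the exponents. -/
def monomialSum {N : ℕ} (lam : Fin N → ℕ) : MvPolynomial (Fin N) ℝ :=
  ∑ α ∈ Finset.univ.image fun s : Equiv.Perm (Fin N) => lam ∘ s,
    MvPolynomial.monomial (Finsupp.equivFunOnFinite.symm α) 1

theorem monomialSum_isSymmetric {N : ℕ} (lam : Fin N → ℕ) : (monomialSum lam).IsSymmetric := by
  intro e
  rw [monomialSum, map_sum]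
  refine Finset.sum_nbij' (fun α => α ∘ e.symm) (fun α => α ∘ e) ?_ ?_ ?_ ?_ ?_
  · intro α hα
    simp only [Finset.mem_image, Finset.mem_univ, true_and] at hα ⊢
    obtain ⟨s, rfl⟩ := hα
    exact ⟨e.symm.trans s, rfl⟩
  · intro α hα
    simp only [Finset.mem_image, Finset.mem_univ, true_and] at hα ⊢
    obtain ⟨s, rfl⟩ := hα
    exact ⟨e.trans s, rfl⟩
  · intro α _
    funext i
    simp
  · intro α _
    funext i
    simp
  · intro α _
    have h : (Finsupp.equivFunOnFinite.symm α).mapDomain e =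
        Finsupp.equivFunOnFinite.symm (α ∘ e.symm) := by
      ext i
      obtain ⟨j, rfl⟩ := e.surjective i
      rw [Finsupp.mapDomain_apply e.injective]
      simp
    rw [MvPolynomial.rename_monomial, h]

/-- `m_lam` as an element of the algebra of symmetric polynomials. -/
def monomialSym {N : ℕ} (lam : Fin N → ℕ) : SymPoly N :=
  ⟨monomialSum lam, monomialSum_isSymmetric lam⟩

/-! ## The second-order partial `q`-difference operator -/

/-- The product of `x_i - x_j` over `i < j`. -/
def vandermonde {N : ℕ} (X : Fin N → ℝ) : ℝ :=
  ∏ i : Fin N, ∏ j ∈ Finset.Ioi i, (X i - X j)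

/-- Multiplication of the `i`-th coordinate by `r`; thus `(S_{r,i} f)(X) = f (scale r i X)`. -/
def scale {N : ℕ} (r : ℝ) (i : Fin N) (X : Fin N → ℝ) : Fin N → ℝ :=
  Function.update X i (r * X i)

/-- The coefficient `σ⁺_N(x) = - (q t^{N-1} / (a b)) (c - 1/x) (d - 1/x)`. -/
def sigmaPlus (N : ℕ) (q t a b : ℝ) (c d : ℂ) (x : ℝ) : ℂ :=
  -((q * t ^ (N - 1) / (a * b) : ℝ) : ℂ) * (c - ((x⁻¹ : ℝ) : ℂ)) * (d - ((x⁻¹ : ℝ) : ℂ))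

/-- The coefficient `σ⁻_N(x) = - (q² t^{N-1} / (a b)) (a/q - 1/x) (b/q - 1/x)`. -/
def sigmaMinus (N : ℕ) (q t a b : ℝ) (x : ℝ) : ℝ :=
  -(q ^ 2 * t ^ (N - 1) / (a * b)) * (a * q⁻¹ - x⁻¹) * (b * q⁻¹ - x⁻¹)

/-- The right-hand side of the definition of `(D_N f)(X)`, for a test function `f`, at a point
`X` with nonzero, pairwise distinct coordinates. -/
def qDifference {N : ℕ} (q t a b : ℝ) (c d : ℂ) (f : (Fin N → ℝ) → ℝ) (X : Fin N → ℝ) : ℂ :=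
  ∑ i : Fin N,
    (((vandermonde (scale t i X) / vandermonde X : ℝ) : ℂ) * sigmaPlus N q t a b c d (X i) *
        ((f (scale q i X) - f X : ℝ) : ℂ) +
      ((vandermonde (scale t⁻¹ i X) / vandermonde X : ℝ) : ℂ) *
        ((sigmaMinus N q t a b (X i) : ℝ) : ℂ) * ((f (scale q⁻¹ i X) - f X : ℝ) : ℂ))

/-- The linear operator `D` on symmetric polynomials is given by the `q`-difference expression
(at all points where that expression is defined). -/
def IsQDifferenceOperator {N : ℕ} (q t a b : ℝ) (c d : ℂ) (D : SymPoly N →ₗ[ℝ] SymPoly N) :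
    Prop :=
  ∀ (f : SymPoly N) (X : Fin N → ℝ), (∀ i, X i ≠ 0) → Function.Injective X →
    (((D f).value X : ℝ) : ℂ) = qDifference q t a b c d f.value X

end QJacobi

end

namespace QJacobi

/-! ## Generation of Feller semigroups from locally finite-dimensional operators -/

theorem _root_.HasDerivAt.continuousLinearMap_apply_const {G F : Type*} [NormedAddCommGroup G]
    [NormedSpace ℝ G] [NormedAddCommGroup F] [NormedSpace ℝ F] {c : ℝ → G →L[ℝ] F}
    {c' : G →L[ℝ] F} {s : ℝ} (hc : HasDerivAt c c' s) (v : G) :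
    HasDerivAt (fun r => c r v) (c' v) s :=
  let L : (G →L[ℝ] F) →L[ℝ] F := ContinuousLinearMap.apply ℝ F v
  L.hasFDerivAt.comp_hasDerivAt s hc

theorem hasDerivAt_eval {E : Type*} [TopologicalSpace E] [CompactSpace E] {u : ℝ → C(E, ℝ)}
    {u' : C(E, ℝ)} {s : ℝ} (hu : HasDerivAt u u' s) (x : E) :
    HasDerivAt (fun r => u r x) (u' x) s :=
  let L : C(E, ℝ) →L[ℝ] ℝ := ContinuousMap.evalCLM ℝ x
  L.hasFDerivAt.comp_hasDerivAt s hu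

/-- A linear endomorphism of a finite-dimensional space generates a flow. -/
theorem exists_linear_flow {M F : Type*} [AddCommGroup M] [Module ℝ M] [FiniteDimensional ℝ M]
    [NormedAddCommGroup F] [NormedSpace ℝ F] (A : M →ₗ[ℝ] M) (v : M) :
    ∃ u : ℝ → M, u 0 = v ∧
      ∀ (L : M →ₗ[ℝ] F) (s : ℝ), HasDerivAt (fun s => L (u s)) (L (A (u s))) s := by
  let e : M ≃ₗ[ℝ] (Fin (Module.finrank ℝ M) → ℝ) := (Module.finBasis ℝ M).equivFun
  let B : (Fin (Module.finrank ℝ M) → ℝ) →L[ℝ] (Fin (Module.finrank ℝ M) → ℝ) :=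
    LinearMap.toContinuousLinearMap (e.toLinearMap ∘ₗ A ∘ₗ e.symm.toLinearMap)
  refine ⟨fun s => e.symm (NormedSpace.exp (s • B) (e v)), by simp [NormedSpace.exp_zero], ?_⟩
  intro L s
  let L' : (Fin (Module.finrank ℝ M) → ℝ) →L[ℝ] F :=
    LinearMap.toContinuousLinearMap (L ∘ₗ e.symm.toLinearMap)
  have h1 : HasDerivAt (fun s : ℝ => NormedSpace.exp (s • B) (e v))
      ((B * NormedSpace.exp (s • B)) (e v)) s :=
    (hasDerivAt_exp_smul_const' B s).continuousLinearMap_apply_const (e v)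
  have h2 := L'.hasFDerivAt.comp_hasDerivAt s h1
  have h3 : L' ((B * NormedSpace.exp (s • B)) (e v)) =
      L (A (e.symm (NormedSpace.exp (s • B) (e v)))) := by
    simp [L', B]
  rw [h3] at h2
  exact h2

/-- An operator `D` on a dense subspace of `C(E)` which contains the constants, is exhausted by
finite-dimensional invariant subspaces, kills constants and satisfies the minimum principle. -/
structure FellerCore (E W : Type*) [TopologicalSpace E] [CompactSpace E]
    [AddCommGroup W] [Module ℝ W] where
  /-- the embedding into continuous functions -/
  ι : W →ₗ[ℝ] C(E, ℝ)
  inj : Function.Injective ι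
  dense : DenseRange ι
  /-- the operator -/
  D : W →ₗ[ℝ] W
  exhaust : ∀ f : W, ∃ V : Submodule ℝ W, f ∈ V ∧ FiniteDimensional ℝ V ∧ ∀ g ∈ V, D g ∈ V
  /-- the constant function `1` -/
  one : W
  ι_one : ι one = 1
  D_one : D one = 0
  min_principle : ∀ f x, (∀ y, ι f x ≤ ι f y) → 0 ≤ ι (D f) x

namespace FellerCore

variable {E W : Type*} [TopologicalSpace E] [CompactSpace E] [AddCommGroup W] [Module ℝ W]
variable (C : FellerCore E W)

/-- Solutions of the evolution equation `u' = D u`. -/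
def IsSolution (u : ℝ → W) : Prop :=
  ∀ s, HasDerivAt (fun s => C.ι (u s)) (C.ι (C.D (u s))) s

theorem exists_solution (f : W) : ∃ u : ℝ → W, u 0 = f ∧ C.IsSolution u := by
  obtain ⟨V, hf, hV, hD⟩ := C.exhaust f
  obtain ⟨u, h0, hu⟩ := exists_linear_flow (F := C(E, ℝ)) (C.D.restrict hD) ⟨f, hf⟩
  refine ⟨fun s => u s, by simp [h0], fun s => ?_⟩
  have := hu (C.ι ∘ₗ V.subtype) s
  simpa using this

variable {C}

theorem IsSolution.add {u v : ℝ → W} (hu : C.IsSolution u) (hv : C.IsSolution v) :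
    C.IsSolution (fun s => u s + v s) := fun s => by
  simpa only [map_add] using (hu s).fun_add (hv s)

theorem IsSolution.smul {u : ℝ → W} (r : ℝ) (hu : C.IsSolution u) :
    C.IsSolution (fun s => r • u s) := fun s => by
  simpa only [map_smul] using (hu s).fun_const_smul r

theorem IsSolution.sub {u v : ℝ → W} (hu : C.IsSolution u) (hv : C.IsSolution v) :
    C.IsSolution (fun s => u s - v s) := fun s => by
  simpa only [map_sub] using (hu s).fun_sub (hv s)

theorem IsSolution.shift {u : ℝ → W} (r : ℝ) (hu : C.IsSolution u) :
    C.IsSolution (fun s => u (r + s)) := fun s => by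
  simpa using (hu (r + s)).comp_const_add r s

variable (C) in
theorem isSolution_one : C.IsSolution (fun _ => C.one) := fun s => by
  simpa [C.D_one] using hasDerivAt_const s (C.ι C.one)

theorem IsSolution.continuous {u : ℝ → W} (hu : C.IsSolution u) :
    Continuous fun s => C.ι (u s) :=
  continuous_iff_continuousAt.mpr fun s => (hu s).continuousAt

theorem IsSolution.nonneg [T2Space E] {u : ℝ → W} (hu : C.IsSolution u)
    (h0 : ∀ x, 0 ≤ C.ι (u 0) x) {s : ℝ} (hs : 0 ≤ s) (x : E) : 0 ≤ C.ι (u s) x := by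
  by_contra! hneg
  set ε : ℝ := -C.ι (u s) x / (2 * (1 + s)) with hε
  have hε0 : 0 < ε := by apply div_pos <;> linarith
  have hεs : ε * (1 + s) = -C.ι (u s) x / 2 := by rw [hε]; field_simp
  let w : ℝ × E → ℝ := fun p => C.ι (u p.1) p.2 + ε * (1 + p.1)
  have hw : Continuous w := by
    have h1 : Continuous fun p : ℝ × E => C.ι (u p.1) := hu.continuous.comp continuous_fst
    have h2 : Continuous fun p : ℝ × E => C.ι (u p.1) p.2 := h1.eval continuous_snd
    fun_prop
  obtain ⟨⟨s₁, x₁⟩, ⟨hs₁, -⟩, hmin⟩ :=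
    ((isCompact_Icc (a := (0 : ℝ)) (b := s)).prod (isCompact_univ (X := E))).exists_isMinOn
      ⟨(s, x), ⟨hs, le_rfl⟩, trivial⟩ hw.continuousOn
  have hmin' : ∀ r ∈ Set.Icc 0 s, ∀ y, w (s₁, x₁) ≤ w (r, y) := fun r hr y => hmin ⟨hr, trivial⟩
  have hlt : w (s₁, x₁) < 0 := by
    refine (hmin' s ⟨hs, le_rfl⟩ x).trans_lt ?_
    simp only [w, hεs]
    linarith
  have hs₁0 : 0 < s₁ := by
    refine lt_of_le_of_ne hs₁.1 fun h => ?_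
    have := h0 x₁
    simp only [w, ← h] at hlt
    linarith
  have hder : HasDerivAt (fun r => w (r, x₁)) (C.ι (C.D (u s₁)) x₁ + ε) s₁ := by
    have h1 : HasDerivAt (fun r => C.ι (u r) x₁) (C.ι (C.D (u s₁)) x₁) s₁ :=
      hasDerivAt_eval (hu s₁) x₁
    have h2 : HasDerivAt (fun r : ℝ => ε * (1 + r)) ε s₁ := by
      simpa using ((hasDerivAt_id s₁).const_add 1).const_mul ε
    exact h1.fun_add h2
  have hpos : 0 < C.ι (C.D (u s₁)) x₁ + ε := by
    have := C.min_principle (u s₁) x₁ fun y => by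
      have := hmin' s₁ hs₁ y
      simp only [w] at this
      linarith
    linarith
  have h1 := (hasDerivWithinAt_iff_tendsto_slope' (s := Set.Iio s₁) (by simp)).mp
    hder.hasDerivWithinAt
  have h2 := h1.eventually (lt_mem_nhds hpos)
  have h3 : ∀ᶠ r in 𝓝[<] s₁, 0 < r := mem_nhdsWithin_of_mem_nhds (lt_mem_nhds hs₁0)
  obtain ⟨r, hr1, hr2, hr3⟩ := (h2.and (h3.and self_mem_nhdsWithin)).exists
  have hr3' : r < s₁ := hr3
  rw [slope_def_field] at hr1
  have h4 := hmin' r ⟨hr2.le, hr3'.le.trans hs₁.2⟩ x₁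
  have h5 : (w (r, x₁) - w (s₁, x₁)) / (r - s₁) ≤ 0 :=
    div_nonpos_of_nonneg_of_nonpos (by linarith) (by linarith)
  linarith

theorem IsSolution.norm_le [T2Space E] {u : ℝ → W} (hu : C.IsSolution u) {s : ℝ} (hs : 0 ≤ s) :
    ‖C.ι (u s)‖ ≤ ‖C.ι (u 0)‖ := by
  rw [ContinuousMap.norm_le _ (norm_nonneg _)]
  intro x
  have hb := fun y => abs_le.mp ((Real.norm_eq_abs _).symm.le.trans ((C.ι (u 0)).norm_coe_le_norm y))
  have h1 := ((C.isSolution_one.smul ‖C.ι (u 0)‖).add hu).nonneg (fun y => by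
    have := (hb y).1
    simp [C.ι_one]; linarith) hs x
  have h2 := ((C.isSolution_one.smul ‖C.ι (u 0)‖).sub hu).nonneg (fun y => by
    have := (hb y).2
    simp [C.ι_one]; linarith) hs x
  simp only [map_add, map_sub, map_smul, C.ι_one, ContinuousMap.add_apply, ContinuousMap.sub_apply,
    ContinuousMap.smul_apply, ContinuousMap.one_apply, smul_eq_mul, mul_one] at h1 h2
  rw [Real.norm_eq_abs, abs_le]
  constructor <;> linarith

theorem IsSolution.unique [T2Space E] {u v : ℝ → W} (hu : C.IsSolution u) (hv : C.IsSolution v)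
    (h : u 0 = v 0) {s : ℝ} (hs : 0 ≤ s) : u s = v s := by
  have := (hu.sub hv).norm_le hs
  rw [h, sub_self, map_zero, norm_zero, norm_le_zero_iff, map_sub, sub_eq_zero] at this
  exact C.inj this

variable (C)

/-- The solution with a given initial value. -/
noncomputable def sol (f : W) : ℝ → W := (C.exists_solution f).choose

theorem sol_zero (f : W) : C.sol f 0 = f := (C.exists_solution f).choose_spec.1

theorem isSolution_sol (f : W) : C.IsSolution (C.sol f) := (C.exists_solution f).choose_spec.2

variable [T2Space E]

/-- The evolution operator on the core. -/
noncomputable def coreOp (s : ℝ≥0) : W →ₗ[ℝ] W where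
  toFun f := C.sol f s
  map_add' f g := (C.isSolution_sol _).unique ((C.isSolution_sol f).add (C.isSolution_sol g))
    (by simp [sol_zero]) s.2
  map_smul' r f := (C.isSolution_sol _).unique ((C.isSolution_sol f).smul r)
    (by simp [sol_zero]) s.2

theorem coreOp_apply (s : ℝ≥0) (f : W) : C.coreOp s f = C.sol f s := rfl

theorem norm_coreOp_le (s : ℝ≥0) (f : W) : ‖(C.ι ∘ₗ C.coreOp s) f‖ ≤ 1 * ‖C.ι f‖ := by
  have := (C.isSolution_sol f).norm_le s.2
  rw [sol_zero] at this
  simpa [coreOp_apply] using this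

theorem coreOp_add (r s : ℝ≥0) (f : W) : C.coreOp (r + s) f = C.coreOp r (C.coreOp s f) := by
  rw [add_comm]
  exact ((C.isSolution_sol f).shift s).unique (C.isSolution_sol _) (by simp [sol_zero, coreOp]) r.2

/-- The evolution operator on `C(E)`. -/
noncomputable def op (s : ℝ≥0) : C(E, ℝ) →L[ℝ] C(E, ℝ) :=
  (C.ι ∘ₗ C.coreOp s).extendOfNorm C.ι

theorem op_apply (s : ℝ≥0) (f : W) : C.op s (C.ι f) = C.ι (C.coreOp s f) :=
  LinearMap.extendOfNorm_eq C.dense ⟨1, C.norm_coreOp_le s⟩ f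

theorem norm_op_le (s : ℝ≥0) : ‖C.op s‖ ≤ 1 :=
  LinearMap.opNorm_extendOfNorm_le C.dense zero_le_one (C.norm_coreOp_le s)

theorem norm_op_apply_le (s : ℝ≥0) (f : C(E, ℝ)) : ‖C.op s f‖ ≤ ‖f‖ := by
  simpa using (C.op s).le_of_opNorm_le (C.norm_op_le s) f

omit [T2Space E] in
theorem eq_of_forall_ι {A B : C(E, ℝ) →L[ℝ] C(E, ℝ)} (h : ∀ f, A (C.ι f) = B (C.ι f)) : A = B :=
  ContinuousLinearMap.ext fun f =>
    C.dense.induction (P := fun f => A f = B f) (by rintro _ ⟨f, rfl⟩; exact h f)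
      (isClosed_eq A.continuous B.continuous) f

/-- The contraction semigroup generated by the closure of `D`. -/
noncomputable def semigroup : ContractionSemigroup C(E, ℝ) where
  op := C.op
  op_zero := C.eq_of_forall_ι fun f => by
    rw [op_apply]; simp [coreOp, sol_zero]
  op_add r s := C.eq_of_forall_ι fun f => by
    simp [op_apply, coreOp_add]
  norm_op_le := C.norm_op_le
  continuous_op f := by
    have hlip : ∀ s (f g : C(E, ℝ)), dist (C.op s f) (C.op s g) ≤ dist f g := fun s f g => by
      rw [dist_eq_norm, dist_eq_norm, ← map_sub]
      exact C.norm_op_apply_le s _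
    have hclosed : IsClosed {f : C(E, ℝ) | Continuous fun s => C.op s f} := by
      rw [← isSeqClosed_iff_isClosed]
      intro g f hg hf
      have hunif : TendstoUniformly (fun n s => C.op s (g n)) (fun s => C.op s f) atTop := by
        rw [Metric.tendstoUniformly_iff]
        intro ε hε
        filter_upwards [(Metric.tendsto_nhds.mp hf) ε hε] with n hn s
        exact (hlip s _ _).trans_lt (by rwa [dist_comm])
      exact hunif.continuous (Frequently.of_forall hg)
    refine C.dense.induction (P := fun f => Continuous fun s => C.op s f) ?_ hclosed f
    rintro _ ⟨f, rfl⟩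
    simp only [op_apply]
    exact (C.isSolution_sol f).continuous.comp NNReal.continuous_coe

theorem isFeller_semigroup : IsFeller C.semigroup := by
  constructor
  · intro s f hf x
    obtain ⟨g, hg⟩ := mem_closure_iff_seq_limit.mp (C.dense f)
    have hcore : ∀ h : W, ∀ δ : ℝ, (∀ y, -δ ≤ C.ι h y) → -δ ≤ C.op s (C.ι h) x := by
      intro h δ hh
      have := ((C.isSolution_one.smul δ).add (C.isSolution_sol h)).nonneg (fun y => by
        have := hh y
        simp [C.ι_one, sol_zero]; linarith) s.2 x
      rw [op_apply]
      rw [coreOp_apply]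
      simpa [C.ι_one, neg_le_iff_add_nonneg'] using this
    have hlim : Tendsto (fun n => C.op s (g n) x + ‖g n - f‖) atTop (𝓝 (C.op s f x + 0)) := by
      refine Tendsto.add ?_ ?_
      · exact ((ContinuousMap.evalCLM ℝ x).continuous.comp (C.op s).continuous).continuousAt.tendsto.comp hg.2
      · exact (tendsto_iff_norm_sub_tendsto_zero.mp hg.2)
    rw [add_zero] at hlim
    refine ge_of_tendsto' hlim fun n => ?_
    obtain ⟨h, hh⟩ := hg.1 n
    have := hcore h ‖g n - f‖ fun y => by
      have h1 := (abs_le.mp ((Real.norm_eq_abs _).symm.le.trans ((g n - f).norm_coe_le_norm y))).1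
      have h2 := hf y
      rw [hh]
      simp only [ContinuousMap.sub_apply] at h1
      linarith
    rw [hh] at this
    linarith
  · intro s
    have h : C.coreOp s C.one = C.one :=
      (C.isSolution_sol _).unique C.isSolution_one (by simp [sol_zero]) s.2
    change C.op s 1 = 1
    rw [← C.ι_one, op_apply, h]

omit [T2Space E] in
theorem norm_le_sub_D (f : W) : ‖C.ι f‖ ≤ ‖C.ι (f - C.D f)‖ := by
  have key : ∀ f : W, ∀ x, -‖C.ι (f - C.D f)‖ ≤ C.ι f x := by
    intro f x
    obtain ⟨y, -, hy⟩ := isCompact_univ.exists_isMinOn ⟨x, trivial⟩ (C.ι f).continuous.continuousOn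
    have hy' : ∀ z, C.ι f y ≤ C.ι f z := fun z => hy trivial
    have h1 := C.min_principle f y hy'
    have h2 := (abs_le.mp ((Real.norm_eq_abs _).symm.le.trans
      ((C.ι (f - C.D f)).norm_coe_le_norm y))).1
    have h3 := hy' x
    simp only [map_sub, ContinuousMap.sub_apply] at h2 ⊢
    linarith
  rw [ContinuousMap.norm_le _ (norm_nonneg _)]
  intro x
  rw [Real.norm_eq_abs, abs_le]
  refine ⟨key f x, ?_⟩
  have := key (-f) x
  rw [map_neg, ← neg_add', ← sub_eq_add_neg, map_neg, norm_neg, map_neg,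
    ContinuousMap.neg_apply] at this
  linarith

omit [T2Space E] in
theorem exists_sub_D_eq (g : W) : ∃ f, f - C.D f = g := by
  obtain ⟨V, hg, hV, hD⟩ := C.exhaust g
  let A : V →ₗ[ℝ] V := LinearMap.id - C.D.restrict hD
  have hinj : Function.Injective A := by
    rw [← LinearMap.ker_eq_bot, LinearMap.ker_eq_bot']
    intro v hv
    have h1 : (v : W) - C.D v = 0 := by simpa [A] using congrArg Subtype.val hv
    have h2 := C.norm_le_sub_D v
    rw [h1, map_zero, norm_zero, norm_le_zero_iff] at h2
    exact Subtype.ext (C.inj (by simpa using h2))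
  obtain ⟨v, hv⟩ := (LinearMap.injective_iff_surjective.mp hinj) ⟨g, hg⟩
  exact ⟨v, by simpa [A] using congrArg Subtype.val hv⟩

/-- The graph of `D` in `C(E) × C(E)`. -/
noncomputable def graph : Submodule ℝ (C(E, ℝ) × C(E, ℝ)) := LinearMap.range (C.ι.prod (C.ι ∘ₗ C.D))

/-- The difference quotients of the semigroup. -/
noncomputable def quotient (f : C(E, ℝ)) (s : ℝ≥0) : C(E, ℝ) := (s : ℝ)⁻¹ • (C.op s f - f)

theorem norm_quotient_sub_le {s : ℝ≥0} (hs : 0 < s) {f g : C(E, ℝ)} {δ : ℝ}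
    (hfg : (f, g) ∈ C.graph.topologicalClosure) (hδ : ∀ r ≤ s, ‖C.op r g - g‖ ≤ δ) :
    ‖C.quotient f s - g‖ ≤ δ := by
  have hcore : ∀ (h : W), ‖C.op s (C.ι h) - C.ι h - (s : ℝ) • g‖ ≤
      (δ + ‖C.ι (C.D h) - g‖) * s := by
    intro h
    have hder : ∀ r : ℝ, HasDerivAt (fun r : ℝ => C.ι (C.sol h r) - r • g)
        (C.ι (C.D (C.sol h r)) - g) r := fun r => by
      simpa using (C.isSolution_sol h r).fun_sub ((hasDerivAt_id r).smul_const g)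
    have hcomm : ∀ r : ℝ≥0, C.ι (C.D (C.sol h r)) = C.op r (C.ι (C.D h)) := by
      intro r
      have hlim : ∀ r : ℝ, 0 ≤ r → Tendsto (fun s : ℝ≥0 => C.quotient (C.ι (C.sol h r)) s)
          (𝓝[>] 0) (𝓝 (C.ι (C.D (C.sol h r)))) := by
        intro r hr
        have h1 := (hasDerivAt_iff_tendsto_slope_zero.mp (C.isSolution_sol h r)).mono_left
          (nhdsWithin_mono (0 : ℝ) (s := Set.Ioi 0) fun x (hx : 0 < x) => hx.ne')
        have h2 : Tendsto (fun s : ℝ≥0 => (s : ℝ)) (𝓝[>] 0) (𝓝[>] 0) := by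
          refine tendsto_nhdsWithin_iff.mpr ⟨?_, ?_⟩
          · exact (NNReal.continuous_coe.tendsto 0).mono_left nhdsWithin_le_nhds
          · filter_upwards [self_mem_nhdsWithin] with s hs
            exact_mod_cast hs
        refine (h1.comp h2).congr fun s => ?_
        have h3 : C.coreOp s (C.sol h r) = C.sol h (r + s) :=
          (C.isSolution_sol _).unique ((C.isSolution_sol h).shift r) (by simp [sol_zero]) s.2
        simp [quotient, op_apply, h3]
      have h1 := ((C.op r).continuous.tendsto _).comp (hlim 0 le_rfl)
      refine tendsto_nhds_unique (hlim r r.2) ?_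
      rw [sol_zero] at h1
      refine h1.congr fun s => ?_
      have h4 : C.op s (C.op r (C.ι h)) = C.op r (C.op s (C.ι h)) := by
        rw [op_apply, op_apply, op_apply, op_apply, ← coreOp_add, ← coreOp_add, add_comm]
      have h5 : C.ι (C.sol h r) = C.op r (C.ι h) := by rw [op_apply]; rfl
      simp only [Function.comp, quotient, map_smul, map_sub, h5, h4]
    have hb : ∀ r ∈ Set.Ico (0 : ℝ) s, ‖C.ι (C.D (C.sol h r)) - g‖ ≤
        δ + ‖C.ι (C.D h) - g‖ := by
      intro r hr
      lift r to ℝ≥0 using hr.1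
      rw [hcomm r]
      have h1 : C.op r (C.ι (C.D h)) - g = (C.op r g - g) + C.op r (C.ι (C.D h) - g) := by
        rw [map_sub]; abel
      rw [h1]
      refine (norm_add_le _ _).trans (add_le_add (hδ r (by exact_mod_cast hr.2.le)) ?_)
      exact C.norm_op_apply_le r _
    have := norm_image_sub_le_of_norm_deriv_le_segment'
      (fun r _ => (hder r).hasDerivWithinAt) hb s ⟨s.2, le_rfl⟩
    simp only [sol_zero, zero_smul, sub_zero] at this
    rw [op_apply]
    rwa [sub_right_comm] at this
  have hs' : (0 : ℝ) < s := by exact_mod_cast hs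
  have hlim : ‖C.op s f - f - (s : ℝ) • g‖ ≤ δ * s := by
    have hclosed : IsClosed {p : C(E, ℝ) × C(E, ℝ) |
        ‖C.op s p.1 - p.1 - (s : ℝ) • g‖ ≤ (δ + ‖p.2 - g‖) * s} :=
      isClosed_le (by fun_prop) (by fun_prop)
    have hsub := closure_minimal (s := (C.graph : Set (C(E, ℝ) × C(E, ℝ)))) (by
      rintro _ ⟨h, rfl⟩
      exact hcore h) hclosed
    simpa using hsub hfg
  have h1 : C.quotient f s - g = (s : ℝ)⁻¹ • (C.op s f - f - (s : ℝ) • g) := by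
    rw [quotient, smul_sub _ _ ((s : ℝ) • g), smul_smul, inv_mul_cancel₀ hs'.ne', one_smul]
  rw [h1, norm_smul, norm_inv, Real.norm_of_nonneg hs'.le, inv_mul_le_iff₀ hs', mul_comm]
  exact hlim

theorem tendsto_quotient {f g : C(E, ℝ)} (hfg : (f, g) ∈ C.graph.topologicalClosure) :
    Tendsto (C.quotient f) (𝓝[>] 0) (𝓝 g) := by
  rw [Metric.tendsto_nhds]
  intro ε hε
  have hc := (C.semigroup.continuous_op g).tendsto 0
  have h0 : C.semigroup.op 0 g = g := by rw [C.semigroup.op_zero]; rfl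
  rw [h0] at hc
  obtain ⟨η, hη, h⟩ := Metric.eventually_nhds_iff.mp ((Metric.tendsto_nhds.mp hc) (ε / 2) (by linarith))
  have h1 : ∀ᶠ s : ℝ≥0 in 𝓝[>] 0, dist s 0 < η :=
    mem_nhdsWithin_of_mem_nhds (Metric.ball_mem_nhds 0 hη)
  filter_upwards [h1, self_mem_nhdsWithin] with s hs hs0
  rw [dist_eq_norm]
  refine (C.norm_quotient_sub_le hs0 hfg (δ := ε / 2) fun r hr => ?_).trans_lt (by linarith)
  rw [← dist_eq_norm]
  refine (h ?_).le
  refine lt_of_le_of_lt ?_ hs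
  rw [NNReal.dist_eq, NNReal.dist_eq]
  simpa using hr

theorem eq_zero_of_tendsto_quotient_self {f : C(E, ℝ)}
    (h : Tendsto (C.quotient f) (𝓝[>] 0) (𝓝 f)) : f = 0 := by
  have h1 : Tendsto (fun s => ‖C.quotient f s - f‖) (𝓝[>] 0) (𝓝 0) :=
    tendsto_iff_norm_sub_tendsto_zero.mp h
  have h2 : ∀ᶠ s : ℝ≥0 in 𝓝[>] 0, ‖f‖ ≤ ‖C.quotient f s - f‖ := by
    filter_upwards [self_mem_nhdsWithin] with s hs
    have hs' : (0 : ℝ) < s := by exact_mod_cast hs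
    have e : (1 + (s : ℝ)⁻¹) • f = (s : ℝ)⁻¹ • C.op s f - (C.quotient f s - f) := by
      rw [quotient]; module
    have h3 : ‖(1 + (s : ℝ)⁻¹) • f‖ ≤ (s : ℝ)⁻¹ * ‖f‖ + ‖C.quotient f s - f‖ := by
      rw [e]
      refine (norm_sub_le _ _).trans (add_le_add_left ?_ _)
      rw [norm_smul, norm_inv, Real.norm_of_nonneg hs'.le]
      exact mul_le_mul_of_nonneg_left (C.norm_op_apply_le s f) (by positivity)
    rw [norm_smul, Real.norm_of_nonneg (by positivity)] at h3
    linarith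
  have : ‖f‖ ≤ 0 := ge_of_tendsto h1 h2
  simpa using this

theorem mem_closure_graph_iff {f g : C(E, ℝ)} :
    (f, g) ∈ C.graph.topologicalClosure ↔ Tendsto (C.quotient f) (𝓝[>] 0) (𝓝 g) := by
  refine ⟨C.tendsto_quotient, fun h => ?_⟩
  obtain ⟨u, hu, hulim⟩ := mem_closure_iff_seq_limit.mp (C.dense (f - g))
  choose v hv using hu
  choose w hw using fun n => C.exists_sub_D_eq (v n)
  have hcauchy : CauchySeq fun n => C.ι (w n) := by
    rw [Metric.cauchySeq_iff]
    intro ε hε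
    obtain ⟨n₀, hn₀⟩ := Metric.cauchySeq_iff.mp hulim.cauchySeq ε hε
    refine ⟨n₀, fun m hm n hn => lt_of_le_of_lt ?_ (hn₀ m hm n hn)⟩
    rw [dist_eq_norm, dist_eq_norm, ← map_sub, ← hv, ← hv, ← map_sub, ← hw, ← hw]
    refine (C.norm_le_sub_D (w m - w n)).trans_eq ?_
    rw [map_sub C.D, sub_sub_sub_comm]
  obtain ⟨f', hf'⟩ := cauchySeq_tendsto_of_complete hcauchy
  have hDlim : Tendsto (fun n => C.ι (C.D (w n))) atTop (𝓝 (f' - (f - g))) := by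
    refine (hf'.sub hulim).congr fun n => ?_
    rw [← hv, ← hw, map_sub]; abel
  have hmem : (f', f' - (f - g)) ∈ C.graph.topologicalClosure := by
    refine mem_closure_of_tendsto (hf'.prodMk_nhds hDlim) (Eventually.of_forall fun n => ?_)
    exact ⟨w n, rfl⟩
  have hz : f - f' = 0 := by
    refine C.eq_zero_of_tendsto_quotient_self ?_
    have := h.sub (C.tendsto_quotient hmem)
    have e : g - (f' - (f - g)) = f - f' := by abel
    rw [e] at this
    refine this.congr fun s => ?_
    simp only [quotient, ← smul_sub, map_sub]
    congr 1
    abel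
  have : f' = f := (sub_eq_zero.mp hz).symm
  subst this
  simpa using hmem

theorem exists_pregenerator : ∃ A : C(E, ℝ) →ₗ.[ℝ] C(E, ℝ),
    (∀ φ ψ, (φ, ψ) ∈ A.graph ↔ ∃ f, φ = C.ι f ∧ ψ = C.ι (C.D f)) ∧ IsPregenerator A C.semigroup := by
  have huniq : ∀ p ∈ C.graph.topologicalClosure, p.1 = 0 → p.2 = 0 := by
    rintro ⟨f, g⟩ hp rfl
    refine tendsto_nhds_unique (C.tendsto_quotient hp) ?_
    refine tendsto_const_nhds.congr fun s => ?_
    simp [quotient]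
  have hA : C.graph.toLinearPMap.graph = C.graph :=
    C.graph.toLinearPMap_graph_eq fun p hp => huniq p (subset_closure hp)
  have hcl : C.graph.toLinearPMap.IsClosable :=
    ⟨C.graph.topologicalClosure.toLinearPMap, by
      rw [hA, Submodule.toLinearPMap_graph_eq _ huniq]⟩
  refine ⟨C.graph.toLinearPMap, fun φ ψ => ?_, hcl, fun f g => ?_⟩
  · rw [hA]
    constructor
    · rintro ⟨f, hf⟩
      obtain ⟨h1, h2⟩ := Prod.mk.inj hf
      exact ⟨f, h1.symm, h2.symm⟩
    · rintro ⟨f, rfl, rfl⟩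
      exact ⟨f, rfl⟩
  · rw [← hcl.graph_closure_eq_closure_graph, hA, mem_closure_graph_iff]
    rfl

end FellerCore

end QJacobi

namespace QJacobi

/-! ## Transition functions of Feller semigroups -/

theorem exists_measure_of_positive {X : Type*} [TopologicalSpace X] [CompactSpace X] [T2Space X]
    [MeasurableSpace X] [BorelSpace X] (L : C(X, ℝ) →ₗ[ℝ] ℝ)
    (hpos : ∀ f : C(X, ℝ), (∀ x, 0 ≤ f x) → 0 ≤ L f) (hone : L 1 = 1) :
    ∃ μ : Measure X, IsProbabilityMeasure μ ∧ ∀ f : C(X, ℝ), ∫ x, f x ∂μ = L f := by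
  let L' : CompactlySupportedContinuousMap X ℝ →ₚ[ℝ] ℝ := PositiveLinearMap.mk₀
    { toFun := fun f => L f
      map_add' := fun f g => by rw [← map_add]; rfl
      map_smul' := fun r f => by rw [RingHom.id_apply, ← map_smul]; rfl }
    fun f hf => hpos f hf
  have key : ∀ f : C(X, ℝ), ∫ x, f x ∂(RealRMK.rieszMeasure L') = L f := fun f =>
    RealRMK.integral_rieszMeasure L' (CompactlySupportedContinuousMap.continuousMapEquiv f)
  refine ⟨RealRMK.rieszMeasure L', ⟨?_⟩, key⟩
  have h1 := key 1
  simp only [ContinuousMap.one_apply, integral_const, smul_eq_mul, mul_one, hone] at h1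
  rw [Measure.real, ENNReal.toReal_eq_one_iff] at h1
  exact h1

theorem exists_isTransitionFunction {E : Type*} [TopologicalSpace E] [CompactSpace E] [T2Space E]
    [HasOuterApproxClosed E] [MeasurableSpace E] [BorelSpace E]
    (T : ContractionSemigroup C(E, ℝ)) (hT : IsFeller T) :
    ∃ p : ℝ≥0 → Kernel E E, IsTransitionFunction p T := by
  have h : ∀ (s : ℝ≥0) (x : E), ∃ μ : Measure E, IsProbabilityMeasure μ ∧
      ∀ f : C(E, ℝ), ∫ y, f y ∂μ = T.op s f x := fun s x => by
    refine exists_measure_of_positive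
      (((ContinuousMap.evalCLM ℝ x).comp (T.op s) : C(E, ℝ) →L[ℝ] ℝ) : C(E, ℝ) →ₗ[ℝ] ℝ)
      (fun f hf => hT.1 s f hf x) ?_
    change T.op s 1 x = 1
    rw [hT.2]
    rfl
  choose μ hμ hint using h
  have hmeas : ∀ s, Measurable (μ s) := fun s => by
    refine Measurable.measure_of_isPiSystem_of_isProbabilityMeasure
      (S := {F | IsClosed F}) ?_ isPiSystem_isClosed fun F hF => ?_
    · rw [BorelSpace.measurable_eq (α := E), borel_eq_generateFrom_isClosed]
    · have hF' : IsClosed F := hF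
      refine measurable_of_tendsto_metrizable (f := fun n x => ∫⁻ y, hF'.apprSeq n y ∂(μ s x))
        (fun n => ?_) (tendsto_pi_nhds.mpr fun x => HasOuterApproxClosed.tendsto_lintegral_apprSeq hF' (μ s x))
      let g : C(E, ℝ) := ⟨fun y => (hF'.apprSeq n y : ℝ),
        NNReal.continuous_coe.comp (hF'.apprSeq n).continuous⟩
      have hg : ∀ x, ∫⁻ y, hF'.apprSeq n y ∂(μ s x) = ENNReal.ofReal (T.op s g x) := fun x => by
        have hgi : ∫ y, g y ∂(μ s x) = (∫⁻ y, hF'.apprSeq n y ∂(μ s x)).toReal :=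
          (BoundedContinuousFunction.toReal_lintegral_coe_eq_integral _ _).symm
        rw [← hint s x g, hgi, ENNReal.ofReal_toReal]
        exact (BoundedContinuousFunction.lintegral_lt_top_of_nnreal (μ s x) (hF'.apprSeq n)).ne
      simp_rw [hg]
      exact ((T.op s g).continuous.measurable).ennreal_ofReal
  exact ⟨fun s => ⟨μ s, hmeas s⟩, fun s => ⟨fun x => hμ s x⟩, fun s f x => (hint s x f).symm⟩

/-! ## Markov processes of Feller semigroups -/

/-- The space of all paths. -/
def PathSpace (E : Type*) : Type _ := ℝ≥0 → E

variable {E : Type*} [TopologicalSpace E] [CompactSpace E]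

instance : TopologicalSpace (PathSpace E) := inferInstanceAs (TopologicalSpace (ℝ≥0 → E))

instance : CompactSpace (PathSpace E) := inferInstanceAs (CompactSpace (ℝ≥0 → E))

instance [T2Space E] : T2Space (PathSpace E) := inferInstanceAs (T2Space (ℝ≥0 → E))

instance : MeasurableSpace (PathSpace E) := borel _

instance : BorelSpace (PathSpace E) := ⟨rfl⟩

omit [CompactSpace E] in
theorem PathSpace.continuous_eval (r : ℝ≥0) : Continuous fun x : PathSpace E => x r :=
  continuous_apply r

/-- The operator `T u` acting on the second variable. -/
noncomputable def applySnd (T : ContractionSemigroup C(E, ℝ)) (u : ℝ≥0) :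
    C(PathSpace E × E, ℝ) →ₗ[ℝ] C(PathSpace E × E, ℝ) where
  toFun F := ⟨fun p => T.op u (F.curry p.1) p.2, by
    have h : Continuous fun p : PathSpace E × E => T.op u (F.curry p.1) := by fun_prop
    exact h.eval continuous_snd⟩
  map_add' F G := by
    ext p
    change T.op u ((F + G).curry p.1) p.2 = _
    have : (F + G).curry p.1 = F.curry p.1 + G.curry p.1 := rfl
    rw [this, map_add]
    rfl
  map_smul' r F := by
    ext p
    change T.op u ((r • F).curry p.1) p.2 = _
    have : (r • F).curry p.1 = r • F.curry p.1 := rfl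
    rw [this, map_smul]
    rfl

theorem applySnd_apply (T : ContractionSemigroup C(E, ℝ)) (u : ℝ≥0) (F : C(PathSpace E × E, ℝ))
    (p : PathSpace E × E) : applySnd T u F p = T.op u (F.curry p.1) p.2 := rfl

theorem applySnd_zero (T : ContractionSemigroup C(E, ℝ)) (F : C(PathSpace E × E, ℝ)) :
    applySnd T 0 F = F := by
  ext p
  rw [applySnd_apply, T.op_zero]
  rfl

theorem applySnd_applySnd (T : ContractionSemigroup C(E, ℝ)) (u v : ℝ≥0)
    (F : C(PathSpace E × E, ℝ)) : applySnd T u (applySnd T v F) = applySnd T (u + v) F := by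
  ext p
  rw [applySnd_apply, applySnd_apply, T.op_add]
  rfl

/-- Substitution of the value of the path at time `r` for the second variable. -/
noncomputable def diag (r : ℝ≥0) : C(PathSpace E × E, ℝ) →ₗ[ℝ] C(PathSpace E, ℝ) where
  toFun F := ⟨fun x => F (x, x r),
    F.continuous.comp (continuous_id.prodMk (PathSpace.continuous_eval r))⟩
  map_add' _ _ := rfl
  map_smul' _ _ := rfl

omit [CompactSpace E] in
theorem diag_apply (r : ℝ≥0) (F : C(PathSpace E × E, ℝ)) (x : PathSpace E) :
    diag r F x = F (x, x r) := rfl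

/-- The path `x` with its value at time `r` replaced by `y`. -/
noncomputable def PathSpace.update (r : ℝ≥0) (p : PathSpace E × E) : PathSpace E :=
  Function.update p.1 r p.2

omit [TopologicalSpace E] [CompactSpace E] in
theorem PathSpace.update_self (r : ℝ≥0) (p : PathSpace E × E) : PathSpace.update r p r = p.2 := by
  exact Function.update_self r p.2 p.1

omit [TopologicalSpace E] [CompactSpace E] in
theorem PathSpace.update_of_ne {r s : ℝ≥0} (h : s ≠ r) (p : PathSpace E × E) :
    PathSpace.update r p s = p.1 s := by
  exact Function.update_of_ne h p.2 p.1

omit [CompactSpace E] in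
theorem PathSpace.continuous_update (r : ℝ≥0) :
    Continuous (PathSpace.update (E := E) r) := by
  refine continuous_pi fun i => ?_
  by_cases hi : i = r
  · subst hi
    simpa only [PathSpace.update_self] using continuous_snd
  · simp only [PathSpace.update_of_ne hi]
    exact (PathSpace.continuous_eval i).comp continuous_fst

/-- Functions of the modified path. -/
noncomputable def onUpdate (r : ℝ≥0) : C(PathSpace E, ℝ) →ₗ[ℝ] C(PathSpace E × E, ℝ) where
  toFun F := F.comp ⟨_, PathSpace.continuous_update r⟩
  map_add' _ _ := rfl
  map_smul' _ _ := rfl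

omit [CompactSpace E] in
theorem onUpdate_apply (r : ℝ≥0) (F : C(PathSpace E, ℝ)) (p : PathSpace E × E) :
    onUpdate r F p = F (PathSpace.update r p) := rfl

/-- `F x y` depends on the path `x` only through its values at times in `J` not later than `s`. -/
def DependsOnPast (J : Finset ℝ≥0) (s : ℝ≥0) (F : C(PathSpace E × E, ℝ)) : Prop :=
  ∀ x x' : PathSpace E, (∀ r ∈ J, r ≤ s → x r = x' r) → F.curry x = F.curry x'

/-- A positive normalized functional on continuous functions of paths, with a given initial
functional, which has the Markov property with transition operators `T` at times in `J`. -/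
structure IsMarkovState (T : ContractionSemigroup C(E, ℝ)) (ν : C(E, ℝ) → ℝ) (J : Finset ℝ≥0)
    (L : C(PathSpace E, ℝ) →ₗ[ℝ] ℝ) : Prop where
  nonneg : ∀ F : C(PathSpace E, ℝ), (∀ x, 0 ≤ F x) → 0 ≤ L F
  map_one : L 1 = 1
  initial : ∀ φ : C(E, ℝ), L (φ.comp ⟨_, PathSpace.continuous_eval 0⟩) = ν φ
  markov : ∀ s u, s ∈ J → s + u ∈ J → ∀ F, DependsOnPast J s F →
    L (diag (s + u) F) = L (diag s (applySnd T u F))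

theorem IsFeller.op_const {T : ContractionSemigroup C(E, ℝ)} (hT : IsFeller T) (u : ℝ≥0) (r : ℝ) :
    T.op u (ContinuousMap.const E r) = ContinuousMap.const E r := by
  have : ContinuousMap.const E r = r • (1 : C(E, ℝ)) := by ext; simp
  rw [this, map_smul, hT.2]

theorem IsMarkovState.insert {T : ContractionSemigroup C(E, ℝ)} (hT : IsFeller T)
    {ν : C(E, ℝ) → ℝ} {J : Finset ℝ≥0} {L : C(PathSpace E, ℝ) →ₗ[ℝ] ℝ}
    (hL : IsMarkovState T ν J L) (hJ : J.Nonempty) {t : ℝ≥0} (ht : ∀ r ∈ J, r < t) :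
    IsMarkovState T ν (insert t J)
      (L ∘ₗ diag (J.max' hJ) ∘ₗ applySnd T (t - J.max' hJ) ∘ₗ onUpdate t) := by
  classical
  set m := J.max' hJ with hm
  have hmJ : m ∈ J := J.max'_mem hJ
  have hmt : m < t := ht m hmJ
  have hind : ∀ G : C(PathSpace E, ℝ), (∀ p, G (PathSpace.update t p) = G p.1) →
      diag m (applySnd T (t - m) (onUpdate t G)) = G := by
    intro G hG
    ext x
    have : (onUpdate t G).curry x = ContinuousMap.const E (G x) := by
      ext y
      exact hG (x, y)
    rw [diag_apply, applySnd_apply, this, hT.op_const]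
    rfl
  have ht0 : (0 : ℝ≥0) ≠ t := (lt_of_le_of_lt zero_le hmt).ne
  refine ⟨fun F hF => ?_, ?_, fun φ => ?_, ?_⟩
  · exact hL.nonneg _ fun x => hT.1 _ _ (fun y => hF _) _
  · rw [LinearMap.comp_apply, LinearMap.comp_apply, LinearMap.comp_apply, hind 1 fun p => rfl,
      hL.map_one]
  · rw [LinearMap.comp_apply, LinearMap.comp_apply, LinearMap.comp_apply, hind, hL.initial]
    intro p
    simp [PathSpace.update_of_ne ht0]
  · intro s u hs hsu F hF
    simp only [LinearMap.comp_apply]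
    rcases Finset.mem_insert.mp hs with rfl | hs
    · have hu : u = 0 := by
        rcases Finset.mem_insert.mp hsu with h | h
        · simpa using h
        · exact absurd (ht _ h) (not_lt.mpr le_self_add)
      subst hu
      rw [add_zero, applySnd_zero]
    · have hst : s < t := ht s hs
      have hF' : DependsOnPast J s F := fun x x' h => hF x x' fun r hr hrs =>
        h r (Finset.mem_of_mem_insert_of_ne hr (hrs.trans_lt hst).ne) hrs
      have hupd : ∀ p : PathSpace E × E, F.curry (PathSpace.update t p) = F.curry p.1 := fun p =>
        hF _ _ fun r _ hrs => PathSpace.update_of_ne (hrs.trans_lt hst).ne p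
      rw [hind (diag s (applySnd T u F))]
      · rcases Finset.mem_insert.mp hsu with h | h
        · have h1 : onUpdate t (diag (s + u) F) = F := by
            ext ⟨x, y⟩
            rw [onUpdate_apply, diag_apply, h, PathSpace.update_self]
            exact DFunLike.congr_fun (hupd (x, y)) y
          obtain ⟨v, hv⟩ := exists_add_of_le (J.le_max' s hs)
          rw [← hm] at hv
          rw [h1]
          have h2 := hL.markov s v hs (hv ▸ hmJ) (applySnd T (t - m) F) fun x x' h => by
            have := hF' x x' h
            ext y
            change T.op _ (F.curry x) y = T.op _ (F.curry x') y
            rw [this]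
          rw [← hv, applySnd_applySnd] at h2
          rw [h2]
          have h3 : v + (t - m) = u := by
            apply add_left_cancel (a := s)
            rw [← add_assoc, ← hv, add_tsub_cancel_of_le hmt.le, h]
          rw [h3]
        · rw [hind (diag (s + u) F)]
          · exact hL.markov s u hs h F hF'
          · intro p
            rw [diag_apply, diag_apply, PathSpace.update_of_ne (ht _ h).ne]
            exact DFunLike.congr_fun (hupd p) _
      · intro p
        rw [diag_apply, diag_apply, PathSpace.update_of_ne hst.ne, applySnd_apply, applySnd_apply,
          hupd p]

theorem exists_isMarkovState_finset {T : ContractionSemigroup C(E, ℝ)} (hT : IsFeller T)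
    (ν : C(E, ℝ) →ₗ[ℝ] ℝ) (hpos : ∀ φ : C(E, ℝ), (∀ x, 0 ≤ φ x) → 0 ≤ ν φ) (hone : ν 1 = 1)
    (J : Finset ℝ≥0) : ∃ L, IsMarkovState T ν (insert 0 J) L := by
  classical
  induction J using Finset.induction_on_max with
  | empty =>
    let c : C(E, PathSpace E) := ⟨fun y _ => y, continuous_pi fun _ => continuous_id⟩
    refine ⟨{ toFun := fun F => ν (F.comp c), map_add' := fun F G => ?_,
              map_smul' := fun r F => ?_ }, fun F hF => hpos _ fun x => hF _, hone,
              fun φ => ?_, ?_⟩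
    · rw [← map_add]; rfl
    · rw [RingHom.id_apply, ← map_smul]; rfl
    · rfl
    · intro s u hs hsu F _
      simp only [insert_empty_eq, Finset.mem_singleton] at hs hsu
      subst hs
      rw [zero_add] at hsu
      subst hsu
      rw [applySnd_zero, add_zero]
  | insert t J ht ih =>
    obtain ⟨L, hL⟩ := ih
    rcases eq_or_lt_of_le (zero_le (a := t)) with rfl | h0
    · exact ⟨L, by rwa [Finset.insert_idem]⟩
    · rw [Finset.insert_comm]
      exact ⟨_, hL.insert hT ⟨0, Finset.mem_insert_self _ _⟩ fun r hr => by
        rcases Finset.mem_insert.mp hr with rfl | hr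
        · exact h0
        · exact ht r hr⟩

theorem IsMarkovState.abs_le {T : ContractionSemigroup C(E, ℝ)} {ν : C(E, ℝ) → ℝ}
    {J : Finset ℝ≥0} {L : C(PathSpace E, ℝ) →ₗ[ℝ] ℝ} (hL : IsMarkovState T ν J L)
    (F : C(PathSpace E, ℝ)) : L F ∈ Set.Icc (-‖F‖) ‖F‖ := by
  have hb := fun y => _root_.abs_le.mp ((Real.norm_eq_abs _).symm.le.trans (F.norm_coe_le_norm y))
  have h1 := hL.nonneg (‖F‖ • 1 + F) fun x => by
    have := (hb x).1
    simp; linarith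
  have h2 := hL.nonneg (‖F‖ • 1 - F) fun x => by
    have := (hb x).2
    simp; linarith
  simp only [map_add, map_sub, map_smul, hL.map_one, smul_eq_mul, mul_one] at h1 h2
  constructor <;> linarith

theorem exists_isMarkovState {T : ContractionSemigroup C(E, ℝ)} (hT : IsFeller T)
    (ν : C(E, ℝ) →ₗ[ℝ] ℝ) (hpos : ∀ φ : C(E, ℝ), (∀ x, 0 ≤ φ x) → 0 ≤ ν φ) (hone : ν 1 = 1) :
    ∃ L, ∀ J, IsMarkovState T ν J L := by
  classical
  choose L hL using exists_isMarkovState_finset hT ν hpos hone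
  let 𝒰 : Ultrafilter (Finset ℝ≥0) := Ultrafilter.of atTop
  have h𝒰 : (𝒰 : Filter (Finset ℝ≥0)) ≤ atTop := Ultrafilter.of_le atTop
  have hex : ∀ F, ∃ l, Tendsto (fun J => L J F) 𝒰 (𝓝 l) := fun F => by
    obtain ⟨l, -, hl⟩ := isCompact_Icc.ultrafilter_le_nhds (𝒰.map fun J => L J F)
      (le_principal_iff.mpr (Eventually.of_forall (f := (𝒰 : Filter (Finset ℝ≥0)))
        fun J => (hL J).abs_le F))
    exact ⟨l, hl⟩
  choose l hl using hex
  refine ⟨{ toFun := l, map_add' := fun F G => ?_, map_smul' := fun r F => ?_ }, fun J =>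
    ⟨fun F hF => ?_, ?_, fun φ => ?_, fun s u _ _ F hF => ?_⟩⟩
  · refine tendsto_nhds_unique (hl (F + G)) ?_
    simpa using (hl F).add (hl G)
  · refine tendsto_nhds_unique (hl (r • F)) ?_
    simpa using (hl F).const_mul r
  · exact ge_of_tendsto' (hl F) fun J => (hL J).nonneg F hF
  · refine tendsto_nhds_unique (hl 1) ?_
    simp [(hL _).map_one]
  · refine tendsto_nhds_unique (hl _) ?_
    simp [(hL _).initial]
  · refine tendsto_nhds_unique (hl (diag (s + u) F)) ((hl (diag s (applySnd T u F))).congr' ?_)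
    filter_upwards [h𝒰 (eventually_ge_atTop (J ∪ {s, s + u}))] with K hK
    refine ((hL K).markov s u ?_ ?_ F ?_).symm
    · exact Finset.mem_insert_of_mem (hK (by simp))
    · exact Finset.mem_insert_of_mem (hK (by simp))
    · exact fun x x' h => hF x x' fun r hr hrs =>
        h r (Finset.mem_insert_of_mem (hK (Finset.mem_union_left _ hr))) hrs

theorem exists_isMarkovProcess {E : Type} [TopologicalSpace E] [CompactSpace E]
    [TopologicalSpace.MetrizableSpace E] [MeasurableSpace E] [BorelSpace E]
    {T : ContractionSemigroup C(E, ℝ)} (hT : IsFeller T) {p : ℝ≥0 → Kernel E E}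
    (hp : IsTransitionFunction p T) (ν : Measure E) [IsProbabilityMeasure ν] :
    ∃ (S : Type) (_ : MeasurableSpace S) (P : Measure S) (X : ℝ≥0 → S → E),
      IsProbabilityMeasure P ∧ IsMarkovProcess P X p ν := by
  classical
  let _ : MetricSpace E := TopologicalSpace.metrizableSpaceMetric E
  have hint : ∀ (m : Measure E) [IsProbabilityMeasure m] (φ : C(E, ℝ)), Integrable φ m :=
    fun m _ φ => φ.continuous.integrable_of_hasCompactSupport (HasCompactSupport.of_compactSpace _)
  obtain ⟨L, hL⟩ := exists_isMarkovState hT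
    { toFun := fun φ : C(E, ℝ) => ∫ x, φ x ∂ν
      map_add' := fun φ ψ => integral_add (hint ν φ) (hint ν ψ)
      map_smul' := fun r φ => integral_const_mul r _ }
    (fun φ hφ => integral_nonneg hφ) (by simp)
  obtain ⟨P, hP, hPL⟩ := exists_measure_of_positive L (hL ∅).nonneg (hL ∅).map_one
  have hX : ∀ r, Measurable fun x : PathSpace E => x r := fun r =>
    (PathSpace.continuous_eval r).measurable
  have hmk : ∀ s, IsMarkovKernel (p s) := hp.1
  refine ⟨PathSpace E, inferInstance, P, fun r x => x r, hP, hX, ?_, fun s u B hB => ?_⟩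
  · have : IsProbabilityMeasure (P.map fun x : PathSpace E => x 0) :=
      Measure.isProbabilityMeasure_map (hX 0).aemeasurable
    refine ext_of_forall_integral_eq_of_IsFiniteMeasure fun f => ?_
    rw [integral_map (hX 0).aemeasurable f.continuous.aestronglyMeasurable]
    exact (hPL _).trans ((hL ∅).initial f.toContinuousMap)
  -- the joint law of finitely many past values and of the value at time `s + u`
  · have hfin : ∀ (I : Finset ℝ≥0), (∀ r ∈ I, r ≤ s) → ∀ A : ℝ≥0 → Set E,
        (∀ r ∈ I, MeasurableSet (A r)) →
        P ((⋂ r ∈ I, (fun x : PathSpace E => x r) ⁻¹' A r) ∩ (fun x => x (s + u)) ⁻¹' B) =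
          ∫⁻ x in ⋂ r ∈ I, (fun x : PathSpace E => x r) ⁻¹' A r, p u (x s) B ∂P := by
      intro I hI A hA
      let res : PathSpace E → (I → E) := fun x r => x r
      have hresc : Continuous res := continuous_pi fun r => PathSpace.continuous_eval r
      let κ : Kernel (PathSpace E) E := (p u).comap (fun x => x s) (hX s)
      let j : PathSpace E × E → (I → E) × E := fun y => (res y.1, y.2)
      have hj : Continuous j := (hresc.comp continuous_fst).prodMk continuous_snd
      have hjm : Measurable j :=
        (hresc.measurable.comp measurable_fst).prodMk measurable_snd
      have hk : Continuous fun x : PathSpace E => (res x, x (s + u)) :=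
        hresc.prodMk (PathSpace.continuous_eval _)
      have hlaw : P.map (fun x => (res x, x (s + u))) = (P ⊗ₘ κ).map j := by
        have i1 : IsProbabilityMeasure (P.map (fun x => (res x, x (s + u)))) :=
          Measure.isProbabilityMeasure_map hk.measurable.aemeasurable
        have i2 : IsProbabilityMeasure ((P ⊗ₘ κ).map j) :=
          Measure.isProbabilityMeasure_map hjm.aemeasurable
        refine ext_of_forall_integral_eq_of_IsFiniteMeasure fun f => ?_
        rw [integral_map hk.measurable.aemeasurable f.continuous.aestronglyMeasurable,
          integral_map hjm.aemeasurable f.continuous.aestronglyMeasurable,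
          Measure.integral_compProd]
        · let F : C(PathSpace E × E, ℝ) := ⟨fun y => f (j y), f.continuous.comp hj⟩
          have h1 := (hL (I ∪ {s, s + u})).markov s u (by simp) (by simp) F ?_
          · rw [← hPL, ← hPL] at h1
            refine h1.trans (integral_congr_ae (Eventually.of_forall fun x => ?_))
            exact hp.2 u (F.curry x) (x s)
          · intro x x' h
            have : res x = res x' := funext fun r =>
              h r (Finset.mem_union_left _ r.2) (hI r r.2)
            ext y
            change f (res x, y) = f (res x', y)
            rw [this]
        · exact Integrable.of_bound (f.continuous.measurable.comp hjm).aestronglyMeasurable ‖f‖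
            (Eventually.of_forall fun y => f.norm_coe_le_norm _)
      have hAm : MeasurableSet (Set.univ.pi fun r : I => A r) :=
        MeasurableSet.univ_pi fun r => hA r r.2
      have hpre : res ⁻¹' (Set.univ.pi fun r : I => A r) =
          ⋂ r ∈ I, (fun x : PathSpace E => x r) ⁻¹' A r := by
        exact Set.ext fun x => ⟨fun h => Set.mem_iInter₂.mpr fun r hr => h ⟨r, hr⟩ trivial,
          fun h r _ => Set.mem_iInter₂.mp h r r.2⟩
      have h2 := congrArg (fun m => m ((Set.univ.pi fun r : I => A r) ×ˢ B)) hlaw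
      beta_reduce at h2
      rw [Measure.map_apply hk.measurable (hAm.prod hB), Measure.map_apply hjm (hAm.prod hB)] at h2
      have e1 : (fun x : PathSpace E => (res x, x (s + u))) ⁻¹'
          ((Set.univ.pi fun r : I => A r) ×ˢ B) =
          (⋂ r ∈ I, (fun x : PathSpace E => x r) ⁻¹' A r) ∩ (fun x => x (s + u)) ⁻¹' B := by
        rw [← hpre]; rfl
      have e2 : j ⁻¹' ((Set.univ.pi fun r : I => A r) ×ˢ B) =
          (⋂ r ∈ I, (fun x : PathSpace E => x r) ⁻¹' A r) ×ˢ B := by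
        rw [← hpre]; rfl
      rw [e1, e2, Measure.compProd_apply_prod _ hB] at h2
      · exact h2
      · rw [← hpre]
        exact hresc.measurable hAm
    have hBm : MeasurableSet ((fun x : PathSpace E => x (s + u)) ⁻¹' B) := hX _ hB
    set m : MeasurableSpace (PathSpace E) :=
      ⨆ r ∈ Set.Iic s, MeasurableSpace.comap (fun x : PathSpace E => x r) inferInstance with hmdef
    have hm : m ≤ instMeasurableSpacePathSpace :=
      iSup₂_le fun r _ => (hX r).comap_le
    have hsm : Measurable[m] fun x : PathSpace E => x s :=
      (comap_measurable _).mono (le_iSup₂ (f := fun r (_ : r ∈ Set.Iic s) =>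
        MeasurableSpace.comap (fun x : PathSpace E => x r) inferInstance) s (Set.mem_Iic.mpr le_rfl)) le_rfl
    have hpB : Measurable fun y => p u y B := Kernel.measurable_coe _ hB
    have htrim : (P.restrict ((fun x : PathSpace E => x (s + u)) ⁻¹' B)).trim hm =
        (P.withDensity fun x => p u (x s) B).trim hm := by
      have hfd : IsFiniteMeasure (P.withDensity fun x => p u (x s) B) :=
        isFiniteMeasure_withDensity (ne_top_of_le_ne_top (b := 1) ENNReal.one_ne_top (by
          refine (lintegral_mono fun x => prob_le_one).trans ?_
          simp))
      have hfd' : IsFiniteMeasure ((P.restrict ((fun x : PathSpace E => x (s + u)) ⁻¹' B)).trim hm) :=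
        isFiniteMeasure_trim hm
      have hpi := generateFrom_piiUnionInter_measurableSet
        (fun r => MeasurableSpace.comap (fun x : PathSpace E => x r) inferInstance) (Set.Iic s)
      have key : ∀ C ∈ piiUnionInter (fun r => {C | MeasurableSet[MeasurableSpace.comap
          (fun x : PathSpace E => x r) inferInstance] C}) (Set.Iic s),
          (P.restrict ((fun x : PathSpace E => x (s + u)) ⁻¹' B)).trim hm C =
          (P.withDensity fun x => p u (x s) B).trim hm C := by
        intro C hC
        have hCm : MeasurableSet[m] C := by
          rw [hmdef, ← hpi]
          exact MeasurableSpace.measurableSet_generateFrom hC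
        rw [trim_measurableSet_eq hm hCm, trim_measurableSet_eq hm hCm,
          Measure.restrict_apply (hm _ hCm), withDensity_apply _ (hm _ hCm)]
        obtain ⟨I, hI, f, hf, rfl⟩ := hC
        choose! A hA hfA using hf
        have e : ⋂ r ∈ I, f r = ⋂ r ∈ I, (fun x : PathSpace E => x r) ⁻¹' A r :=
          Set.iInter₂_congr fun r hr => (hfA r hr).symm
        rw [e]
        exact hfin I (fun r hr => hI hr) A hA
      refine ext_of_generate_finite _ hpi.symm (isPiSystem_piiUnionInter _
        (fun r => @MeasurableSpace.isPiSystem_measurableSet _ (MeasurableSpace.comap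
          (fun x : PathSpace E => x r) inferInstance)) _) key (key _ ?_)
      exact ⟨∅, by simp, fun _ => Set.univ, by simp, by simp⟩
    refine (ae_eq_condExp_of_forall_setIntegral_eq hm ?_ ?_ ?_ ?_).symm
    · exact (integrable_const (1 : ℝ)).indicator hBm
    · intro C hC _
      refine (Integrable.of_bound ?_ 1 (Eventually.of_forall fun x => ?_)).integrableOn
      · exact (hpB.comp (hX s)).ennreal_toReal.aestronglyMeasurable
      · rw [Real.norm_of_nonneg measureReal_nonneg]
        exact measureReal_le_one
    · intro C hC _
      have h1 := congrArg (fun μ : @Measure (PathSpace E) m => μ C) htrim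
      beta_reduce at h1
      rw [trim_measurableSet_eq hm hC, trim_measurableSet_eq hm hC,
        Measure.restrict_apply (hm _ hC), withDensity_apply _ (hm _ hC)] at h1
      rw [integral_indicator hBm, Measure.restrict_restrict hBm]
      rw [setIntegral_const, smul_eq_mul, mul_one, measureReal_def, Set.inter_comm, h1]
      exact integral_toReal (hpB.comp (hX s)).aemeasurable
        (Eventually.of_forall fun x => measure_lt_top _ _)
    · exact ((hpB.comp hsm).ennreal_toReal).stronglyMeasurable.aestronglyMeasurable

end QJacobi

namespace QJacobi

/-! ## Symmetric polynomials and power sums -/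

variable {N : ℕ}

/-- Evaluation of symmetric polynomials at a point, as an algebra morphism. -/
noncomputable def evalAt (X : Fin N → ℝ) : SymPoly N →ₐ[ℝ] ℝ :=
  (MvPolynomial.aeval X).comp (MvPolynomial.symmetricSubalgebra (Fin N) ℝ).val

theorem evalAt_apply (X : Fin N → ℝ) (f : SymPoly N) : evalAt X f = f.value X := by
  simp [evalAt, SymPoly.value, MvPolynomial.aeval_eq_eval]

/-- The power sums. -/
noncomputable def psumSym (N k : ℕ) : SymPoly N :=
  ⟨MvPolynomial.psum (Fin N) ℝ k, MvPolynomial.psum_isSymmetric _ _ _⟩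

theorem value_psumSym (k : ℕ) (X : Fin N → ℝ) : (psumSym N k).value X = ∑ i, X i ^ k := by
  simp [psumSym, SymPoly.value, MvPolynomial.psum]

/-- The elementary symmetric polynomials. -/
noncomputable def esymmSym (N k : ℕ) : SymPoly N :=
  ⟨MvPolynomial.esymm (Fin N) ℝ k, MvPolynomial.esymm_isSymmetric _ _ _⟩

theorem evalAt_esymmSym (k : ℕ) (X : Fin N → ℝ) :
    evalAt X (esymmSym N k) = (Finset.univ.val.map X).esymm k := by
  simp only [evalAt, esymmSym, AlgHom.comp_apply, Subalgebra.coe_val]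
  exact MvPolynomial.aeval_esymm_eq_multiset_esymm _ _ _ _

theorem esymmSym_mem_adjoin_psumSym (k : ℕ) :
    esymmSym N k ∈ Algebra.adjoin ℝ (Set.range fun k => psumSym N (k + 1)) := by
  induction k using Nat.strong_induction_on with
  | _ k ih =>
    set S := Algebra.adjoin ℝ (Set.range fun k => psumSym N (k + 1))
    rcases Nat.eq_zero_or_pos k with rfl | hk
    · have : esymmSym N 0 = 1 := Subtype.ext (MvPolynomial.esymm_zero (Fin N) ℝ)
      rw [this]
      exact S.one_mem
    · have h1 : (k : SymPoly N) * esymmSym N k = (-1) ^ (k + 1) *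
          ∑ a ∈ Finset.HasAntidiagonal.antidiagonal k with a.1 < k,
            (-1) ^ a.1 * esymmSym N a.1 * psumSym N a.2 := by
        apply Subtype.ext
        have := MvPolynomial.mul_esymm_eq_sum (Fin N) ℝ k
        push_cast
        exact this
      have h2 : (k : SymPoly N) * esymmSym N k ∈ S := by
        rw [h1]
        refine S.mul_mem (S.pow_mem (S.neg_mem S.one_mem) _) (S.sum_mem fun x hx => ?_)
        rw [Finset.mem_filter, Finset.HasAntidiagonal.mem_antidiagonal] at hx
        refine S.mul_mem (S.mul_mem (S.pow_mem (S.neg_mem S.one_mem) _) (ih _ hx.2)) ?_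
        obtain ⟨l, hl⟩ : ∃ l, x.2 = l + 1 := ⟨x.2 - 1, by omega⟩
        rw [hl]
        exact Algebra.subset_adjoin ⟨l, rfl⟩
      have h3 : esymmSym N k = ((k : ℝ)⁻¹) • ((k : SymPoly N) * esymmSym N k) := by
        have : (k : SymPoly N) * esymmSym N k = (k : ℝ) • esymmSym N k := by
          rw [← nsmul_eq_mul, Nat.cast_smul_eq_nsmul]
        rw [this, smul_smul, inv_mul_cancel₀ (by positivity), one_smul]
      rw [h3]
      exact S.smul_mem h2 _

theorem adjoin_psumSym : Algebra.adjoin ℝ (Set.range fun k => psumSym N (k + 1)) = ⊤ := by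
  rw [eq_top_iff]
  rintro f -
  obtain ⟨p, rfl⟩ := MvPolynomial.esymmAlgHom_surjective (σ := Fin N) (n := N) ℝ (by simp) f
  induction p using MvPolynomial.induction_on with
  | C r =>
    rw [← MvPolynomial.algebraMap_eq, AlgHom.commutes]
    exact Subalgebra.algebraMap_mem _ r
  | add p q hp hq => rw [map_add]; exact Subalgebra.add_mem _ hp hq
  | mul_X p i hp =>
    rw [map_mul]
    refine Subalgebra.mul_mem _ hp ?_
    rw [MvPolynomial.esymmAlgHom, MvPolynomial.aeval_X]
    exact esymmSym_mem_adjoin_psumSym _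

theorem SymPoly.induction_psum {P : SymPoly N → Prop} (const : ∀ r : ℝ, P (algebraMap ℝ _ r))
    (psum : ∀ k, P (psumSym N (k + 1))) (add : ∀ f g, P f → P g → P (f + g))
    (mul : ∀ f g, P f → P g → P (f * g)) (f : SymPoly N) : P f := by
  have hf : f ∈ Algebra.adjoin ℝ (Set.range fun k => psumSym N (k + 1)) := by
    rw [adjoin_psumSym]; trivial
  induction hf using Algebra.adjoin_induction with
  | mem x hx => obtain ⟨k, rfl⟩ := hx; exact psum k
  | algebraMap r => exact const r
  | add x y _ _ hx hy => exact add x y hx hy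
  | mul x y _ _ hx hy => exact mul x y hx hy

theorem sum_scale_pow (k : ℕ) (r : ℝ) (i : Fin N) (X : Fin N → ℝ) :
    ∑ j, scale r i X j ^ k = ∑ j, X j ^ k + (r ^ k - 1) * X i ^ k := by
  rw [← Finset.add_sum_erase _ _ (Finset.mem_univ i),
    ← Finset.add_sum_erase _ (fun j => X j ^ k) (Finset.mem_univ i)]
  have : ∑ j ∈ Finset.univ.erase i, scale r i X j ^ k = ∑ j ∈ Finset.univ.erase i, X j ^ k :=
    Finset.sum_congr rfl fun j hj => by
      rw [scale, Function.update_of_ne (Finset.ne_of_mem_erase hj)]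
  rw [this, scale, Function.update_self]
  ring

/-- Evaluation of a polynomial with symmetric coefficients. -/
noncomputable def polyEval (X : Fin N → ℝ) (z : ℝ) : Polynomial (SymPoly N) →+* ℝ :=
  Polynomial.eval₂RingHom (evalAt X : SymPoly N →+* ℝ) z

@[simp] theorem polyEval_C (X : Fin N → ℝ) (z : ℝ) (f : SymPoly N) :
    polyEval X z (Polynomial.C f) = f.value X := by
  simp [polyEval, evalAt_apply]

@[simp] theorem polyEval_X (X : Fin N → ℝ) (z : ℝ) : polyEval X z Polynomial.X = z := by
  simp [polyEval]

theorem polyEval_sub (X : Fin N → ℝ) (z : ℝ) (p p' : Polynomial (SymPoly N)) :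
    polyEval X z (p - p') = polyEval X z p - polyEval X z p' :=
  eq_sub_of_add_eq
    ((map_add (polyEval X z) _ _).symm.trans (congrArg (polyEval X z) (sub_add_cancel p p')))

theorem polyEval_eq_eval_map (X : Fin N → ℝ) (z : ℝ) (p : Polynomial (SymPoly N)) :
    polyEval X z p = (p.map (evalAt X : SymPoly N →+* ℝ)).eval z := by
  simp [polyEval, Polynomial.eval₂_eq_eval_map]

theorem value_algebraMap (r : ℝ) (X : Fin N → ℝ) :
    (algebraMap ℝ (SymPoly N) r).value X = r := by
  rw [← evalAt_apply]; simp

theorem value_add (f g : SymPoly N) (X : Fin N → ℝ) : (f + g).value X = f.value X + g.value X := by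
  simp [← evalAt_apply]

theorem value_sub (f g : SymPoly N) (X : Fin N → ℝ) : (f - g).value X = f.value X - g.value X := by
  simp [← evalAt_apply]

theorem value_mul (f g : SymPoly N) (X : Fin N → ℝ) : (f * g).value X = f.value X * g.value X := by
  simp [← evalAt_apply]

theorem value_smul (r : ℝ) (f : SymPoly N) (X : Fin N → ℝ) : (r • f).value X = r * f.value X := by
  simp [← evalAt_apply]

/-- Multiplication of one variable by `r` in a symmetric polynomial gives a polynomial in this
variable with symmetric coefficients, whose linear coefficient is proportional to `r - 1`. -/
theorem SymPoly.exists_scale_expansion (f : SymPoly N) :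
    ∃ (g : SymPoly N) (K : ℝ → Polynomial (SymPoly N)), ∀ r i X,
      f.value (scale r i X) = f.value X + (r - 1) * g.value X * X i +
        X i ^ 2 * polyEval X (X i) (K r) := by
  induction f using SymPoly.induction_psum with
  | const r => exact ⟨0, 0, fun s i X => by simp [SymPoly.value]⟩
  | psum k =>
    rcases Nat.eq_zero_or_pos k with rfl | hk
    · refine ⟨1, 0, fun r i X => ?_⟩
      rw [value_psumSym, value_psumSym, sum_scale_pow]
      simp [SymPoly.value]
    · refine ⟨0, fun r => Polynomial.C (algebraMap ℝ _ (r ^ (k + 1) - 1)) * Polynomial.X ^ (k - 1),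
        fun r i X => ?_⟩
      rw [value_psumSym, value_psumSym, sum_scale_pow, map_mul, map_pow, polyEval_C, polyEval_X,
        value_algebraMap]
      obtain ⟨l, rfl⟩ : ∃ l, k = l + 1 := ⟨k - 1, by omega⟩
      have : (0 : SymPoly N).value X = 0 := by simp [SymPoly.value]
      rw [this, Nat.add_sub_cancel]
      ring
  | add f f' hf hf' =>
    obtain ⟨g, K, h⟩ := hf
    obtain ⟨g', K', h'⟩ := hf'
    refine ⟨g + g', fun r => K r + K' r, fun r i X => ?_⟩
    rw [value_add, value_add, value_add, h, h', map_add]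
    ring
  | mul f f' hf hf' =>
    obtain ⟨g, K, h⟩ := hf
    obtain ⟨g', K', h'⟩ := hf'
    refine ⟨f * g' + g * f', fun r => Polynomial.C f * K' r + Polynomial.C f' * K r +
      Polynomial.C (algebraMap ℝ _ ((r - 1) ^ 2)) * Polynomial.C g * Polynomial.C g' +
      Polynomial.C (algebraMap ℝ _ (r - 1)) * Polynomial.X *
        (Polynomial.C g * K' r + Polynomial.C g' * K r) + Polynomial.X ^ 2 * K r * K' r,
      fun r i X => ?_⟩
    rw [value_mul, value_mul, value_add, value_mul, value_mul, h, h']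
    simp only [map_add, map_mul, map_pow, polyEval_C, polyEval_X, value_algebraMap]
    ring

/-! ## Lagrange sums -/

/-- The coefficients `∏_{j ≠ i} (r x_i - x_j) / (x_i - x_j)`. -/
noncomputable def shiftCoeff {ι : Type*} [DecidableEq ι] (s : Finset ι) (r : ℝ) (i : ι)
    (X : ι → ℝ) : ℝ :=
  ∏ j ∈ s.erase i, (r * X i - X j) / (X i - X j)

/-- The polynomial `(p(r z) - p(z)) / ((r - 1) z)`. -/
noncomputable def qDerivative {A : Type*} [CommRing A] [Algebra ℝ A] (r : ℝ) (p : Polynomial A) :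
    Polynomial A :=
  Polynomial.C (algebraMap ℝ A (r - 1)⁻¹) *
    (p.comp (Polynomial.C (algebraMap ℝ A r) * Polynomial.X) - p).divX

section qDerivative

variable {A B : Type*} [CommRing A] [Algebra ℝ A] [CommRing B] [Algebra ℝ B]

theorem coeff_qDerivative (r : ℝ) (p : Polynomial A) (k : ℕ) :
    (qDerivative r p).coeff k =
      algebraMap ℝ A ((r - 1)⁻¹ * (r ^ (k + 1) - 1)) * p.coeff (k + 1) := by
  simp only [qDerivative, Polynomial.coeff_C_mul, Polynomial.coeff_divX, Polynomial.coeff_sub,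
    Polynomial.comp_C_mul_X_coeff, map_mul, map_sub, map_pow, map_one]
  ring

theorem map_qDerivative (φ : A →ₐ[ℝ] B) (r : ℝ) (p : Polynomial A) :
    (qDerivative r p).map (φ : A →+* B) = qDerivative r (p.map (φ : A →+* B)) := by
  ext k
  simp [coeff_qDerivative, Polynomial.coeff_map]

theorem degree_qDerivative_lt (r : ℝ) {p : Polynomial A} {n : ℕ} (h : p.natDegree ≤ n) :
    (qDerivative r p).degree < n := by
  rw [Polynomial.degree_lt_iff_coeff_zero]
  intro m hm
  rw [coeff_qDerivative, Polynomial.coeff_eq_zero_of_natDegree_lt (by omega), mul_zero]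

theorem eval_qDerivative {r : ℝ} (hr : r ≠ 1) (p : Polynomial ℝ) (z : ℝ) :
    (r - 1) * z * (qDerivative r p).eval z = p.eval (r * z) - p.eval z := by
  have h := Polynomial.divX_mul_X_add (p.comp (Polynomial.C r * Polynomial.X) - p)
  have h2 := congrArg (Polynomial.eval z) h
  simp only [Polynomial.eval_add, Polynomial.eval_mul, Polynomial.eval_X, Polynomial.eval_C,
    Polynomial.eval_sub, Polynomial.eval_comp, Polynomial.coeff_sub,
    Polynomial.comp_C_mul_X_coeff, pow_zero, mul_one, sub_self, add_zero] at h2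
  rw [← h2, qDerivative, Polynomial.eval_mul, Polynomial.eval_C]
  have : r - 1 ≠ 0 := sub_ne_zero.mpr hr
  simp only [Algebra.algebraMap_self, RingHom.id_apply]
  field_simp

theorem coeff_zero_qDerivative {r : ℝ} (hr : r ≠ 1) (p : Polynomial A) :
    (qDerivative r p).coeff 0 = p.coeff 1 := by
  rw [coeff_qDerivative, zero_add, pow_one, inv_mul_cancel₀ (sub_ne_zero.mpr hr), map_one, one_mul]

end qDerivative

section Lagrange

variable {ι : Type*} [DecidableEq ι] {s : Finset ι} {X : ι → ℝ}

theorem eval_qDerivative_nodal {r : ℝ} (hr : r ≠ 1) {i : ι} (hi : i ∈ s) (h0 : X i ≠ 0) :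
    (qDerivative r (Lagrange.nodal s X)).eval (X i) = ∏ j ∈ s.erase i, (r * X i - X j) := by
  have h1 := eval_qDerivative hr (Lagrange.nodal s X) (X i)
  rw [Lagrange.eval_nodal_at_node hi, sub_zero, Lagrange.eval_nodal,
    ← Finset.mul_prod_erase _ _ hi] at h1
  have h2 : r * X i - X i = (r - 1) * X i := by ring
  rw [h2] at h1
  exact mul_left_cancel₀ (mul_ne_zero (sub_ne_zero.mpr hr) h0) h1

theorem shiftCoeff_eq {r : ℝ} (hr : r ≠ 1) {i : ι} (hi : i ∈ s) (h0 : X i ≠ 0) :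
    shiftCoeff s r i X = (qDerivative r (Lagrange.nodal s X)).eval (X i) /
      ∏ j ∈ s.erase i, (X i - X j) := by
  rw [eval_qDerivative_nodal hr hi h0, shiftCoeff, Finset.prod_div_distrib]

theorem sum_shiftCoeff {r : ℝ} (hr : r ≠ 1) (hX : Set.InjOn X s) (h0 : ∀ i ∈ s, X i ≠ 0) :
    ∑ i ∈ s, shiftCoeff s r i X = ∑ k ∈ Finset.range s.card, r ^ k := by
  rcases s.eq_empty_or_nonempty with rfl | hs
  · simp
  rw [Finset.sum_congr rfl fun i hi => shiftCoeff_eq hr hi (h0 i hi),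
    ← Lagrange.coeff_eq_sum hX (degree_qDerivative_lt r (Lagrange.natDegree_nodal (s := s)).le),
    coeff_qDerivative, Nat.sub_add_cancel hs.card_pos, geom_sum_eq hr]
  have h1 : (Lagrange.nodal s X).coeff s.card = 1 := by
    have := (Lagrange.nodal_monic (s := s) (v := X)).coeff_natDegree
    rwa [Lagrange.natDegree_nodal] at this
  rw [h1]
  simp only [Algebra.algebraMap_self, RingHom.id_apply]
  field_simp

theorem sum_shiftCoeff_div {r r' : ℝ} (hr : r ≠ 1) (hr' : r' ≠ 1) (hX : Set.InjOn X s)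
    (h0 : ∀ i ∈ s, X i ≠ 0) :
    ∑ i ∈ s, shiftCoeff s r i X / X i = ∑ i ∈ s, shiftCoeff s r' i X / X i := by
  rcases s.eq_empty_or_nonempty with rfl | hs
  · simp
  rw [← sub_eq_zero, ← Finset.sum_sub_distrib]
  set L := Lagrange.nodal s X
  set B := (qDerivative r L - qDerivative r' L).divX with hB
  have hL : L.natDegree ≤ s.card := (Lagrange.natDegree_nodal (s := s)).le
  have hBdeg : B.degree < s.card := by
    rw [Polynomial.degree_lt_iff_coeff_zero]
    intro m hm
    rw [hB, Polynomial.coeff_divX, Polynomial.coeff_sub, coeff_qDerivative, coeff_qDerivative,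
      Polynomial.coeff_eq_zero_of_natDegree_lt (p := L) (by omega)]
    simp
  have hcoeff : B.coeff (s.card - 1) = 0 := by
    have := hs.card_pos
    rw [hB, Polynomial.coeff_divX, Polynomial.coeff_sub, coeff_qDerivative, coeff_qDerivative,
      Polynomial.coeff_eq_zero_of_natDegree_lt (p := L) (by omega)]
    simp
  rw [← hcoeff, Lagrange.coeff_eq_sum hX hBdeg]
  refine Finset.sum_congr rfl fun i hi => ?_
  have h := congrArg (Polynomial.eval (X i)) (Polynomial.divX_mul_X_add (qDerivative r L - qDerivative r' L))
  rw [Polynomial.coeff_sub, coeff_zero_qDerivative hr, coeff_zero_qDerivative hr', sub_self,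
    map_zero, add_zero, Polynomial.eval_mul, Polynomial.eval_X, Polynomial.eval_sub, ← hB] at h
  have hBi : B.eval (X i) = ((qDerivative r L).eval (X i) - (qDerivative r' L).eval (X i)) / X i := by
    rw [← h, mul_div_cancel_right₀ _ (h0 i hi)]
  rw [shiftCoeff_eq hr hi (h0 i hi), shiftCoeff_eq hr' hi (h0 i hi), hBi]
  ring

end Lagrange

/-- The polynomial `∏ (z - x_j)` with symmetric coefficients. -/
noncomputable def nodalSym (N : ℕ) : Polynomial (SymPoly N) :=
  Polynomial.X ^ N + ∑ j ∈ Finset.range N,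
    Polynomial.C ((-1 : ℝ) ^ (j + 1) • esymmSym N (j + 1)) * Polynomial.X ^ (N - 1 - j)

theorem monic_nodalSym (N : ℕ) : (nodalSym N).Monic := by
  refine Polynomial.monic_X_pow_add ?_
  refine Polynomial.mem_degreeLT.mp (Submodule.sum_mem _ fun j hj => Polynomial.mem_degreeLT.mpr ?_)
  refine (Polynomial.degree_C_mul_X_pow_le _ _).trans_lt ?_
  have := Finset.mem_range.mp hj
  exact_mod_cast (show N - 1 - j < N by omega)

theorem map_nodalSym (X : Fin N → ℝ) :
    (nodalSym N).map (evalAt X : SymPoly N →+* ℝ) = Lagrange.nodal Finset.univ X := by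
  have h := Multiset.prod_X_sub_X_eq_sum_esymm (Finset.univ.val.map X)
  rw [Multiset.map_map] at h
  have h1 : Lagrange.nodal Finset.univ X = (Multiset.map ((fun t => Polynomial.X - Polynomial.C t) ∘ X)
      Finset.univ.val).prod := rfl
  rw [h1, h]
  simp only [Multiset.card_map, Finset.card_val, Finset.card_univ, Fintype.card_fin]
  rw [Finset.sum_range_succ', nodalSym, Polynomial.map_add, Polynomial.map_pow, Polynomial.map_X,
    Polynomial.map_sum, add_comm]
  refine congrArg₂ (· + ·) (Finset.sum_congr rfl fun j _ => ?_) (by simp [Multiset.esymm])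
  have h2 : evalAt X ((-1 : ℝ) ^ (j + 1) • esymmSym N (j + 1)) =
      (-1) ^ (j + 1) * (Finset.univ.val.map X).esymm (j + 1) := by
    rw [map_smul, evalAt_esymmSym, smul_eq_mul]
  rw [Polynomial.map_mul, Polynomial.map_C, Polynomial.map_pow, Polynomial.map_X, RingHom.coe_coe,
    h2, show N - 1 - j = N - (j + 1) by omega]
  simp only [map_mul, map_pow, map_neg, map_one]
  ring

theorem natDegree_nodalSym (N : ℕ) : (nodalSym N).natDegree ≤ N := by
  have h := congrArg Polynomial.natDegree (map_nodalSym (fun _ : Fin N => (0 : ℝ)))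
  rw [(monic_nodalSym N).natDegree_map, Lagrange.natDegree_nodal] at h
  simpa using h.le

/-- Lagrange sums of polynomials with symmetric coefficients are symmetric polynomials. -/
theorem exists_value_eq_lagrange_sum (G : Polynomial (SymPoly N)) :
    ∃ g : SymPoly N, ∀ X : Fin N → ℝ, Function.Injective X →
      g.value X = ∑ i, polyEval X (X i) G / ∏ j ∈ Finset.univ.erase i, (X i - X j) := by
  refine ⟨(G %ₘ nodalSym N).coeff (N - 1), fun X hX => ?_⟩
  have hdeg : ((G %ₘ nodalSym N).map (evalAt X : SymPoly N →+* ℝ)).degree <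
      (Finset.univ : Finset (Fin N)).card := by
    refine Polynomial.degree_map_le.trans_lt
      ((Polynomial.degree_modByMonic_lt _ (monic_nodalSym N)).trans_le ?_)
    refine Polynomial.degree_le_natDegree.trans ?_
    simpa using natDegree_nodalSym N
  have h := Lagrange.coeff_eq_sum hX.injOn hdeg
  rw [Polynomial.coeff_map, Finset.card_univ, Fintype.card_fin] at h
  rw [← evalAt_apply]
  refine Eq.trans h (Finset.sum_congr rfl fun i _ => ?_)
  congr 1
  rw [← polyEval_eq_eval_map]
  conv_rhs => rw [← Polynomial.modByMonic_add_div G (nodalSym N)]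
  rw [map_add, map_mul, polyEval_eq_eval_map _ _ (nodalSym N), map_nodalSym,
    Lagrange.eval_nodal_at_node (Finset.mem_univ i), zero_mul, add_zero]

theorem shiftCoeff_eq_polyEval {r : ℝ} (hr : r ≠ 1) (X : Fin N → ℝ) {i : Fin N} (h0 : X i ≠ 0) :
    shiftCoeff Finset.univ r i X = polyEval X (X i) (qDerivative r (nodalSym N)) /
      ∏ j ∈ Finset.univ.erase i, (X i - X j) := by
  rw [shiftCoeff_eq hr (Finset.mem_univ i) h0, polyEval_eq_eval_map, map_qDerivative, map_nodalSym]

/-! ## The `q`-difference operator -/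

theorem vandermonde_scale_div {X : Fin N → ℝ} (hX : Function.Injective X) (r : ℝ) (i : Fin N) :
    vandermonde (scale r i X) / vandermonde X = shiftCoeff Finset.univ r i X := by
  have h1 : ∀ a : Fin N, ∏ b ∈ Finset.Ioi a, (scale r i X a - scale r i X b) / (X a - X b) =
      if a = i then ∏ b ∈ Finset.Ioi i, (r * X i - X b) / (X i - X b) else
        if a < i then (r * X i - X a) / (X i - X a) else 1 := by
    intro a
    split_ifs with h h'
    · subst h
      refine Finset.prod_congr rfl fun b hb => ?_
      rw [scale, Function.update_self, Function.update_of_ne (Finset.mem_Ioi.mp hb).ne']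
    · rw [← Finset.mul_prod_erase _ _ (Finset.mem_Ioi.mpr h'), Finset.prod_eq_one, mul_one]
      · rw [scale, Function.update_self, Function.update_of_ne h,
          ← neg_sub, ← neg_sub (X i), neg_div_neg_eq]
      · intro b hb
        rw [scale, Function.update_of_ne h, Function.update_of_ne (Finset.ne_of_mem_erase hb),
          div_self]
        exact sub_ne_zero.mpr (hX.ne (Finset.mem_Ioi.mp (Finset.mem_of_mem_erase hb)).ne)
    · refine Finset.prod_eq_one fun b hb => ?_
      have hb' := Finset.mem_Ioi.mp hb
      have hbi : b ≠ i := fun e => h' (e ▸ hb')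
      rw [scale, Function.update_of_ne h, Function.update_of_ne hbi, div_self]
      exact sub_ne_zero.mpr (hX.ne hb'.ne)
  rw [vandermonde, vandermonde, ← Finset.prod_div_distrib]
  simp only [← Finset.prod_div_distrib, h1]
  rw [← Finset.mul_prod_erase _ _ (Finset.mem_univ i), if_pos rfl, shiftCoeff]
  have h2 : (Finset.univ.erase i : Finset (Fin N)) = Finset.Ioi i ∪ Finset.Iio i := by
    ext j
    simp only [Finset.mem_erase, Finset.mem_univ, and_true, Finset.mem_union, Finset.mem_Ioi,
      Finset.mem_Iio, lt_or_lt_iff_ne, ne_comm]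
  have h3 : ∏ a ∈ Finset.univ.erase i, (if a = i then ∏ b ∈ Finset.Ioi i, (r * X i - X b) / (X i - X b)
      else if a < i then (r * X i - X a) / (X i - X a) else 1) =
      ∏ a ∈ Finset.Iio i, (r * X i - X a) / (X i - X a) := by
    rw [h2, Finset.prod_union]
    · rw [Finset.prod_eq_one, one_mul]
      · refine Finset.prod_congr rfl fun a ha => ?_
        have := Finset.mem_Iio.mp ha
        rw [if_neg this.ne, if_pos this]
      · intro a ha
        have := Finset.mem_Ioi.mp ha
        rw [if_neg this.ne', if_neg this.asymm]
    · rw [Finset.disjoint_left]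
      intro a ha ha'
      exact (Finset.mem_Ioi.mp ha).asymm (Finset.mem_Iio.mp ha')
  rw [h3, h2, Finset.prod_union]
  rw [Finset.disjoint_left]
  intro a ha ha'
  exact (Finset.mem_Ioi.mp ha).asymm (Finset.mem_Iio.mp ha')

/-- The common factor `- q t^{N-1} / (a b)` of the coefficients. -/
noncomputable def kap (N : ℕ) (q t a b : ℝ) : ℝ := -(q * t ^ (N - 1) / (a * b))

/-- The coefficient `σ⁺` as a real number. -/
noncomputable def sigmaPlusRe (N : ℕ) (q t a b : ℝ) (d : ℂ) (x : ℝ) : ℝ :=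
  kap N q t a b * ((d.re - x⁻¹) ^ 2 + d.im ^ 2)

theorem sigmaPlus_eq (q t a b : ℝ) {c d : ℂ} (hd : c = (starRingEnd ℂ) d) (x : ℝ) :
    sigmaPlus N q t a b c d x = (sigmaPlusRe N q t a b d x : ℂ) := by
  subst hd
  apply Complex.ext
  · simp [sigmaPlus, sigmaPlusRe, kap, pow_two]
    norm_cast
    simp
    ring
  · simp [sigmaPlus, sigmaPlusRe, kap, pow_two]
    norm_cast
    simp
    ring

theorem sigmaMinus_eq (q t a b x : ℝ) :
    sigmaMinus N q t a b x = q * kap N q t a b * ((a * q⁻¹ - x⁻¹) * (b * q⁻¹ - x⁻¹)) := by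
  rw [sigmaMinus, kap]
  ring

/-- The right-hand side of the definition of `(D_N f)(X)` in real form. -/
noncomputable def qDifferenceRe (q t a b : ℝ) (d : ℂ) (f : (Fin N → ℝ) → ℝ) (X : Fin N → ℝ) : ℝ :=
  ∑ i, (shiftCoeff Finset.univ t i X * sigmaPlusRe N q t a b d (X i) * (f (scale q i X) - f X) +
    shiftCoeff Finset.univ t⁻¹ i X * sigmaMinus N q t a b (X i) * (f (scale q⁻¹ i X) - f X))

theorem qDifference_eq (q t a b : ℝ) {c d : ℂ} (hd : c = (starRingEnd ℂ) d)
    (f : (Fin N → ℝ) → ℝ) {X : Fin N → ℝ} (hX : Function.Injective X) :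
    qDifference q t a b c d f X = (qDifferenceRe q t a b d f X : ℂ) := by
  simp only [qDifference, qDifferenceRe, vandermonde_scale_div hX, sigmaPlus_eq q t a b hd]
  push_cast
  rfl

theorem exists_value_eq_qDifferenceRe {q t : ℝ} (hq : q ≠ 0) (ht : t ≠ 1) (a b : ℝ) (d : ℂ)
    (f : SymPoly N) : ∃ g : SymPoly N, ∀ X : Fin N → ℝ, (∀ i, X i ≠ 0) → Function.Injective X →
      g.value X = qDifferenceRe q t a b d f.value X := by
  obtain ⟨g, K, hK⟩ := f.exists_scale_expansion
  let κ := kap N q t a b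
  let M := qDerivative t (nodalSym N)
  let M' := qDerivative t⁻¹ (nodalSym N)
  let c (r : ℝ) : Polynomial (SymPoly N) := Polynomial.C (algebraMap ℝ _ r)
  let z : Polynomial (SymPoly N) := Polynomial.X
  have ht' : t⁻¹ ≠ 1 := inv_ne_one.mpr ht
  obtain ⟨h, hh⟩ := exists_value_eq_lagrange_sum (N := N)
    (c κ * M * ((c (d.re ^ 2 + d.im ^ 2) * z ^ 2 - c (2 * d.re) * z + 1) * K q +
        (c (d.re ^ 2 + d.im ^ 2) * z - c (2 * d.re)) * c (q - 1) * Polynomial.C g) +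
      c (q * κ) * M' * ((c (a * b * q⁻¹ ^ 2) * z ^ 2 - c ((a + b) * q⁻¹) * z + 1) * K q⁻¹ +
        (c (a * b * q⁻¹ ^ 2) * z - c ((a + b) * q⁻¹)) * c (q⁻¹ - 1) * Polynomial.C g) +
      c (κ * (q - 1)) * Polynomial.C g * (M - M').divX)
  refine ⟨h, fun X h0 hX => ?_⟩
  rw [hh X hX, qDifferenceRe]
  refine Finset.sum_congr rfl fun i _ => ?_
  have hdiv : polyEval X (X i) (M - M').divX * X i =
      polyEval X (X i) M - polyEval X (X i) M' := by
    have h := congrArg (polyEval X (X i)) (Polynomial.divX_mul_X_add (M - M'))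
    rw [Polynomial.coeff_sub, coeff_zero_qDerivative ht, coeff_zero_qDerivative ht', sub_self,
      map_zero, add_zero, map_mul, polyEval_X, polyEval_sub] at h
    exact h
  rw [shiftCoeff_eq_polyEval ht X (h0 i), shiftCoeff_eq_polyEval ht' X (h0 i), hK, hK,
    sigmaPlusRe, sigmaMinus_eq]
  rw [← eq_div_iff (h0 i)] at hdiv
  simp only [map_add, map_mul, polyEval_sub, map_pow, map_one, c, z, polyEval_C, polyEval_X,
    value_algebraMap, hdiv]
  have hP : ∏ j ∈ Finset.univ.erase i, (X i - X j) ≠ 0 :=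
    Finset.prod_ne_zero_iff.mpr fun j hj => sub_ne_zero.mpr (hX.ne (Finset.ne_of_mem_erase hj).symm)
  have hx := h0 i
  simp only [M, M', κ]
  field_simp
  ring

/-! ## Symmetric polynomials are determined by their values on the configurations -/

theorem MvPolynomial.eq_zero_of_eval_eq_zero_of_monotone {q t a : ℝ} (hq : q ∈ Set.Ioo (0 : ℝ) 1)
    (ht : t ≠ 0) (ha : a ≠ 0) (P : MvPolynomial (Fin N) ℝ)
    (h : ∀ k : Fin N → ℕ, Monotone k → (∀ i, 1 ≤ k i) →
      MvPolynomial.eval (fun i : Fin N => a⁻¹ * q ^ k i * t ^ (i : ℕ)) P = 0) : P = 0 := by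
  classical
  set M := P.totalDegree + 1 with hM
  refine MvPolynomial.eq_zero_of_eval_zero_at_prod_finset P
    (fun i => (Finset.Icc ((i : ℕ) * M + 1) ((i + 1) * M)).image
      fun k => a⁻¹ * q ^ k * t ^ (i : ℕ)) (fun i => ?_) fun x hx => ?_
  · rw [Finset.card_image_of_injective]
    · have := MvPolynomial.degreeOf_le_totalDegree P i
      rw [Nat.card_Icc]
      have : ((i : ℕ) + 1) * M = i * M + M := by ring
      omega
    · intro k l hkl
      have h1 := mul_right_cancel₀ (pow_ne_zero _ ht) hkl
      have h2 := mul_left_cancel₀ (inv_ne_zero ha) h1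
      exact pow_right_injective₀ hq.1 hq.2.ne h2
  · simp only [Finset.mem_image, Finset.mem_Icc] at hx
    choose k hk hkx using hx
    have : x = fun i : Fin N => a⁻¹ * q ^ k i * t ^ (i : ℕ) := funext fun i => (hkx i).symm
    rw [this]
    refine h k (fun i j hij => ?_) fun i => by have := (hk i).1; omega
    rcases hij.eq_or_lt with rfl | hlt
    · rfl
    · have h1 : ((i : ℕ) + 1) * M ≤ j * M := Nat.mul_le_mul_right _ hlt
      have h2 := (hk i).2
      have h3 := (hk j).1
      omega

theorem SymPoly.ext_of_value {f g : SymPoly N}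
    (h : ∀ X : Fin N → ℝ, (∀ i, X i ≠ 0) → Function.Injective X → f.value X = g.value X) :
    f = g := by
  apply Subtype.ext
  rw [← sub_eq_zero]
  have hq : (2⁻¹ : ℝ) ∈ Set.Ioo (0 : ℝ) 1 := by constructor <;> norm_num
  refine MvPolynomial.eq_zero_of_eval_eq_zero_of_monotone (q := 2⁻¹) (t := 2⁻¹) (a := 1) hq
    (by norm_num) one_ne_zero _ fun k hk _ => ?_
  rw [map_sub, sub_eq_zero]
  refine h _ (fun i => by positivity) ?_
  have : StrictAnti fun i : Fin N => (1 : ℝ)⁻¹ * 2⁻¹ ^ k i * 2⁻¹ ^ (i : ℕ) := by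
    intro i j hij
    simp only [inv_one, one_mul, ← pow_add]
    refine pow_lt_pow_right_of_lt_one₀ hq.1 hq.2 ?_
    have := hk hij.le
    have : (i : ℕ) < j := hij
    omega
  exact this.injective

/-- The operator `D_N` on symmetric polynomials. -/
theorem exists_qDifferenceOperator {q t : ℝ} (hq : q ≠ 0) (ht : t ≠ 1) (a b : ℝ) (d : ℂ) :
    ∃ D : SymPoly N →ₗ[ℝ] SymPoly N, ∀ f X, (∀ i, X i ≠ 0) → Function.Injective X →
      (D f).value X = qDifferenceRe q t a b d f.value X := by
  choose D hD using exists_value_eq_qDifferenceRe (N := N) hq ht a b d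
  refine ⟨{ toFun := D, map_add' := fun f g => ?_, map_smul' := fun r f => ?_ }, hD⟩
  · refine SymPoly.ext_of_value fun X h0 hX => ?_
    rw [value_add, hD _ _ h0 hX, hD _ _ h0 hX, hD _ _ h0 hX]
    simp only [qDifferenceRe, value_add]
    rw [← Finset.sum_add_distrib]
    exact Finset.sum_congr rfl fun i _ => by ring
  · refine SymPoly.ext_of_value fun X h0 hX => ?_
    rw [RingHom.id_apply, value_smul, hD _ _ h0 hX, hD _ _ h0 hX]
    simp only [qDifferenceRe, value_smul]
    rw [Finset.mul_sum]
    exact Finset.sum_congr rfl fun i _ => by ring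

end QJacobi

namespace QJacobi

/-! ## Configurations -/

variable {N : ℕ}

theorem qPow_natCast (q : ℝ) (k : ℕ) : qPow q k = q ^ k := by simp [qPow]

theorem qPow_top (q : ℝ) : qPow q ⊤ = 0 := by simp [qPow]

theorem qPow_nonneg {q : ℝ} (hq : q ∈ Set.Ioo (0 : ℝ) 1) (k : ℕ∞) : 0 ≤ qPow q k := by
  rw [qPow]; split_ifs
  · exact le_rfl
  · exact pow_nonneg hq.1.le _

theorem qPow_antitone {q : ℝ} (hq : q ∈ Set.Ioo (0 : ℝ) 1) : Antitone (qPow q) := by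
  intro k l hkl
  by_cases hl : l = ⊤
  · rw [hl, qPow_top]; exact qPow_nonneg hq k
  · lift l to ℕ using hl
    lift k to ℕ using ne_top_of_le_ne_top (ENat.natCast_ne_top l) hkl
    rw [qPow_natCast, qPow_natCast]
    exact pow_le_pow_of_le_one hq.1.le hq.2.le (by exact_mod_cast hkl)

theorem qPow_injective {q : ℝ} (hq : q ∈ Set.Ioo (0 : ℝ) 1) : Function.Injective (qPow q) := by
  intro k l h
  by_cases hk : k = ⊤ <;> by_cases hl : l = ⊤
  · rw [hk, hl]
  · lift l to ℕ using hl
    rw [hk, qPow_top, qPow_natCast] at h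
    exact absurd h (pow_pos hq.1 _).ne
  · lift k to ℕ using hk
    rw [hl, qPow_top, qPow_natCast] at h
    exact absurd h (pow_pos hq.1 _).ne'
  · lift l to ℕ using hl
    lift k to ℕ using hk
    rw [qPow_natCast, qPow_natCast] at h
    rw [pow_right_injective₀ hq.1 hq.2.ne h]

/-- `n` is the number of positive particles of `ω` and `m` the number of negative ones. -/
structure Omega.HasCounts (ω : Omega N) (n m : ℕ) : Prop where
  le : n + m ≤ N
  fst : ∀ i, ω.1.1 i ≠ ⊤ ↔ i < n
  snd : ∀ i, ω.1.2 i ≠ ⊤ ↔ i < m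

theorem exists_count_of_monotone {k : ℕ → ℕ∞} (hk : Monotone k) (hfin : {i | k i ≠ ⊤}.encard ≠ ⊤) :
    ∃ n : ℕ, (∀ i, k i ≠ ⊤ ↔ i < n) ∧ {i | k i ≠ ⊤}.encard = n := by
  classical
  have hex : ∃ n, k n = ⊤ := by
    by_contra! h
    have : {i | k i ≠ ⊤} = Set.univ := Set.eq_univ_of_forall h
    rw [this, Set.encard_univ] at hfin
    simp at hfin
  have h1 : ∀ i, k i ≠ ⊤ ↔ i < Nat.find hex := by
    intro i
    rw [Nat.lt_find_iff]
    exact ⟨fun h j hj hj' => h (top_le_iff.mp (hj' ▸ hk hj)), fun h => h i le_rfl⟩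
  refine ⟨Nat.find hex, h1, ?_⟩
  have : {i | k i ≠ ⊤} = (Finset.range (Nat.find hex) : Set ℕ) := by
    ext i; simpa using h1 i
  rw [this, Set.encard_coe_eq_coe_finsetCard, Finset.card_range]

theorem Omega.exists_hasCounts (ω : Omega N) : ∃ n m, ω.HasCounts n m := by
  obtain ⟨⟨k, l⟩, hk, hl, -, -, hs⟩ := ω
  have hs' : {i | k i ≠ ⊤}.encard + {i | l i ≠ ⊤}.encard ≤ N := hs
  have h1 := ne_top_of_le_ne_top (ENat.natCast_ne_top N) (le_self_add.trans hs')
  have h2 := ne_top_of_le_ne_top (ENat.natCast_ne_top N) (le_add_self.trans hs')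
  obtain ⟨n, hn, hn'⟩ := exists_count_of_monotone hk h1
  obtain ⟨m, hm, hm'⟩ := exists_count_of_monotone hl h2
  refine ⟨n, m, ?_, hn, hm⟩
  rw [hn', hm'] at hs'
  exact_mod_cast hs'

theorem mem_omegaSet_of_counts {k l : ℕ → ℕ∞} (hk : Monotone k) (hl : Monotone l)
    (hk1 : ∀ i, 1 ≤ k i) (hl1 : ∀ i, 1 ≤ l i) {n m : ℕ} (hnm : n + m ≤ N)
    (hn : ∀ i, n ≤ i → k i = ⊤) (hm : ∀ i, m ≤ i → l i = ⊤) : (k, l) ∈ omegaSet N := by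
  refine ⟨hk, hl, hk1, hl1, ?_⟩
  have h1 : {i | k i ≠ ⊤} ⊆ (Finset.range n : Set ℕ) := fun i hi => by
    rw [Finset.coe_range, Set.mem_Iio]
    by_contra! h
    exact hi (hn i h)
  have h2 : {i | l i ≠ ⊤} ⊆ (Finset.range m : Set ℕ) := fun i hi => by
    rw [Finset.coe_range, Set.mem_Iio]
    by_contra! h
    exact hi (hm i h)
  have h3 := add_le_add (Set.encard_le_encard h1) (Set.encard_le_encard h2)
  rw [Set.encard_coe_eq_coe_finsetCard, Set.encard_coe_eq_coe_finsetCard, Finset.card_range,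
    Finset.card_range] at h3
  exact h3.trans (by exact_mod_cast hnm)

section

variable {q t a b : ℝ} {ω : Omega N} {n m : ℕ}

theorem xPlus_nonneg (hq : q ∈ Set.Ioo (0 : ℝ) 1) (ht : t ∈ Set.Ioo (0 : ℝ) 1) (ha : 0 < a)
    (ω : Omega N) (i : ℕ) : 0 ≤ xPlus q t a ω i :=
  mul_nonneg (mul_nonneg (inv_nonneg.mpr ha.le) (qPow_nonneg hq _)) (pow_nonneg ht.1.le _)

theorem xMinus_nonpos (hq : q ∈ Set.Ioo (0 : ℝ) 1) (ht : t ∈ Set.Ioo (0 : ℝ) 1) (hb : b < 0)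
    (ω : Omega N) (i : ℕ) : xMinus q t b ω i ≤ 0 :=
  mul_nonpos_of_nonpos_of_nonneg (mul_nonpos_of_nonpos_of_nonneg (inv_nonpos.mpr hb.le)
    (qPow_nonneg hq _)) (pow_nonneg ht.1.le _)

theorem Omega.HasCounts.xPlus_eq_zero (h : ω.HasCounts n m) {i : ℕ} (hi : n ≤ i) :
    xPlus q t a ω i = 0 := by
  have : ω.1.1 i = ⊤ := by
    by_contra h'
    exact absurd ((h.fst i).mp h') (not_lt.mpr hi)
  rw [xPlus, this, qPow_top, mul_zero, zero_mul]

theorem Omega.HasCounts.xMinus_eq_zero (h : ω.HasCounts n m) {i : ℕ} (hi : m ≤ i) :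
    xMinus q t b ω i = 0 := by
  have : ω.1.2 i = ⊤ := by
    by_contra h'
    exact absurd ((h.snd i).mp h') (not_lt.mpr hi)
  rw [xMinus, this, qPow_top, mul_zero, zero_mul]

theorem Omega.HasCounts.config_of_lt (h : ω.HasCounts n m) {i : Fin N} (hi : (i : ℕ) + m < N) :
    config q t a b ω i = xPlus q t a ω i := by
  rw [config, h.xMinus_eq_zero (i := Fin.rev i), add_zero]
  rw [Fin.val_rev]; omega

theorem Omega.HasCounts.config_of_ge (h : ω.HasCounts n m) {i : Fin N} (hi : n ≤ i) :
    config q t a b ω i = xMinus q t b ω (Fin.rev i) := by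
  rw [config, h.xPlus_eq_zero hi, zero_add]

theorem xPlus_eq_max (hq : q ∈ Set.Ioo (0 : ℝ) 1) (ht : t ∈ Set.Ioo (0 : ℝ) 1) (ha : 0 < a)
    (hb : b < 0) (ω : Omega N) (i : Fin N) : xPlus q t a ω i = max (config q t a b ω i) 0 := by
  obtain ⟨n, m, h⟩ := ω.exists_hasCounts
  rcases lt_or_ge (i : ℕ) n with hi | hi
  · have := h.le
    rw [h.config_of_lt (by omega), max_eq_left (xPlus_nonneg hq ht ha ω i)]
  · rw [h.config_of_ge hi, h.xPlus_eq_zero hi, max_eq_right (xMinus_nonpos hq ht hb ω _)]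

theorem xMinus_eq_min (hq : q ∈ Set.Ioo (0 : ℝ) 1) (ht : t ∈ Set.Ioo (0 : ℝ) 1) (ha : 0 < a)
    (hb : b < 0) (ω : Omega N) (i : Fin N) :
    xMinus q t b ω (Fin.rev i) = min (config q t a b ω i) 0 := by
  obtain ⟨n, m, h⟩ := ω.exists_hasCounts
  rcases lt_or_ge (i : ℕ) n with hi | hi
  · have := h.le
    rw [h.config_of_lt (by omega), min_eq_right (xPlus_nonneg hq ht ha ω i),
      h.xMinus_eq_zero (by rw [Fin.val_rev]; omega)]
  · rw [h.config_of_ge hi, min_eq_left (xMinus_nonpos hq ht hb ω _)]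

theorem config_injective (hq : q ∈ Set.Ioo (0 : ℝ) 1) (ht : t ∈ Set.Ioo (0 : ℝ) 1) (ha : 0 < a)
    (hb : b < 0) : Function.Injective fun ω : Omega N => config q t a b ω := by
  intro ω ω' h
  have h' : ∀ i, config q t a b ω i = config q t a b ω' i := fun i => congrFun h i
  obtain ⟨n, m, hω⟩ := ω.exists_hasCounts
  obtain ⟨n', m', hω'⟩ := ω'.exists_hasCounts
  have htop : ∀ (k : ℕ∞) (n i : ℕ), (k ≠ ⊤ ↔ i < n) → n ≤ N → N ≤ i → k = ⊤ := by
    intro k n i h1 h2 h3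
    by_contra h4
    have := h1.mp h4
    omega
  have e1 := hω.le
  have e2 := hω'.le
  apply Subtype.ext
  refine Prod.ext (funext fun i => ?_) (funext fun i => ?_)
  · rcases lt_or_ge i N with hi | hi
    · have h1 := xPlus_eq_max hq ht ha hb ω ⟨i, hi⟩
      rw [h', ← xPlus_eq_max hq ht ha hb ω' ⟨i, hi⟩] at h1
      exact qPow_injective hq (mul_left_cancel₀ (inv_ne_zero ha.ne')
        (mul_right_cancel₀ (pow_ne_zero _ ht.1.ne') h1))
    · rw [htop _ _ _ (hω.fst i) (by omega) hi, htop _ _ _ (hω'.fst i) (by omega) hi]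
  · rcases lt_or_ge i N with hi | hi
    · have h1 := xMinus_eq_min hq ht ha hb ω (Fin.rev ⟨i, hi⟩)
      rw [h', ← xMinus_eq_min hq ht ha hb ω' (Fin.rev ⟨i, hi⟩), Fin.rev_rev] at h1
      exact qPow_injective hq (mul_left_cancel₀ (inv_ne_zero hb.ne)
        (mul_right_cancel₀ (pow_ne_zero _ ht.1.ne') h1))
    · rw [htop _ _ _ (hω.snd i) (by omega) hi, htop _ _ _ (hω'.snd i) (by omega) hi]

theorem config_antitone (hq : q ∈ Set.Ioo (0 : ℝ) 1) (ht : t ∈ Set.Ioo (0 : ℝ) 1) (ha : 0 < a)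
    (hb : b < 0) (ω : Omega N) : Antitone (config q t a b ω) := by
  intro i j hij
  have key : ∀ (k : ℕ → ℕ∞), Monotone k → ∀ i j : ℕ, i ≤ j →
      qPow q (k j) * t ^ j ≤ qPow q (k i) * t ^ i := fun k hk i j hij =>
    mul_le_mul (qPow_antitone hq (hk hij)) (pow_le_pow_of_le_one ht.1.le ht.2.le hij)
      (pow_nonneg ht.1.le _) (qPow_nonneg hq _)
  refine add_le_add ?_ ?_
  · simp only [xPlus, mul_assoc]
    exact mul_le_mul_of_nonneg_left (key _ ω.2.1 i j hij) (inv_nonneg.mpr ha.le)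
  · simp only [xMinus, mul_assoc]
    exact mul_le_mul_of_nonpos_left (key _ ω.2.2.1 _ _ (Fin.rev_le_rev.mpr hij))
      (inv_nonpos.mpr hb.le)

theorem metrizableSpace_omega (N : ℕ) : TopologicalSpace.MetrizableSpace (Omega N) := by
  have hq : (2⁻¹ : ℝ) ∈ Set.Ioo (0 : ℝ) 1 := by constructor <;> norm_num
  exact ((continuous_config hq 2⁻¹ 1 (-1) N).isClosedEmbedding
    (config_injective hq hq one_pos (by norm_num))).isEmbedding.metrizableSpace

/-! ## The embedding of symmetric polynomials -/

theorem eq_of_antitone_of_forall_value_eq {X Y : Fin N → ℝ} (hX : Antitone X) (hY : Antitone Y)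
    (h : ∀ f : SymPoly N, f.value X = f.value Y) : X = Y := by
  have h1 : evalAt X = evalAt Y := AlgHom.ext fun f => by rw [evalAt_apply, evalAt_apply, h]
  have h2 : Lagrange.nodal Finset.univ X = Lagrange.nodal Finset.univ Y := by
    rw [← map_nodalSym, ← map_nodalSym, h1]
  have h3 : ∀ X : Fin N → ℝ, (Lagrange.nodal Finset.univ X).roots = (List.ofFn X : Multiset ℝ) := by
    intro X
    have : Lagrange.nodal Finset.univ X =
        ((Finset.univ.val.map X).map fun a => Polynomial.X - Polynomial.C a).prod := by
      rw [Multiset.map_map]; rfl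
    rw [this, Polynomial.roots_multiset_prod_X_sub_C, Fin.univ_val_map]
  have h4 : List.Perm (List.ofFn X) (List.ofFn Y) := by
    rw [← Multiset.coe_eq_coe, ← h3, ← h3, h2]
  exact List.ofFn_injective
    (h4.eq_of_pairwise' hX.sortedGE_ofFn.pairwise hY.sortedGE_ofFn.pairwise)

theorem embed_apply (hq : q ∈ Set.Ioo (0 : ℝ) 1) (f : SymPoly N) (ω : Omega N) :
    embed hq t a b N f ω = f.value (config q t a b ω) := rfl

theorem denseRange_embed (hq : q ∈ Set.Ioo (0 : ℝ) 1) (ht : t ∈ Set.Ioo (0 : ℝ) 1) (ha : 0 < a)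
    (hb : b < 0) : DenseRange (embed hq t a b N) := by
  have h := ContinuousMap.subalgebra_topologicalClosure_eq_top_of_separatesPoints
    (embed hq t a b N).range (by
      intro ω ω' hne
      by_contra! hcon
      refine hne (config_injective hq ht ha hb (eq_of_antitone_of_forall_value_eq
        (config_antitone hq ht ha hb ω) (config_antitone hq ht ha hb ω') fun f => ?_))
      exact hcon _ ⟨embed hq t a b N f, ⟨f, rfl⟩, rfl⟩)
  rw [DenseRange, dense_iff_closure_eq]
  have h' := congrArg (fun A : Subalgebra ℝ C(Omega N, ℝ) => (A : Set C(Omega N, ℝ))) h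
  simpa using h'

theorem exists_config_eq_of_monotone (k : Fin N → ℕ) (hk : Monotone k) (hk1 : ∀ i, 1 ≤ k i) :
    ∃ ω : Omega N, config q t a b ω = fun i : Fin N => a⁻¹ * q ^ k i * t ^ (i : ℕ) := by
  refine ⟨⟨(fun i => if h : i < N then (k ⟨i, h⟩ : ℕ∞) else ⊤, fun _ => ⊤),
    mem_omegaSet_of_counts (n := N) (m := 0) ?_ monotone_const ?_ (by simp) (by simp) ?_ (by simp)⟩, ?_⟩
  · intro i j hij
    by_cases hj : j < N
    · have hi : i < N := by omega
      simp only [hj, hi, dif_pos]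
      exact_mod_cast hk hij
    · simp [hj]
  · intro i
    by_cases hi : i < N
    · simp only [hi, dif_pos]
      exact_mod_cast hk1 _
    · simp [hi]
  · intro i hi
    simp [not_lt.mpr hi]
  · funext i
    simp [config, xPlus, xMinus, qPow_top, qPow_natCast]

theorem embed_injective (hq : q ∈ Set.Ioo (0 : ℝ) 1) (ht : t ∈ Set.Ioo (0 : ℝ) 1) (ha : 0 < a) :
    Function.Injective (embed hq t a b N) := by
  rw [injective_iff_map_eq_zero]
  intro f hf
  refine Subtype.ext (MvPolynomial.eq_zero_of_eval_eq_zero_of_monotone hq ht.1.ne' ha.ne' _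
    fun k hk hk1 => ?_)
  obtain ⟨ω, hω⟩ := exists_config_eq_of_monotone (q := q) (t := t) (a := a) (b := b) k hk hk1
  have := DFunLike.congr_fun hf ω
  rw [embed_apply, hω] at this
  exact this

/-! ## Moves of particles -/

/-- The configuration with the roles of positive and negative particles exchanged. -/
def Omega.swap (ω : Omega N) : Omega N :=
  ⟨(ω.1.2, ω.1.1), ω.2.2.1, ω.2.1, ω.2.2.2.2.1, ω.2.2.2.1, by
    have := ω.2.2.2.2.2
    rw [size] at this ⊢
    rwa [add_comm]⟩

theorem Omega.swap_swap (ω : Omega N) : ω.swap.swap = ω := rfl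

theorem Omega.HasCounts.swap (h : ω.HasCounts n m) : ω.swap.HasCounts m n :=
  ⟨by have := h.le; omega, h.snd, h.fst⟩

/-- Reflection of a tuple. -/
def reflect (X : Fin N → ℝ) : Fin N → ℝ := fun i => -X (Fin.rev i)

theorem reflect_reflect (X : Fin N → ℝ) : reflect (reflect X) = X := by
  funext i; simp [reflect]

theorem config_swap (ω : Omega N) : config q t (-b) (-a) ω.swap = reflect (config q t a b ω) := by
  funext i
  simp only [config, reflect, xPlus, xMinus, Omega.swap, Fin.rev_rev, inv_neg]
  ring

theorem reflect_update (X : Fin N → ℝ) (i : Fin N) (x : ℝ) :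
    reflect (Function.update X i x) = Function.update (reflect X) (Fin.rev i) (-x) := by
  funext j
  by_cases h : j = Fin.rev i
  · subst h; simp [reflect]
  · have h' : Fin.rev j ≠ i := fun e => h (by rw [← e, Fin.rev_rev])
    simp [reflect, Function.update_of_ne h, Function.update_of_ne h']

theorem reflect_scale (X : Fin N → ℝ) (r : ℝ) (i : Fin N) :
    reflect (scale r i X) = scale r (Fin.rev i) (reflect X) := by
  rw [scale, reflect_update, scale]
  simp [reflect]

theorem shiftCoeff_reflect (X : Fin N → ℝ) (r : ℝ) (i : Fin N) :
    shiftCoeff Finset.univ r (Fin.rev i) (reflect X) = shiftCoeff Finset.univ r i X := by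
  refine Finset.prod_nbij' Fin.rev Fin.rev ?_ ?_ (fun j _ => Fin.rev_rev j) (fun j _ => Fin.rev_rev j)
    fun j _ => ?_
  · intro j hj
    rw [Finset.mem_erase] at hj ⊢
    exact ⟨fun e => hj.1 (by rw [← e, Fin.rev_rev]), Finset.mem_univ _⟩
  · intro j hj
    rw [Finset.mem_erase] at hj ⊢
    exact ⟨fun e => hj.1 (Fin.rev_injective e), Finset.mem_univ _⟩
  · simp only [reflect, Fin.rev_rev]
    rw [← neg_div_neg_eq]
    congr 1 <;> ring

/-- A positive particle may be placed at a free position. -/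
theorem Omega.HasCounts.exists_update (h : ω.HasCounts n m) (i : Fin N) (hin : (i : ℕ) ≤ n)
    (him : (i : ℕ) + m < N) {j : ℕ} (hj : 1 ≤ j) (hlt : ∀ i' : ℕ, i' < i → ω.1.1 i' ≤ j)
    (hgt : ∀ i' : ℕ, (i : ℕ) < i' → (j : ℕ∞) ≤ ω.1.1 i') :
    ∃ ω' : Omega N, ω'.HasCounts (max n (i + 1)) m ∧ ω'.1.2 = ω.1.2 ∧ ∀ a b,
      config q t a b ω' = Function.update (config q t a b ω) i (a⁻¹ * q ^ j * t ^ (i : ℕ)) := by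
  have hle := h.le
  have hmono : Monotone (Function.update ω.1.1 i (j : ℕ∞)) := by
    intro x y hxy
    by_cases hx : x = i <;> by_cases hy : y = i
    · rw [hx, hy]
    · subst hx
      rw [Function.update_self, Function.update_of_ne hy]
      exact hgt y (by omega)
    · subst hy
      rw [Function.update_self, Function.update_of_ne hx]
      exact hlt x (by omega)
    · rw [Function.update_of_ne hx, Function.update_of_ne hy]
      exact ω.2.1 hxy
  have hone : ∀ x, 1 ≤ Function.update ω.1.1 i (j : ℕ∞) x := by
    intro x
    by_cases hx : x = i
    · subst hx
      rw [Function.update_self]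
      exact_mod_cast hj
    · rw [Function.update_of_ne hx]
      exact ω.2.2.2.1 x
  have hfst : ∀ x, Function.update ω.1.1 i (j : ℕ∞) x ≠ ⊤ ↔ x < max n (i + 1) := by
    intro x
    by_cases hx : x = i
    · subst hx
      rw [Function.update_self]
      simp
    · rw [Function.update_of_ne hx, h.fst]
      constructor
      · intro hx'; exact lt_max_of_lt_left hx'
      · intro hx'
        rcases lt_max_iff.mp hx' with h1 | h1
        · exact h1
        · omega
  refine ⟨⟨(Function.update ω.1.1 i (j : ℕ∞), ω.1.2),
    mem_omegaSet_of_counts (n := max n (i + 1)) (m := m) hmono ω.2.2.1 hone ω.2.2.2.2.1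
      (by omega) (fun x hx => ?_) (fun x hx => ?_)⟩, ⟨by omega, hfst, h.snd⟩, rfl, fun a b => ?_⟩
  · by_contra h'
    exact absurd ((hfst x).mp h') (not_lt.mpr hx)
  · by_contra h'
    exact absurd ((h.snd x).mp h') (not_lt.mpr hx)
  · funext x
    by_cases hx : x = i
    · subst hx
      have := h.xMinus_eq_zero (q := q) (t := t) (b := b) (i := Fin.rev x)
        (by rw [Fin.val_rev]; omega)
      rw [Function.update_self]
      change a⁻¹ * qPow q (Function.update ω.1.1 (x : ℕ) (j : ℕ∞) x) * t ^ (x : ℕ) +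
        xMinus q t b ω (Fin.rev x) = _
      rw [this, Function.update_self, qPow_natCast, add_zero]
    · have hx' : (x : ℕ) ≠ i := fun e => hx (Fin.ext e)
      rw [Function.update_of_ne hx]
      change a⁻¹ * qPow q (Function.update ω.1.1 (i : ℕ) (j : ℕ∞) x) * t ^ (x : ℕ) +
        xMinus q t b ω (Fin.rev x) = _
      rw [Function.update_of_ne hx']
      rfl

theorem Omega.HasCounts.exists_eq_natCast (h : ω.HasCounts n m) {i : ℕ} (hi : i < n) :
    ∃ k : ℕ, ω.1.1 i = k := by
  have := (h.fst i).mpr hi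
  lift ω.1.1 i to ℕ using this with k hk
  exact ⟨k, rfl⟩

theorem Omega.HasCounts.config_eq (h : ω.HasCounts n m) {i : Fin N} (hi : (i : ℕ) < n) {k : ℕ}
    (hk : ω.1.1 i = k) : config q t a b ω i = a⁻¹ * q ^ k * t ^ (i : ℕ) := by
  have := h.le
  rw [h.config_of_lt (by omega), xPlus, hk, qPow_natCast]

theorem Omega.HasCounts.config_pos (h : ω.HasCounts n m) (hq : q ∈ Set.Ioo (0 : ℝ) 1)
    (ht : t ∈ Set.Ioo (0 : ℝ) 1) (ha : 0 < a) {i : Fin N} (hi : (i : ℕ) < n) :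
    0 < config q t a b ω i := by
  obtain ⟨k, hk⟩ := h.exists_eq_natCast hi
  rw [h.config_eq hi hk]
  have := hq.1
  have := ht.1
  positivity

theorem Omega.HasCounts.config_le_mul (h : ω.HasCounts n m) (hq : q ∈ Set.Ioo (0 : ℝ) 1)
    (ht : t ∈ Set.Ioo (0 : ℝ) 1) (ha : 0 < a) (hb : b < 0) {i j : Fin N} (hij : i < j)
    (hi : (i : ℕ) < n) : config q t a b ω j ≤ t * config q t a b ω i := by
  have hle := h.le
  rw [h.config_of_lt (i := i) (by omega)]
  rcases lt_or_ge (j : ℕ) n with hj | hj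
  · rw [h.config_of_lt (i := j) (by omega), xPlus, xPlus, mul_assoc,
      show t * (a⁻¹ * qPow q (ω.1.1 i) * t ^ (i : ℕ)) =
        a⁻¹ * (qPow q (ω.1.1 i) * t ^ ((i : ℕ) + 1)) by ring]
    refine mul_le_mul_of_nonneg_left ?_ (inv_nonneg.mpr ha.le)
    exact mul_le_mul (qPow_antitone hq (ω.2.1 (le_of_lt hij)))
      (pow_le_pow_of_le_one ht.1.le ht.2.le hij) (pow_nonneg ht.1.le _) (qPow_nonneg hq _)
  · rw [h.config_of_ge hj]
    exact (xMinus_nonpos hq ht hb ω _).trans (mul_nonneg ht.1.le (xPlus_nonneg hq ht ha ω _))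

theorem Omega.HasCounts.shiftCoeff_nonneg (h : ω.HasCounts n m) (hq : q ∈ Set.Ioo (0 : ℝ) 1)
    (ht : t ∈ Set.Ioo (0 : ℝ) 1) (ha : 0 < a) (hb : b < 0) {i : Fin N} (hi : (i : ℕ) < n) :
    0 ≤ shiftCoeff Finset.univ t i (config q t a b ω) ∧
      0 ≤ shiftCoeff Finset.univ t⁻¹ i (config q t a b ω) := by
  set X := config q t a b ω
  have h0 : 0 < X i := h.config_pos hq ht ha hi
  have h1 : t * X i < X i := by nlinarith [ht.2]
  have h2 : X i < t⁻¹ * X i := by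
    have := (one_lt_inv₀ ht.1).mpr ht.2
    nlinarith
  have key : ∀ j ∈ Finset.univ.erase i, 0 ≤ (t * X i - X j) / (X i - X j) ∧
      0 ≤ (t⁻¹ * X i - X j) / (X i - X j) := by
    intro j hj
    rcases lt_or_gt_of_ne (Finset.ne_of_mem_erase hj) with hji | hij
    · have h3 : X i ≤ t * X j := h.config_le_mul hq ht ha hb hji (by have : (j : ℕ) < i := hji; omega)
      have h4 : t⁻¹ * X i ≤ X j := by rwa [inv_mul_le_iff₀ ht.1]
      constructor <;> apply div_nonneg_of_nonpos <;> linarith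
    · have h3 : X j ≤ t * X i := h.config_le_mul hq ht ha hb hij hi
      constructor <;> apply div_nonneg <;> linarith
  exact ⟨Finset.prod_nonneg fun j hj => (key j hj).1, Finset.prod_nonneg fun j hj => (key j hj).2⟩

theorem kap_pos (hq : q ∈ Set.Ioo (0 : ℝ) 1) (ht : t ∈ Set.Ioo (0 : ℝ) 1) (ha : 0 < a)
    (hb : b < 0) : 0 < kap N q t a b := by
  rw [kap, neg_pos]
  exact div_neg_of_pos_of_neg (mul_pos hq.1 (pow_pos ht.1 _)) (mul_neg_of_pos_of_neg ha hb)

theorem sigmaPlusRe_nonneg (hq : q ∈ Set.Ioo (0 : ℝ) 1) (ht : t ∈ Set.Ioo (0 : ℝ) 1) (ha : 0 < a)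
    (hb : b < 0) (d : ℂ) (x : ℝ) : 0 ≤ sigmaPlusRe N q t a b d x :=
  mul_nonneg (kap_pos hq ht ha hb).le (by positivity)

theorem Omega.HasCounts.sigmaMinus_nonneg (h : ω.HasCounts n m) (hq : q ∈ Set.Ioo (0 : ℝ) 1)
    (ht : t ∈ Set.Ioo (0 : ℝ) 1) (ha : 0 < a) (hb : b < 0) {i : Fin N} (hi : (i : ℕ) < n) :
    0 ≤ sigmaMinus N q t a b (config q t a b ω i) := by
  have h0 : 0 < config q t a b ω i := h.config_pos hq ht ha hi
  rw [sigmaMinus_eq]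
  refine mul_nonneg (mul_nonneg hq.1.le (kap_pos hq ht ha hb).le) (mul_nonneg_of_nonpos_of_nonpos ?_ ?_)
  · have h1 : config q t a b ω i ≤ a⁻¹ * q := by
      have hle := h.le
      rw [h.config_of_lt (by omega), xPlus, mul_assoc]
      refine mul_le_mul_of_nonneg_left ?_ (inv_nonneg.mpr ha.le)
      have h2 : qPow q (ω.1.1 i) ≤ q := by
        have := qPow_antitone hq (ω.2.2.2.1 i)
        rwa [show (1 : ℕ∞) = ((1 : ℕ) : ℕ∞) by norm_num, qPow_natCast, pow_one] at this
      calc qPow q (ω.1.1 i) * t ^ (i : ℕ) ≤ q * 1 :=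
            mul_le_mul h2 (pow_le_one₀ ht.1.le ht.2.le) (pow_nonneg ht.1.le _) hq.1.le
        _ = q := mul_one q
    have h3 := inv_anti₀ h0 h1
    rw [mul_inv, inv_inv] at h3
    linarith
  · have h1 : b * q⁻¹ < 0 := mul_neg_of_neg_of_pos hb (inv_pos.mpr hq.1)
    have h2 : 0 < (config q t a b ω i)⁻¹ := inv_pos.mpr h0
    linarith

/-- A particle to the right of the origin jumps only to admissible configurations. -/
theorem Omega.HasCounts.exists_scale (h : ω.HasCounts n m)
    {i : Fin N} (hi : (i : ℕ) < n) (hne : shiftCoeff Finset.univ t i (config q t a b ω) ≠ 0) :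
    ∃ ω' : Omega N, config q t a b ω' = scale q i (config q t a b ω) := by
  have hle := h.le
  obtain ⟨k, hk⟩ := h.exists_eq_natCast hi
  have hk1 : (1 : ℕ∞) ≤ k := hk ▸ ω.2.2.2.1 i
  have hlt : ∀ i' : ℕ, i' < i → ω.1.1 i' ≤ (k + 1 : ℕ) := by
    intro i' hi'
    refine (ω.2.1 hi'.le).trans ?_
    rw [hk]
    exact_mod_cast Nat.le_succ k
  have hgt : ∀ i' : ℕ, (i : ℕ) < i' → ((k + 1 : ℕ) : ℕ∞) ≤ ω.1.1 i' := by
    intro i' hi'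
    refine le_trans ?_ (ω.2.1 (show (i : ℕ) + 1 ≤ i' from hi'))
    by_cases hi1 : (i : ℕ) + 1 < n
    · obtain ⟨l, hl⟩ := h.exists_eq_natCast hi1
      have hkl : k ≤ l := by
        have := ω.2.1 (Nat.le_succ (i : ℕ))
        rw [hk] at this
        have h' : ((k : ℕ) : ℕ∞) ≤ l := this.trans hl.le
        exact_mod_cast h'
      rw [hl]
      rcases hkl.eq_or_lt with rfl | hlt
      · exfalso
        have hiN : (i : ℕ) + 1 < N := by omega
        have h1 := Finset.prod_ne_zero_iff.mp hne ⟨i + 1, hiN⟩ (by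
          rw [Finset.mem_erase]
          exact ⟨fun e => by simpa using congrArg Fin.val e, Finset.mem_univ _⟩)
        rw [h.config_eq hi hk, h.config_eq (i := ⟨i + 1, hiN⟩) hi1 hl] at h1
        refine h1 ?_
        rw [div_eq_zero_iff]
        left
        simp only
        ring
      · exact_mod_cast hlt
    · have : ω.1.1 ((i : ℕ) + 1) = ⊤ := by
        by_contra h'
        exact hi1 ((h.fst _).mp h')
      rw [this]
      exact le_top
  obtain ⟨ω', -, -, hω'⟩ := h.exists_update (q := q) (t := t) i hi.le (by omega) (j := k + 1)
    (by omega) hlt hgt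
  refine ⟨ω', (hω' a b).trans ?_⟩
  rw [scale, h.config_eq hi hk]
  congr 1
  ring

theorem Omega.HasCounts.exists_scale_inv (h : ω.HasCounts n m) (hq : q ∈ Set.Ioo (0 : ℝ) 1)
    (ht : t ≠ 0) {i : Fin N} (hi : (i : ℕ) < n)
    (hne : shiftCoeff Finset.univ t⁻¹ i (config q t a b ω) ≠ 0)
    (hne' : sigmaMinus N q t a b (config q t a b ω i) ≠ 0) :
    ∃ ω' : Omega N, config q t a b ω' = scale q⁻¹ i (config q t a b ω) := by
  have hle := h.le
  obtain ⟨k, hk⟩ := h.exists_eq_natCast hi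
  have hk1 : (1 : ℕ∞) ≤ k := hk ▸ ω.2.2.2.1 i
  have hk1' : 1 ≤ k := by exact_mod_cast hk1
  have hprev : ∀ i' : ℕ, i' < i → ω.1.1 i' ≤ (k - 1 : ℕ) := by
    intro i' hi'
    obtain ⟨l, hl⟩ := h.exists_eq_natCast (show (i : ℕ) - 1 < n by omega)
    refine (ω.2.1 (show i' ≤ (i : ℕ) - 1 by omega)).trans ?_
    have hlk : l ≤ k := by
      have := ω.2.1 (show (i : ℕ) - 1 ≤ i by omega)
      rw [hl, hk] at this
      exact_mod_cast this
    rcases hlk.eq_or_lt with rfl | hlt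
    · exfalso
      have hiN : (i : ℕ) - 1 < N := by omega
      have h1 := Finset.prod_ne_zero_iff.mp hne ⟨i - 1, hiN⟩ (by
        rw [Finset.mem_erase]
        refine ⟨fun e => ?_, Finset.mem_univ _⟩
        have : (i : ℕ) - 1 = i := congrArg Fin.val e
        omega)
      rw [h.config_eq hi hk, h.config_eq (i := ⟨i - 1, hiN⟩) (show (i : ℕ) - 1 < n by omega) hl] at h1
      refine h1 ?_
      rw [div_eq_zero_iff]
      left
      have e : t ^ (i : ℕ) = t * t ^ ((i : ℕ) - 1) := by
        rw [← pow_succ']; congr 1; omega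
      rw [e]
      field_simp
      ring
    · rw [hl]
      exact_mod_cast (show l ≤ k - 1 by omega)
  have hk2 : 2 ≤ k := by
    rcases Nat.eq_zero_or_pos (i : ℕ) with h0 | h0
    · by_contra! hlt
      have hk' : k = 1 := by omega
      refine hne' ?_
      rw [h.config_eq hi hk, hk', h0, sigmaMinus_eq]
      simp only [pow_zero, pow_one, mul_one, mul_inv, inv_inv, sub_self, zero_mul, mul_zero]
    · have h1 := hprev 0 h0
      have h2 : ((1 : ℕ) : ℕ∞) ≤ (k - 1 : ℕ) := le_trans (by exact_mod_cast ω.2.2.2.1 0) h1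
      have : 1 ≤ k - 1 := by exact_mod_cast h2
      omega
  have hgt : ∀ i' : ℕ, (i : ℕ) < i' → ((k - 1 : ℕ) : ℕ∞) ≤ ω.1.1 i' := by
    intro i' hi'
    refine le_trans ?_ (ω.2.1 hi'.le)
    rw [hk]
    exact_mod_cast Nat.sub_le k 1
  obtain ⟨ω', -, -, hω'⟩ := h.exists_update (q := q) (t := t) i hi.le (by omega) (j := k - 1)
    (by omega) hprev hgt
  refine ⟨ω', (hω' a b).trans ?_⟩
  rw [scale, h.config_eq hi hk]
  congr 1
  have e : q ^ k = q * q ^ (k - 1) := by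
    rw [← pow_succ']; congr 1; omega
  have := hq.1.ne'
  rw [e]
  field_simp

/-- The jumps of one nonzero particle contribute nonnegatively at a minimum point. -/
theorem jump_nonneg (hq : q ∈ Set.Ioo (0 : ℝ) 1) (ht : t ∈ Set.Ioo (0 : ℝ) 1) (ha : 0 < a)
    (hb : b < 0) (d : ℂ) (φ : (Fin N → ℝ) → ℝ) (ω : Omega N)
    (hφ : ∀ ω' : Omega N, φ (config q t a b ω) ≤ φ (config q t a b ω')) {i : Fin N}
    (hi : config q t a b ω i ≠ 0) :
    0 ≤ shiftCoeff Finset.univ t i (config q t a b ω) * sigmaPlusRe N q t a b d (config q t a b ω i) *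
        (φ (scale q i (config q t a b ω)) - φ (config q t a b ω)) +
      shiftCoeff Finset.univ t⁻¹ i (config q t a b ω) * sigmaMinus N q t a b (config q t a b ω i) *
        (φ (scale q⁻¹ i (config q t a b ω)) - φ (config q t a b ω)) := by
  have key : ∀ {a b : ℝ} (_ : 0 < a) (_ : b < 0) (φ : (Fin N → ℝ) → ℝ) (ω : Omega N) (i : Fin N)
      {n m : ℕ} (_ : ω.HasCounts n m) (_ : (i : ℕ) < n)
      (_ : ∀ ω' : Omega N, φ (config q t a b ω) ≤ φ (config q t a b ω')),
      0 ≤ shiftCoeff Finset.univ t i (config q t a b ω) *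
        (φ (scale q i (config q t a b ω)) - φ (config q t a b ω)) ∧
      0 ≤ shiftCoeff Finset.univ t⁻¹ i (config q t a b ω) *
        sigmaMinus N q t a b (config q t a b ω i) *
        (φ (scale q⁻¹ i (config q t a b ω)) - φ (config q t a b ω)) := by
    intro a b ha hb φ ω i n m h hi hφ
    obtain ⟨h1, h2⟩ := h.shiftCoeff_nonneg hq ht ha hb hi
    have h3 := h.sigmaMinus_nonneg hq ht ha hb hi
    constructor
    · by_cases hz : shiftCoeff Finset.univ t i (config q t a b ω) = 0
      · rw [hz, zero_mul]
      · obtain ⟨ω', hω'⟩ := h.exists_scale hi hz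
        exact mul_nonneg h1 (sub_nonneg.mpr (hω' ▸ hφ ω'))
    · by_cases hz : shiftCoeff Finset.univ t⁻¹ i (config q t a b ω) = 0
      · rw [hz, zero_mul, zero_mul]
      by_cases hz' : sigmaMinus N q t a b (config q t a b ω i) = 0
      · rw [hz', mul_zero, zero_mul]
      · obtain ⟨ω', hω'⟩ := h.exists_scale_inv hq ht.1.ne' hi hz hz'
        exact mul_nonneg (mul_nonneg h2 h3) (sub_nonneg.mpr (hω' ▸ hφ ω'))
  have hσ := sigmaPlusRe_nonneg (N := N) hq ht ha hb d (config q t a b ω i)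
  obtain ⟨n, m, h⟩ := ω.exists_hasCounts
  suffices hs : 0 ≤ shiftCoeff Finset.univ t i (config q t a b ω) *
        (φ (scale q i (config q t a b ω)) - φ (config q t a b ω)) ∧
      0 ≤ shiftCoeff Finset.univ t⁻¹ i (config q t a b ω) *
        sigmaMinus N q t a b (config q t a b ω i) *
        (φ (scale q⁻¹ i (config q t a b ω)) - φ (config q t a b ω)) by
    refine add_nonneg ?_ hs.2
    rw [mul_right_comm]
    exact mul_nonneg hs.1 hσ
  rcases lt_or_ge (i : ℕ) n with hin | hin
  · exact key ha hb φ ω i h hin hφ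
  · have him : (Fin.rev i : ℕ) < m := by
      by_contra! hcon
      exact hi (by rw [h.config_of_ge hin, h.xMinus_eq_zero hcon])
    have h1 := key (a := -b) (b := -a) (by linarith) (by linarith) (fun Y => φ (reflect Y)) ω.swap
      (Fin.rev i) h.swap him (fun ω' => by
        have e : config q t (-b) (-a) ω' = reflect (config q t a b ω'.swap) := by
          rw [← config_swap, Omega.swap_swap]
        rw [config_swap, e, reflect_reflect, reflect_reflect]
        exact hφ _)
    have e2 : sigmaMinus N q t (-b) (-a) (reflect (config q t a b ω) (Fin.rev i)) =
        sigmaMinus N q t a b (config q t a b ω i) := by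
      simp only [reflect, Fin.rev_rev, sigmaMinus, inv_neg]
      ring
    rw [config_swap, shiftCoeff_reflect, shiftCoeff_reflect, ← reflect_scale, ← reflect_scale, e2] at h1
    simpa only [reflect_reflect] using h1

end

end QJacobi

namespace QJacobi

/-! ## Triangularity in the monomial basis -/

variable {N : ℕ}

theorem sum_mul_pow_rev_lt {B : ℕ} : ∀ {N : ℕ} {α : Fin N → ℕ}, (∀ i, α i < B) →
    ∑ i, α i * B ^ (Fin.rev i : ℕ) < B ^ N
  | 0, α, _ => by simp
  | N + 1, α, hα => by
    have h := sum_mul_pow_rev_lt (α := fun i => α i.succ) fun i => hα _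
    rw [Fin.sum_univ_succ]
    simp only [Fin.rev_succ, Fin.val_castSucc, Fin.rev_zero, Fin.val_last]
    have h1 : (α 0 + 1) * B ^ N ≤ B * B ^ N := Nat.mul_le_mul_right _ (hα 0)
    rw [pow_succ']
    linarith

theorem sum_mul_pow_rev_lt_of_lex {B : ℕ} : ∀ {N : ℕ} {α β : Fin N → ℕ}, (∀ i, α i < B) →
    (∃ i, (∀ j < i, α j = β j) ∧ α i < β i) →
    ∑ i, α i * B ^ (Fin.rev i : ℕ) < ∑ i, β i * B ^ (Fin.rev i : ℕ)
  | 0, α, β, _, ⟨i, _⟩ => i.elim0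
  | N + 1, α, β, hα, ⟨i, hi, hlt⟩ => by
    rw [Fin.sum_univ_succ, Fin.sum_univ_succ]
    simp only [Fin.rev_succ, Fin.val_castSucc, Fin.rev_zero, Fin.val_last]
    rcases Fin.eq_zero_or_eq_succ i with rfl | ⟨i, rfl⟩
    · have h := sum_mul_pow_rev_lt (α := fun i => α i.succ) fun i => hα _
      have h1 : (α 0 + 1) * B ^ N ≤ β 0 * B ^ N := Nat.mul_le_mul_right _ hlt
      have h2 := Nat.zero_le (∑ i : Fin N, β i.succ * B ^ (Fin.rev i : ℕ))
      linarith
    · rw [hi 0 (Fin.succ_pos i)]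
      exact Nat.add_lt_add_left (sum_mul_pow_rev_lt_of_lex (fun i => hα _)
        ⟨i, fun j hj => hi _ (Fin.succ_lt_succ_iff.mpr hj), hlt⟩) _

theorem toLex_lt_of_sum_mul_pow_rev_lt {B : ℕ} {α β : Fin N → ℕ} (hβ : ∀ i, β i < B)
    (h : ∑ i, α i * B ^ (Fin.rev i : ℕ) < ∑ i, β i * B ^ (Fin.rev i : ℕ)) :
    toLex α < toLex β := by
  by_contra hcon
  rcases (not_lt.mp hcon).eq_or_lt with he | hlt
  · rw [toLex.injective he] at h
    exact lt_irrefl _ h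
  · exact lt_asymm h (sum_mul_pow_rev_lt_of_lex hβ hlt)

theorem eq_of_sum_mul_pow_rev_eq {B : ℕ} {α β : Fin N → ℕ} (hα : ∀ i, α i < B) (hβ : ∀ i, β i < B)
    (h : ∑ i, α i * B ^ (Fin.rev i : ℕ) = ∑ i, β i * B ^ (Fin.rev i : ℕ)) : α = β := by
  rcases lt_trichotomy (toLex α) (toLex β) with hlt | he | hlt
  · exact absurd h (sum_mul_pow_rev_lt_of_lex hα hlt).ne
  · exact toLex.injective he
  · exact absurd h.symm (sum_mul_pow_rev_lt_of_lex hβ hlt).ne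

/-- The curve `s ↦ (s ^ w_i)_i` with well separated exponents. -/
def curve (N B : ℕ) (s : ℝ) (i : Fin N) : ℝ := s ^ B ^ (Fin.rev i : ℕ)

theorem prod_curve_pow (B : ℕ) (s : ℝ) (α : Fin N → ℕ) :
    ∏ i, curve N B s i ^ α i = s ^ ∑ i, α i * B ^ (Fin.rev i : ℕ) := by
  rw [← Finset.prod_pow_eq_pow_sum]
  refine Finset.prod_congr rfl fun i _ => ?_
  rw [curve, ← pow_mul, mul_comm]

theorem curve_ne_zero {s : ℝ} (hs : 1 < s) (B : ℕ) (i : Fin N) : curve N B s i ≠ 0 :=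
  (pow_pos (by linarith) _).ne'

theorem curve_injective {s : ℝ} (hs : 1 < s) {B : ℕ} (hB : 2 ≤ B) :
    Function.Injective (curve N B s) := by
  intro i j hij
  have h1 := pow_right_injective₀ (by linarith) hs.ne' hij
  have h2 : ((Fin.rev i : Fin N) : ℕ) = Fin.rev j := Nat.pow_right_injective hB h1
  exact Fin.rev_injective (Fin.ext h2)

theorem tendsto_curve_inv (B : ℕ) (hB : 2 ≤ B) (i : Fin N) :
    Tendsto (fun s => (curve N B s i)⁻¹) atTop (𝓝 0) :=
  tendsto_inv_atTop_zero.comp (tendsto_pow_atTop (pow_pos (by omega) _).ne')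

theorem tendsto_curve_div {B : ℕ} (hB : 2 ≤ B) {i j : Fin N} (hij : i < j) :
    Tendsto (fun s => curve N B s j / curve N B s i) atTop (𝓝 0) :=
  tendsto_pow_div_pow_atTop_zero (Nat.pow_lt_pow_right hB (Fin.rev_lt_rev.mpr hij))

theorem tendsto_shiftCoeff_curve {B : ℕ} (hB : 2 ≤ B) (r : ℝ) (i : Fin N) :
    Tendsto (fun s => shiftCoeff Finset.univ r i (curve N B s)) atTop (𝓝 (r ^ (Fin.rev i : ℕ))) := by
  have h1 : ∀ j ∈ Finset.univ.erase i,
      Tendsto (fun s => (r * curve N B s i - curve N B s j) / (curve N B s i - curve N B s j))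
        atTop (𝓝 (if i < j then r else 1)) := by
    intro j hj
    rcases lt_or_gt_of_ne (Finset.ne_of_mem_erase hj) with hji | hij
    · rw [if_neg hji.asymm]
      have h2 := tendsto_curve_div (N := N) hB hji
      have h3 : Tendsto (fun s => (r * (curve N B s i / curve N B s j) - 1) /
          (curve N B s i / curve N B s j - 1)) atTop (𝓝 ((r * 0 - 1) / (0 - 1))) :=
        ((h2.const_mul r).sub_const 1).div (h2.sub_const 1) (by norm_num)
      rw [show (r * 0 - 1) / (0 - 1) = (1 : ℝ) by norm_num] at h3
      refine h3.congr' ?_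
      filter_upwards [eventually_gt_atTop 1] with s hs
      have h0 := curve_ne_zero hs B j
      rw [← mul_div_mul_right _ _ h0, sub_mul, sub_mul, mul_assoc, div_mul_cancel₀ _ h0, one_mul]
    · rw [if_pos hij]
      have h2 := tendsto_curve_div (N := N) hB hij
      have h3 : Tendsto (fun s => (r - curve N B s j / curve N B s i) /
          (1 - curve N B s j / curve N B s i)) atTop (𝓝 ((r - 0) / (1 - 0))) :=
        (h2.const_sub r).div (h2.const_sub 1) (by norm_num)
      rw [show (r - 0) / (1 - 0) = r by norm_num] at h3
      refine h3.congr' ?_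
      filter_upwards [eventually_gt_atTop 1] with s hs
      have h0 := curve_ne_zero hs B i
      rw [← mul_div_mul_right _ _ h0, sub_mul, sub_mul, div_mul_cancel₀ _ h0, one_mul]
  have h2 := tendsto_finsetProd _ h1
  rw [Finset.prod_ite, Finset.prod_const_one, mul_one, Finset.prod_const,
    show (Finset.univ.erase i).filter (fun j => i < j) = Finset.Ioi i by
      ext j
      simp only [Finset.mem_filter, Finset.mem_erase, Finset.mem_univ, and_true, Finset.mem_Ioi]
      exact ⟨fun h => h.2, fun h => ⟨h.ne', h⟩⟩,
    Fin.card_Ioi, show N - 1 - (i : ℕ) = (Fin.rev i : ℕ) by rw [Fin.val_rev]; omega] at h2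
  exact h2

theorem eq_of_antitone_comp_perm {lam : Fin N → ℕ} (hlam : Antitone lam) {σ : Equiv.Perm (Fin N)}
    (h : Antitone (lam ∘ σ)) : lam ∘ σ = lam := by
  have := Tuple.unique_monotone (f := OrderDual.toDual ∘ lam) (σ := σ) (τ := 1)
    (fun i j hij => h hij) (fun i j hij => hlam hij)
  funext i
  exact congrFun this i

theorem sum_comp_perm_mul_pow_rev_lt {B : ℕ} (hB : 2 ≤ B) {lam : Fin N → ℕ} (hlam : Antitone lam)
    {σ : Equiv.Perm (Fin N)} (h : lam ∘ σ ≠ lam) :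
    ∑ i, (lam ∘ σ) i * B ^ (Fin.rev i : ℕ) < ∑ i, lam i * B ^ (Fin.rev i : ℕ) := by
  have hw : StrictAnti fun i : Fin N => B ^ (Fin.rev i : ℕ) := fun i j hij =>
    Nat.pow_lt_pow_right hB (Fin.rev_lt_rev.mpr hij)
  refine (Monovary.sum_comp_perm_mul_lt_sum_mul_iff ?_).mpr fun hcon => h ?_
  · intro i j hij
    exact hlam (hw.lt_iff_gt.mp hij).le
  · refine eq_of_antitone_comp_perm hlam fun i j hij => ?_
    rcases hij.eq_or_lt with rfl | hlt
    · exact le_rfl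
    · exact hcon (hw hlt)

theorem value_monomialSym (lam : Fin N → ℕ) (X : Fin N → ℝ) :
    (monomialSym lam).value X =
      ∑ α ∈ Finset.univ.image fun s : Equiv.Perm (Fin N) => lam ∘ s, ∏ i, X i ^ α i := by
  rw [SymPoly.value, monomialSym]
  simp only [monomialSum, map_sum, MvPolynomial.eval_monomial, one_mul]
  refine Finset.sum_congr rfl fun α _ => ?_
  rw [Finsupp.prod_fintype _ _ fun i => pow_zero _]
  rfl

theorem prod_scale_pow (r : ℝ) (i : Fin N) (X : Fin N → ℝ) (α : Fin N → ℕ) :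
    ∏ j, scale r i X j ^ α j = r ^ α i * ∏ j, X j ^ α j := by
  rw [← Finset.mul_prod_erase _ _ (Finset.mem_univ i),
    ← Finset.mul_prod_erase _ (fun j => X j ^ α j) (Finset.mem_univ i), ← mul_assoc, ← mul_pow,
    scale, Function.update_self]
  refine congrArg _ (Finset.prod_congr rfl fun j hj => ?_)
  rw [Function.update_of_ne (Finset.ne_of_mem_erase hj)]

/-- Leading asymptotics of a monomial symmetric polynomial along the curve. -/
theorem tendsto_monomialSym_scale_curve {B : ℕ} (hB : 2 ≤ B) {lam : Fin N → ℕ} (hlam : Antitone lam)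
    (r : ℝ) (i : Fin N) :
    Tendsto (fun s => (monomialSym lam).value (scale r i (curve N B s)) /
      s ^ ∑ i, lam i * B ^ (Fin.rev i : ℕ)) atTop (𝓝 (r ^ lam i)) := by
  simp only [value_monomialSym, prod_scale_pow, Finset.sum_div, prod_curve_pow]
  set S := Finset.univ.image fun s : Equiv.Perm (Fin N) => lam ∘ s with hS
  have hmem : lam ∈ S := Finset.mem_image.mpr ⟨1, Finset.mem_univ _, rfl⟩
  have h1 : ∀ α ∈ S, Tendsto (fun s : ℝ => r ^ α i * s ^ (∑ i, α i * B ^ (Fin.rev i : ℕ)) /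
      s ^ ∑ i, lam i * B ^ (Fin.rev i : ℕ)) atTop (𝓝 (if α = lam then r ^ lam i else 0)) := by
    intro α hα
    obtain ⟨σ, -, rfl⟩ := Finset.mem_image.mp hα
    split_ifs with hσ
    · rw [hσ]
      refine tendsto_const_nhds.congr' ?_
      filter_upwards [eventually_gt_atTop 0] with s hs
      rw [mul_div_cancel_right₀ _ (pow_pos hs _).ne']
    · have h2 := (tendsto_pow_div_pow_atTop_zero (𝕜 := ℝ)
        (sum_comp_perm_mul_pow_rev_lt hB hlam hσ)).const_mul (r ^ (lam ∘ σ) i)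
      rw [mul_zero] at h2
      exact h2.congr fun s => by rw [mul_div_assoc]
  have h2 := tendsto_finsetSum _ h1
  rwa [Finset.sum_ite_eq' S lam, if_pos hmem] at h2

theorem scale_one (i : Fin N) (X : Fin N → ℝ) : scale 1 i X = X := by
  rw [scale, one_mul, Function.update_eq_self]

/-- The diagonal entries of the operator in the monomial basis. -/
noncomputable def diagEntry (q t a b : ℝ) (d : ℂ) (lam : Fin N → ℕ) : ℝ :=
  ∑ i, (t ^ (Fin.rev i : ℕ) * (kap N q t a b * (d.re ^ 2 + d.im ^ 2)) * (q ^ lam i - 1) +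
    t⁻¹ ^ (Fin.rev i : ℕ) * (q * kap N q t a b * (a * q⁻¹ * (b * q⁻¹))) * (q⁻¹ ^ lam i - 1))

theorem diagEntry_nonpos {q t a b : ℝ} (hq : q ∈ Set.Ioo (0 : ℝ) 1) (ht : t ∈ Set.Ioo (0 : ℝ) 1)
    (ha : 0 < a) (hb : b < 0) (d : ℂ) (lam : Fin N → ℕ) : diagEntry q t a b d lam ≤ 0 := by
  have hk := kap_pos (N := N) hq ht ha hb
  have h1 := hq.1
  have h2 := ht.1
  refine Finset.sum_nonpos fun i _ => add_nonpos ?_ ?_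
  · refine mul_nonpos_of_nonneg_of_nonpos (by positivity) ?_
    linarith [pow_le_one₀ (n := lam i) hq.1.le hq.2.le]
  · refine mul_nonpos_of_nonpos_of_nonneg (mul_nonpos_of_nonneg_of_nonpos (by positivity)
      (mul_nonpos_of_nonneg_of_nonpos (by positivity) ?_)) ?_
    · exact mul_nonpos_of_nonneg_of_nonpos (by positivity)
        (mul_nonpos_of_nonpos_of_nonneg hb.le (by positivity))
    · linarith [one_le_pow₀ (n := lam i) ((one_lt_inv₀ hq.1).mpr hq.2).le]

theorem tendsto_qDifferenceRe_curve {B : ℕ} (hB : 2 ≤ B) (q t a b : ℝ) (d : ℂ) {lam : Fin N → ℕ}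
    (hlam : Antitone lam) :
    Tendsto (fun s => qDifferenceRe q t a b d (monomialSym lam).value (curve N B s) /
      s ^ ∑ i, lam i * B ^ (Fin.rev i : ℕ)) atTop (𝓝 (diagEntry q t a b d lam)) := by
  simp only [qDifferenceRe, Finset.sum_div]
  refine tendsto_finsetSum _ fun i _ => ?_
  have h0 := tendsto_monomialSym_scale_curve hB hlam 1 i
  simp only [scale_one, one_pow] at h0
  have hx := tendsto_curve_inv (N := N) B hB i
  have hd : ∀ r : ℝ, Tendsto (fun s => ((monomialSym lam).value (scale r i (curve N B s)) -
      (monomialSym lam).value (curve N B s)) / s ^ ∑ i, lam i * B ^ (Fin.rev i : ℕ)) atTop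
      (𝓝 (r ^ lam i - 1)) := fun r =>
    ((tendsto_monomialSym_scale_curve hB hlam r i).sub h0).congr fun s => (sub_div _ _ _).symm
  have hp : Tendsto (fun s => sigmaPlusRe N q t a b d (curve N B s i)) atTop
      (𝓝 (kap N q t a b * (d.re ^ 2 + d.im ^ 2))) := by
    have := ((((hx.const_sub d.re).pow 2).add_const (d.im ^ 2)).const_mul (kap N q t a b))
    rwa [sub_zero] at this
  have hm : Tendsto (fun s => sigmaMinus N q t a b (curve N B s i)) atTop
      (𝓝 (q * kap N q t a b * (a * q⁻¹ * (b * q⁻¹)))) := by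
    have := ((hx.const_sub (a * q⁻¹)).mul (hx.const_sub (b * q⁻¹))).const_mul (q * kap N q t a b)
    rw [sub_zero, sub_zero] at this
    exact this.congr fun s => (sigmaMinus_eq _ _ _ _ _).symm
  refine ((((tendsto_shiftCoeff_curve hB t i).mul hp).mul (hd q)).add
    (((tendsto_shiftCoeff_curve hB t⁻¹ i).mul hm).mul (hd q⁻¹))).congr fun s => ?_
  rw [add_div, mul_div_assoc, mul_div_assoc]

/-- A polynomial that is negligible along the curve only has small monomials. -/
theorem MvPolynomial.sum_lt_of_tendsto {B : ℕ} (g : MvPolynomial (Fin N) ℝ)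
    (hg : ∀ α ∈ g.support, ∀ i, α i < B) {W : ℕ}
    (h : Tendsto (fun s => MvPolynomial.eval (curve N B s) g / s ^ W) atTop (𝓝 0)) :
    ∀ α ∈ g.support, ∑ i, α i * B ^ (Fin.rev i : ℕ) < W := by
  intro α hα
  set P : Polynomial ℝ := ∑ β ∈ g.support,
    Polynomial.C (g.coeff β) * Polynomial.X ^ (∑ i, β i * B ^ (Fin.rev i : ℕ)) with hP
  have heval : ∀ s, MvPolynomial.eval (curve N B s) g = P.eval s := by
    intro s
    rw [MvPolynomial.eval_eq, hP, Polynomial.eval_finsetSum]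
    refine Finset.sum_congr rfl fun β _ => ?_
    rw [Polynomial.eval_mul, Polynomial.eval_C, Polynomial.eval_pow, Polynomial.eval_X,
      ← prod_curve_pow]
    refine congrArg _ ?_
    refine Finset.prod_subset (Finset.subset_univ _) fun i _ hi => ?_
    rw [Finsupp.notMem_support_iff.mp hi, pow_zero]
  have hcoeff : P.coeff (∑ i, α i * B ^ (Fin.rev i : ℕ)) = g.coeff α := by
    rw [hP, Polynomial.finsetSum_coeff, Finset.sum_eq_single α]
    · simp
    · intro β hβ hne
      rw [Polynomial.coeff_C_mul, Polynomial.coeff_X_pow, if_neg, mul_zero]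
      intro he
      exact hne (DFunLike.coe_injective (eq_of_sum_mul_pow_rev_eq (hg β hβ) (hg α hα) he.symm))
    · intro hα'
      exact absurd hα hα'
  have hdeg : P.degree < (Polynomial.X ^ W : Polynomial ℝ).degree := by
    rw [← Polynomial.div_tendsto_atTop_zero_iff_degree_lt _ _ (pow_ne_zero _ Polynomial.X_ne_zero)]
    simpa [heval] using h
  rw [Polynomial.degree_X_pow] at hdeg
  have hle := Polynomial.le_degree_of_ne_zero (p := P) (hcoeff ▸ MvPolynomial.mem_support_iff.mp hα)
  exact_mod_cast hle.trans_lt hdeg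

theorem coeff_comp_perm (g : SymPoly N) (α : Fin N →₀ ℕ) (σ : Equiv.Perm (Fin N)) :
    (g : MvPolynomial (Fin N) ℝ).coeff (Finsupp.equivFunOnFinite.symm (α ∘ σ)) =
      (g : MvPolynomial (Fin N) ℝ).coeff α := by
  have h : α.mapDomain σ.symm = Finsupp.equivFunOnFinite.symm (α ∘ σ) := by
    ext i
    obtain ⟨j, rfl⟩ := σ.symm.surjective i
    rw [Finsupp.mapDomain_apply σ.symm.injective]
    simp
  have hs : MvPolynomial.rename σ.symm (g : MvPolynomial (Fin N) ℝ) = g := g.2 σ.symm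
  rw [← h]
  nth_rewrite 1 [← hs]
  exact MvPolynomial.coeff_rename_mapDomain _ σ.symm.injective _ _

theorem coeff_monomialSum (ν : Fin N → ℕ) (α : Fin N →₀ ℕ) :
    (monomialSum ν).coeff α = if ∃ σ : Equiv.Perm (Fin N), ν ∘ σ = α then 1 else 0 := by
  classical
  rw [monomialSum, MvPolynomial.coeff_sum]
  simp only [MvPolynomial.coeff_monomial, Equiv.symm_apply_eq]
  rw [Finset.sum_ite_eq']
  simp [Finset.mem_image, Finsupp.equivFunOnFinite]

theorem exists_perm_antitone (α : Fin N → ℕ) : ∃ σ : Equiv.Perm (Fin N), Antitone (α ∘ σ) := by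
  refine ⟨(Fin.revPerm).trans (Tuple.sort α), fun i j hij => ?_⟩
  exact Tuple.monotone_sort α (Fin.rev_le_rev.mpr hij)

/-- Expansion of a symmetric polynomial in the monomial basis. -/
theorem SymPoly.mem_span_monomialSym (g : SymPoly N) :
    g ∈ Submodule.span ℝ {f | ∃ ν : Fin N →₀ ℕ, Antitone ν ∧
      ν ∈ (g : MvPolynomial (Fin N) ℝ).support ∧ f = monomialSym ν} := by
  classical
  have key : g = ∑ ν ∈ (g : MvPolynomial (Fin N) ℝ).support.filter (fun ν : Fin N →₀ ℕ => Antitone ν),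
      (g : MvPolynomial (Fin N) ℝ).coeff ν • monomialSym (N := N) ν := by
    apply Subtype.ext
    rw [AddSubmonoidClass.coe_finsetSum]
    ext α
    rw [MvPolynomial.coeff_sum]
    obtain ⟨σ, hσ⟩ := exists_perm_antitone α
    set ν₀ : Fin N →₀ ℕ := Finsupp.equivFunOnFinite.symm (α ∘ σ) with hν₀
    have hcoe : (ν₀ : Fin N → ℕ) = α ∘ σ := rfl
    have hback : ν₀ ∘ σ.symm = (α : Fin N → ℕ) := by rw [hcoe]; funext i; simp
    rw [Finset.sum_eq_single ν₀]
    · have : (monomialSum ν₀).coeff α = 1 := by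
        rw [coeff_monomialSum, if_pos ⟨σ.symm, hback⟩]
      change _ = MvPolynomial.coeff α (_ • monomialSum ν₀)
      rw [MvPolynomial.coeff_smul, this, smul_eq_mul, mul_one, hν₀, coeff_comp_perm]
    · intro ν hν hne
      change MvPolynomial.coeff α (_ • monomialSum ν) = 0
      rw [MvPolynomial.coeff_smul, coeff_monomialSum, if_neg, smul_zero]
      rintro ⟨τ, hτ⟩
      apply hne
      apply DFunLike.coe_injective
      have hτ' : ν ∘ (τ * σ : Equiv.Perm (Fin N)) = α ∘ σ := by rw [← hτ]; rfl
      rw [hcoe, ← hτ', eq_of_antitone_comp_perm (Finset.mem_filter.mp hν).2 (hτ' ▸ hσ)]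
    · intro hν
      have h0 : (g : MvPolynomial (Fin N) ℝ).coeff ν₀ = 0 := by
        by_contra hne
        exact hν (Finset.mem_filter.mpr ⟨MvPolynomial.mem_support_iff.mpr hne, hσ⟩)
      rw [h0, zero_smul]
      rfl
  nth_rewrite 2 [key]
  refine Submodule.sum_mem _ fun ν hν => Submodule.smul_mem _ _ (Submodule.subset_span ?_)
  exact ⟨ν, (Finset.mem_filter.mp hν).2, (Finset.mem_filter.mp hν).1, rfl⟩

theorem SymPoly.exists_exponent_bound (g : SymPoly N) :
    ∃ n, ∀ α ∈ (g : MvPolynomial (Fin N) ℝ).support, ∀ i, α i ≤ n :=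
  ⟨(g : MvPolynomial (Fin N) ℝ).support.sup fun α => Finset.univ.sup α, fun α hα i =>
    (Finset.le_sup (f := α) (Finset.mem_univ i)).trans
      (Finset.le_sup (f := fun α : Fin N →₀ ℕ => Finset.univ.sup α) hα)⟩

/-- Triangularity of the operator in the monomial basis. -/
theorem sub_diagEntry_mem_span {q t a b : ℝ} {d : ℂ} {D : SymPoly N →ₗ[ℝ] SymPoly N}
    (hD : ∀ f X, (∀ i, X i ≠ 0) → Function.Injective X →
      (D f).value X = qDifferenceRe q t a b d f.value X) {lam : Fin N → ℕ} (hlam : Antitone lam) :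
    D (monomialSym lam) - diagEntry q t a b d lam • monomialSym lam ∈
      Submodule.span ℝ {g | ∃ ν : Fin N → ℕ,
        Antitone ν ∧ toLex ν < toLex lam ∧ g = monomialSym ν} := by
  rcases Nat.eq_zero_or_pos N with rfl | hN
  · have : D (monomialSym lam) - diagEntry q t a b d lam • monomialSym lam = 0 := by
      refine SymPoly.ext_of_value fun X h0 hX => ?_
      rw [value_sub, value_smul, hD _ _ h0 hX]
      simp [qDifferenceRe, diagEntry, SymPoly.value]
    rw [this]
    exact Submodule.zero_mem _
  set g := D (monomialSym lam) - diagEntry q t a b d lam • monomialSym lam with hg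
  obtain ⟨n, hn⟩ := g.exists_exponent_bound
  set B := n + Finset.univ.sup lam + 2 with hB
  have hB2 : 2 ≤ B := by omega
  have h1 : ∀ α ∈ (g : MvPolynomial (Fin N) ℝ).support, ∀ i, α i < B := fun α hα i => by
    have := hn α hα i
    omega
  have h2 : ∀ i, lam i < B := fun i => by
    have := Finset.le_sup (f := lam) (Finset.mem_univ i)
    omega
  have hlim : Tendsto (fun s => MvPolynomial.eval (curve N B s) (g : MvPolynomial (Fin N) ℝ) /
      s ^ ∑ i, lam i * B ^ (Fin.rev i : ℕ)) atTop (𝓝 0) := by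
    have h3 := tendsto_qDifferenceRe_curve hB2 q t a b d hlam
    have h4 := tendsto_monomialSym_scale_curve hB2 hlam 1 ⟨0, hN⟩
    simp only [scale_one, one_pow] at h4
    have h5 := h3.sub (h4.const_mul (diagEntry q t a b d lam))
    rw [mul_one, sub_self] at h5
    refine h5.congr' ?_
    filter_upwards [eventually_gt_atTop 1] with s hs
    change _ = g.value _ / _
    rw [hg, value_sub, value_smul, hD _ _ (curve_ne_zero hs B) (curve_injective hs hB2)]
    ring
  refine Submodule.span_mono ?_ g.mem_span_monomialSym
  rintro _ ⟨ν, hν, hmem, rfl⟩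
  exact ⟨ν, hν, toLex_lt_of_sum_mul_pow_rev_lt h2
    (MvPolynomial.sum_lt_of_tendsto _ h1 hlim ν hmem), rfl⟩

/-- A triangular operator preserves a finite-dimensional subspace containing a given element. -/
theorem exists_finiteDimensional_invariant (hN : 0 < N) {D : SymPoly N →ₗ[ℝ] SymPoly N}
    (hD : ∀ lam : Fin N → ℕ, Antitone lam → ∃ μ : ℝ,
      D (monomialSym lam) - μ • monomialSym lam ∈
        Submodule.span ℝ {g | ∃ ν : Fin N → ℕ,
          Antitone ν ∧ toLex ν < toLex lam ∧ g = monomialSym ν}) (f : SymPoly N) :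
    ∃ V : Submodule ℝ (SymPoly N), f ∈ V ∧ FiniteDimensional ℝ V ∧ ∀ g ∈ V, D g ∈ V := by
  obtain ⟨n, hn⟩ := f.exists_exponent_bound
  set S : Set (Fin N → ℕ) := {ν | Antitone ν ∧ ∀ i, ν i ≤ n} with hS
  have hfin : S.Finite := (Set.finite_Iic fun _ : Fin N => n).subset fun ν hν i => hν.2 i
  refine ⟨Submodule.span ℝ (monomialSym '' S), ?_, FiniteDimensional.span_of_finite ℝ (hfin.image _),
    fun g hg => ?_⟩
  · refine Submodule.span_mono ?_ f.mem_span_monomialSym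
    rintro _ ⟨ν, hν, hmem, rfl⟩
    exact ⟨ν, ⟨hν, hn ν hmem⟩, rfl⟩
  · induction hg using Submodule.span_induction with
    | mem x hx =>
      obtain ⟨lam, ⟨hlam, hle⟩, rfl⟩ := hx
      obtain ⟨μ, hμ⟩ := hD lam hlam
      have h1 : D (monomialSym lam) = (D (monomialSym lam) - μ • monomialSym lam) +
          μ • monomialSym lam := by abel
      rw [h1]
      refine Submodule.add_mem _ (Submodule.span_mono ?_ hμ)
        (Submodule.smul_mem _ _ (Submodule.subset_span ⟨lam, ⟨hlam, hle⟩, rfl⟩))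
      rintro _ ⟨ν, hν, hlt, rfl⟩
      refine ⟨ν, ⟨hν, fun i => ?_⟩, rfl⟩
      have h0 : ν ⟨0, hN⟩ ≤ lam ⟨0, hN⟩ :=
        Pi.apply_le_of_toLex hlt.le fun j hj => absurd hj (Nat.not_lt_zero _)
      exact (hν (Fin.mk_le_of_le_val (Nat.zero_le _))).trans (h0.trans (hle _))
    | zero => rw [map_zero]; exact Submodule.zero_mem _
    | add x y _ _ hx hy => rw [map_add]; exact Submodule.add_mem _ hx hy
    | smul r x _ hx => rw [map_smul]; exact Submodule.smul_mem _ _ hx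

end QJacobi

namespace QJacobi

/-! ## The operator at configurations with particles at the origin -/

variable {N : ℕ}

theorem sum_add_smul_pow {X η : Fin N → ℝ} (hη : ∀ i, X i ≠ 0 → η i = 0) (k : ℕ) (ε : ℝ) :
    ∑ i, (X + ε • η) i ^ (k + 1) = ∑ i, X i ^ (k + 1) + ε ^ (k + 1) * ∑ i, η i ^ (k + 1) := by
  rw [Finset.mul_sum, ← Finset.sum_add_distrib]
  refine Finset.sum_congr rfl fun i _ => ?_
  rw [Pi.add_apply, Pi.smul_apply, smul_eq_mul]
  by_cases h : X i = 0
  · rw [h]; ring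
  · rw [hη i h]; ring

/-- Second-order expansion of a symmetric polynomial in the variables that vanish. -/
theorem SymPoly.exists_expansion (f : SymPoly N) (X : Fin N → ℝ) :
    ∃ f₁ A B : ℝ, ∀ η : Fin N → ℝ, (∀ i, X i ≠ 0 → η i = 0) → ∃ R : ℝ → ℝ, Continuous R ∧
      ∀ ε : ℝ, f.value (X + ε • η) = f.value X + ε * (f₁ * ∑ i, η i) +
        ε ^ 2 * (A * (∑ i, η i) ^ 2 + B * ∑ i, η i ^ 2) + ε ^ 3 * R ε := by
  induction f using SymPoly.induction_psum with
  | const r => exact ⟨0, 0, 0, fun η _ => ⟨0, continuous_const, fun ε => by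
      simp [value_algebraMap]⟩⟩
  | psum k =>
    rcases k with _ | _ | k
    · refine ⟨1, 0, 0, fun η hη => ⟨0, continuous_const, fun ε => ?_⟩⟩
      rw [value_psumSym, value_psumSym, sum_add_smul_pow hη]
      simp
    · refine ⟨0, 0, 1, fun η hη => ⟨0, continuous_const, fun ε => ?_⟩⟩
      rw [value_psumSym, value_psumSym, sum_add_smul_pow hη]
      simp
    · refine ⟨0, 0, 0, fun η hη => ⟨fun ε => ε ^ k * ∑ i, η i ^ (k + 2 + 1), by fun_prop, fun ε => ?_⟩⟩
      rw [value_psumSym, value_psumSym, sum_add_smul_pow hη]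
      ring
  | add f g hf hg =>
    obtain ⟨f₁, A, B, h⟩ := hf
    obtain ⟨g₁, A', B', h'⟩ := hg
    refine ⟨f₁ + g₁, A + A', B + B', fun η hη => ?_⟩
    obtain ⟨R, hR, e⟩ := h η hη
    obtain ⟨R', hR', e'⟩ := h' η hη
    refine ⟨fun ε => R ε + R' ε, hR.add hR', fun ε => ?_⟩
    rw [value_add, value_add, e, e']
    ring
  | mul f g hf hg =>
    obtain ⟨f₁, A, B, h⟩ := hf
    obtain ⟨g₁, A', B', h'⟩ := hg
    refine ⟨f.value X * g₁ + g.value X * f₁, f.value X * A' + g.value X * A + f₁ * g₁,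
      f.value X * B' + g.value X * B, fun η hη => ?_⟩
    obtain ⟨R, hR, e⟩ := h η hη
    obtain ⟨R', hR', e'⟩ := h' η hη
    refine ⟨fun ε => f.value X * R' ε + g.value X * R ε +
      f₁ * (∑ i, η i) * (A' * (∑ i, η i) ^ 2 + B' * ∑ i, η i ^ 2) +
      g₁ * (∑ i, η i) * (A * (∑ i, η i) ^ 2 + B * ∑ i, η i ^ 2) +
      ε * (f₁ * (∑ i, η i) * R' ε + g₁ * (∑ i, η i) * R ε +
        (A * (∑ i, η i) ^ 2 + B * ∑ i, η i ^ 2) * (A' * (∑ i, η i) ^ 2 + B' * ∑ i, η i ^ 2)) +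
      ε ^ 2 * ((A * (∑ i, η i) ^ 2 + B * ∑ i, η i ^ 2) * R' ε +
        (A' * (∑ i, η i) ^ 2 + B' * ∑ i, η i ^ 2) * R ε) + ε ^ 3 * (R ε * R' ε), by fun_prop,
      fun ε => ?_⟩
    rw [value_mul, value_mul, e, e']
    ring

/-- The factors of the shift coefficients belonging to the particles at the origin decouple. -/
theorem tendsto_shiftCoeff_of_zero {X η : Fin N → ℝ} {Z : Finset (Fin N)}
    (hZ : ∀ i, i ∈ Z ↔ X i = 0) (r : ℝ) {i : Fin N} (hi : i ∈ Z) :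
    Tendsto (fun ε : ℝ => shiftCoeff Finset.univ r i (X + ε • η)) (𝓝[≠] 0)
      (𝓝 (shiftCoeff Z r i η)) := by
  have h1 : ∀ j ∈ Finset.univ.erase i, Tendsto (fun ε : ℝ =>
      (r * (X + ε • η) i - (X + ε • η) j) / ((X + ε • η) i - (X + ε • η) j)) (𝓝[≠] 0)
      (𝓝 (if j ∈ Z then (r * η i - η j) / (η i - η j) else 1)) := by
    intro j hj
    simp only [Pi.add_apply, Pi.smul_apply, smul_eq_mul, (hZ i).mp hi, zero_add]
    split_ifs with hjZ
    · refine tendsto_const_nhds.congr' ?_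
      filter_upwards [self_mem_nhdsWithin] with ε hε
      rw [(hZ j).mp hjZ, zero_add, show r * (ε * η i) - ε * η j = ε * (r * η i - η j) by ring,
        ← mul_sub, mul_div_mul_left _ _ hε]
    · have hXj : X j ≠ 0 := fun h => hjZ ((hZ j).mpr h)
      have hc : ContinuousAt (fun ε : ℝ => (r * (ε * η i) - (X j + ε * η j)) /
          (ε * η i - (X j + ε * η j))) 0 :=
        ContinuousAt.div (by fun_prop) (by fun_prop) (by simpa using hXj)
      have h2 := hc.tendsto.mono_left (nhdsWithin_le_nhds (s := {0}ᶜ))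
      simp only [zero_mul, mul_zero, add_zero, zero_sub] at h2
      rwa [div_self (neg_ne_zero.mpr hXj)] at h2
  have h2 := tendsto_finsetProd _ h1
  rw [Finset.prod_ite, Finset.prod_const_one, mul_one,
    show (Finset.univ.erase i).filter (fun j => j ∈ Z) = Z.erase i by
      ext j; simp [and_comm]] at h2
  exact h2

theorem tendsto_sigmaPlusRe_zero (q t a b : ℝ) (d : ℂ) {y : ℝ} (hy : y ≠ 0) :
    Tendsto (fun ε : ℝ => ε ^ 2 * sigmaPlusRe N q t a b d (ε * y)) (𝓝[≠] 0)
      (𝓝 (kap N q t a b * (y⁻¹) ^ 2)) := by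
  have hc : Continuous fun ε : ℝ => kap N q t a b * ((ε * d.re - y⁻¹) ^ 2 + (ε * d.im) ^ 2) := by
    fun_prop
  have h := (hc.tendsto 0).mono_left (nhdsWithin_le_nhds (s := {0}ᶜ))
  rw [show kap N q t a b * ((0 * d.re - y⁻¹) ^ 2 + (0 * d.im) ^ 2) = kap N q t a b * (y⁻¹) ^ 2 by
    ring] at h
  refine h.congr' ?_
  filter_upwards [self_mem_nhdsWithin] with ε hε
  have hε' : ε ≠ 0 := hε
  rw [sigmaPlusRe]
  field_simp

theorem tendsto_sigmaMinus_zero (q t a b : ℝ) {y : ℝ} (hy : y ≠ 0) :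
    Tendsto (fun ε : ℝ => ε ^ 2 * sigmaMinus N q t a b (ε * y)) (𝓝[≠] 0)
      (𝓝 (q * kap N q t a b * (y⁻¹) ^ 2)) := by
  have hc : Continuous fun ε : ℝ =>
      q * kap N q t a b * ((ε * (a * q⁻¹) - y⁻¹) * (ε * (b * q⁻¹) - y⁻¹)) := by
    fun_prop
  have h := (hc.tendsto 0).mono_left (nhdsWithin_le_nhds (s := {0}ᶜ))
  rw [show q * kap N q t a b * ((0 * (a * q⁻¹) - y⁻¹) * (0 * (b * q⁻¹) - y⁻¹)) =
    q * kap N q t a b * (y⁻¹) ^ 2 by ring] at h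
  refine h.congr' ?_
  filter_upwards [self_mem_nhdsWithin] with ε hε
  have hε' : ε ≠ 0 := hε
  rw [sigmaMinus_eq, mul_inv]
  have e : ∀ c : ℝ, ε * c - y⁻¹ = ε * (c - ε⁻¹ * y⁻¹) := fun c => by field_simp
  rw [e, e]
  ring

/-- The summand of the `q`-difference expression for the particle `i`. -/
noncomputable def jump (q t a b : ℝ) (d : ℂ) (φ : (Fin N → ℝ) → ℝ) (i : Fin N) (X : Fin N → ℝ) : ℝ :=
  shiftCoeff Finset.univ t i X * sigmaPlusRe N q t a b d (X i) * (φ (scale q i X) - φ X) +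
    shiftCoeff Finset.univ t⁻¹ i X * sigmaMinus N q t a b (X i) * (φ (scale q⁻¹ i X) - φ X)

theorem continuousAt_jump (q t a b : ℝ) (d : ℂ) {φ : (Fin N → ℝ) → ℝ} (hφ : Continuous φ)
    {i : Fin N} {X : Fin N → ℝ} (h0 : X i ≠ 0) (hne : ∀ j, j ≠ i → X i ≠ X j) :
    ContinuousAt (jump q t a b d φ i) X := by
  have h1 : ∀ r, ContinuousAt (shiftCoeff Finset.univ r i) X := by
    intro r
    refine tendsto_finsetProd _ fun j hj => ?_
    refine ContinuousAt.div (by fun_prop) (by fun_prop) ?_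
    exact sub_ne_zero.mpr (hne j (Finset.ne_of_mem_erase hj))
  have hinv : ContinuousAt (fun Y : Fin N → ℝ => (Y i)⁻¹) X :=
    (continuous_apply i).continuousAt.inv₀ h0
  have h2 : ContinuousAt (fun Y : Fin N → ℝ => sigmaPlusRe N q t a b d (Y i)) X := by
    unfold sigmaPlusRe
    fun_prop
  have h3 : ContinuousAt (fun Y : Fin N → ℝ => sigmaMinus N q t a b (Y i)) X := by
    unfold sigmaMinus
    fun_prop
  have h4 : ∀ r, Continuous fun Y : Fin N → ℝ => φ (scale r i Y) - φ Y := fun r =>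
    (hφ.comp (continuous_id.update i (continuous_const.mul (continuous_apply i)))).sub hφ
  exact (((h1 t).mul h2).mul (h4 q).continuousAt).add
    (((h1 t⁻¹).mul h3).mul (h4 q⁻¹).continuousAt)

theorem scale_add_smul {X η : Fin N → ℝ} {i : Fin N} (hi : X i = 0) (r ε : ℝ) :
    scale r i (X + ε • η) = X + ε • scale r i η := by
  funext j
  by_cases hj : j = i
  · subst hj
    simp only [scale, Function.update_self, Pi.add_apply, Pi.smul_apply, smul_eq_mul, hi]
    ring
  · simp [scale, Function.update_of_ne hj]

/-- The total contribution of the particles near the origin. -/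
theorem tendsto_sum_jump_zero {q t : ℝ} (hq : q ≠ 0) (ht : t ≠ 1) (a b : ℝ) (d : ℂ)
    {φ : (Fin N → ℝ) → ℝ} {X η : Fin N → ℝ} {Z : Finset (Fin N)} (hZ : ∀ i, i ∈ Z ↔ X i = 0)
    {A B : ℝ} (hφ : ∀ η : Fin N → ℝ, (∀ i, X i ≠ 0 → η i = 0) →
      Tendsto (fun ε : ℝ => (φ (X + ε • η) - φ X) / ε ^ 2) (𝓝[≠] 0)
        (𝓝 (A * (∑ i, η i) ^ 2 + B * ∑ i, η i ^ 2)))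
    (hη : ∀ i, X i ≠ 0 → η i = 0) (hη0 : ∀ i ∈ Z, η i ≠ 0) (hinj : Set.InjOn η Z) :
    Tendsto (fun ε : ℝ => ∑ i ∈ Z, jump q t a b d φ i (X + ε • η)) (𝓝[≠] 0)
      (𝓝 (kap N q t a b * (1 - q) *
        (A * ((1 - q) * (∑ k ∈ Finset.range Z.card, t ^ k +
            q⁻¹ * ∑ k ∈ Finset.range Z.card, t⁻¹ ^ k)) +
          B * ((1 + q) * (q⁻¹ * ∑ k ∈ Finset.range Z.card, t⁻¹ ^ k -
            ∑ k ∈ Finset.range Z.card, t ^ k))))) := by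
  have ht' : t⁻¹ ≠ 1 := by rwa [ne_eq, inv_eq_one]
  have hΔ : ∀ r : ℝ, ∀ i ∈ Z, Tendsto (fun ε : ℝ =>
      (φ (scale r i (X + ε • η)) - φ (X + ε • η)) / ε ^ 2) (𝓝[≠] 0)
      (𝓝 (A * (2 * (r - 1) * η i * ∑ j, η j + (r - 1) ^ 2 * η i ^ 2) + B * ((r ^ 2 - 1) * η i ^ 2))) := by
    intro r i hi
    have hs : ∀ j, X j ≠ 0 → scale r i η j = 0 := by
      intro j hj
      have : j ≠ i := fun e => hj (e ▸ (hZ i).mp hi)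
      rw [scale, Function.update_of_ne this, hη j hj]
    have h1 := (hφ _ hs).sub (hφ η hη)
    have e1 := sum_scale_pow 1 r i η
    have e2 := sum_scale_pow 2 r i η
    simp only [pow_one] at e1
    rw [e1, e2] at h1
    convert h1 using 2
    · rw [scale_add_smul ((hZ i).mp hi)]
      ring
    · ring
  have h1 : ∀ i ∈ Z, Tendsto (fun ε : ℝ => jump q t a b d φ i (X + ε • η)) (𝓝[≠] 0)
      (𝓝 (kap N q t a b * (2 * A * (q - 1) * (∑ j, η j) * (shiftCoeff Z t i η / η i -
          shiftCoeff Z t⁻¹ i η / η i) +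
        (A * (q - 1) ^ 2 + B * (q ^ 2 - 1)) * shiftCoeff Z t i η +
        q * (A * (q⁻¹ - 1) ^ 2 + B * (q⁻¹ ^ 2 - 1)) * shiftCoeff Z t⁻¹ i η))) := by
    intro i hi
    have h0 := hη0 i hi
    have h2 := (((tendsto_shiftCoeff_of_zero (η := η) hZ t hi).mul
      (tendsto_sigmaPlusRe_zero (N := N) q t a b d h0)).mul (hΔ q i hi)).add
      (((tendsto_shiftCoeff_of_zero (η := η) hZ t⁻¹ hi).mul
      (tendsto_sigmaMinus_zero (N := N) q t a b h0)).mul (hΔ q⁻¹ i hi))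
    have hlim : shiftCoeff Z t i η * (kap N q t a b * (η i)⁻¹ ^ 2) *
        (A * (2 * (q - 1) * η i * ∑ j, η j + (q - 1) ^ 2 * η i ^ 2) + B * ((q ^ 2 - 1) * η i ^ 2)) +
        shiftCoeff Z t⁻¹ i η * (q * kap N q t a b * (η i)⁻¹ ^ 2) *
        (A * (2 * (q⁻¹ - 1) * η i * ∑ j, η j + (q⁻¹ - 1) ^ 2 * η i ^ 2) +
          B * ((q⁻¹ ^ 2 - 1) * η i ^ 2)) =
        kap N q t a b * (2 * A * (q - 1) * (∑ j, η j) * (shiftCoeff Z t i η / η i -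
          shiftCoeff Z t⁻¹ i η / η i) +
        (A * (q - 1) ^ 2 + B * (q ^ 2 - 1)) * shiftCoeff Z t i η +
        q * (A * (q⁻¹ - 1) ^ 2 + B * (q⁻¹ ^ 2 - 1)) * shiftCoeff Z t⁻¹ i η) := by
      field_simp
      ring
    rw [hlim] at h2
    refine h2.congr' ?_
    filter_upwards [self_mem_nhdsWithin] with ε hε
    have hε' : ε ≠ 0 := hε
    have hXi : (X + ε • η) i = ε * η i := by
      rw [Pi.add_apply, Pi.smul_apply, smul_eq_mul, (hZ i).mp hi, zero_add]
    rw [jump, hXi]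
    field_simp
  have h2 := tendsto_finsetSum _ h1
  have h0 : ∀ i ∈ Z, η i ≠ 0 := hη0
  have hdiv := sum_shiftCoeff_div ht ht' hinj h0
  rw [← Finset.mul_sum, Finset.sum_add_distrib, Finset.sum_add_distrib, ← Finset.mul_sum,
    ← Finset.mul_sum, ← Finset.mul_sum, Finset.sum_sub_distrib, hdiv, sub_self, mul_zero, zero_add,
    sum_shiftCoeff ht hinj h0, sum_shiftCoeff ht' hinj h0] at h2
  convert h2 using 2
  field_simp
  ring

theorem sum_pow_le_sum_inv_pow {t : ℝ} (ht : t ∈ Set.Ioo (0 : ℝ) 1) (m : ℕ) :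
    ∑ k ∈ Finset.range m, t ^ k ≤ ∑ k ∈ Finset.range m, t⁻¹ ^ k :=
  Finset.sum_le_sum fun _ _ => (pow_le_one₀ ht.1.le ht.2.le).trans
    (one_le_pow₀ ((one_lt_inv₀ ht.1).mpr ht.2).le)

/-- Nonnegativity of the contribution of several particles at the origin. -/
theorem zero_part_nonneg {q U V A B s : ℝ} (hq : q ∈ Set.Ioo (0 : ℝ) 1) (hU : 0 ≤ U) (hUV : U ≤ V)
    (h1 : 0 ≤ A + B) (hs : s ∈ Set.Ioc q 1) (h2 : 0 ≤ A * (1 - s) ^ 2 + B * (1 + s ^ 2)) :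
    0 ≤ A * ((1 - q) * (U + q⁻¹ * V)) + B * ((1 + q) * (q⁻¹ * V - U)) := by
  have hq0 := hq.1
  have hq1 : 0 < 1 - q := by linarith [hq.2]
  have e : A * ((1 - q) * (U + q⁻¹ * V)) + B * ((1 + q) * (q⁻¹ * V - U)) =
      q⁻¹ * (A * ((1 - q) * (q * U + V)) + B * ((1 + q) * (V - q * U))) := by
    field_simp
  rw [e]
  refine mul_nonneg (inv_nonneg.mpr hq0.le) ?_
  have hV : 0 ≤ V := hU.trans hUV
  rcases le_or_gt 0 B with hB | hB
  · have h3 : -B * ((1 - q) * (q * U + V)) ≤ A * ((1 - q) * (q * U + V)) :=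
      mul_le_mul_of_nonneg_right (by linarith) (by positivity)
    have h4 : 0 ≤ B * (2 * q * (V - U)) := by
      have : 0 ≤ V - U := by linarith
      positivity
    nlinarith
  · have hA : 0 ≤ A := by linarith
    have h3 : 0 ≤ A * (1 - q) ^ 2 + B * (1 + q ^ 2) := by
      have h4 : A * (1 - s) ^ 2 ≤ A * (1 - q) ^ 2 := by
        refine mul_le_mul_of_nonneg_left ?_ hA
        have := hs.1
        have := hs.2
        nlinarith
      have h5 : B * (1 + s ^ 2) ≤ B * (1 + q ^ 2) := by
        refine mul_le_mul_of_nonpos_left ?_ hB.le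
        have := hs.1
        nlinarith
      linarith
    have h6 : 0 ≤ (A * (1 - q) ^ 2 + B * (1 + q ^ 2)) * (q * U + V) := by positivity
    have h7 : 0 ≤ (1 - q) * (A * ((1 - q) * (q * U + V)) + B * ((1 + q) * (V - q * U))) := by
      have h8 : 0 ≤ -B * (2 * q * U + 2 * q ^ 2 * V) := by
        have : 0 ≤ -B := by linarith
        positivity
      nlinarith
    exact nonneg_of_mul_nonneg_right h7 hq1

end QJacobi

namespace QJacobi

/-! ## The minimum principle -/

variable {N : ℕ} {q t a b : ℝ} {ω : Omega N} {n m : ℕ}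

theorem config_ne_of_ne_zero (hq : q ∈ Set.Ioo (0 : ℝ) 1) (ht : t ∈ Set.Ioo (0 : ℝ) 1)
    (ha : 0 < a) (hb : b < 0) (ω : Omega N) {i j : Fin N} (hij : j ≠ i)
    (hi : config q t a b ω i ≠ 0) : config q t a b ω i ≠ config q t a b ω j := by
  have key : ∀ {a b : ℝ} (_ : 0 < a) (_ : b < 0) (ω : Omega N) {n m : ℕ} (_ : ω.HasCounts n m)
      {i j : Fin N} (_ : j ≠ i) (_ : (i : ℕ) < n), config q t a b ω i ≠ config q t a b ω j := by
    intro a b ha hb ω n m h i j hij hi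
    have h0 := h.config_pos (b := b) hq ht ha hi
    have ht1 := ht.2
    rcases lt_or_gt_of_ne hij with hlt | hlt
    · have hj : (j : ℕ) < n := lt_trans hlt hi
      have h1 := h.config_le_mul hq ht ha hb hlt hj
      have h2 := h.config_pos (b := b) hq ht ha hj
      refine ne_of_lt (h1.trans_lt ?_)
      nlinarith
    · have h1 := h.config_le_mul hq ht ha hb hlt hi
      refine ne_of_gt (h1.trans_lt ?_)
      nlinarith
  obtain ⟨n, m, h⟩ := ω.exists_hasCounts
  rcases lt_or_ge (i : ℕ) n with hin | hin
  · exact key ha hb ω h hij hin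
  · have him : (Fin.rev i : ℕ) < m := by
      by_contra! hcon
      exact hi (by rw [h.config_of_ge hin, h.xMinus_eq_zero hcon])
    have h1 := key (a := -b) (b := -a) (by linarith) (by linarith) ω.swap h.swap
      (fun e => hij (Fin.rev_injective e)) him
    intro e
    refine h1 ?_
    rw [config_swap, reflect, reflect, Fin.rev_rev, Fin.rev_rev, e]

theorem Omega.HasCounts.config_eq_zero_iff (h : ω.HasCounts n m) (hq : q ∈ Set.Ioo (0 : ℝ) 1)
    (ht : t ∈ Set.Ioo (0 : ℝ) 1) (ha : 0 < a) (hb : b < 0) (i : Fin N) :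
    config q t a b ω i = 0 ↔ n ≤ i ∧ (i : ℕ) + m < N := by
  constructor
  · intro h0
    constructor
    · by_contra! hcon
      exact (h.config_pos (b := b) hq ht ha hcon).ne' h0
    · by_contra! hcon
      have h1 := h.swap.config_pos (a := -b) (b := -a) (i := Fin.rev i) hq ht (by linarith)
        (by rw [Fin.val_rev]; omega)
      rw [config_swap, reflect, Fin.rev_rev, h0] at h1
      simp at h1
  · rintro ⟨h1, h2⟩
    rw [h.config_of_lt h2, h.xPlus_eq_zero h1]

theorem Omega.HasCounts.exists_le_natCast (h : ω.HasCounts n m) :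
    ∃ K₀ : ℕ, ∀ i < n, ω.1.1 i ≤ K₀ := by
  rcases Nat.eq_zero_or_pos n with rfl | hn
  · exact ⟨0, fun i hi => absurd hi (Nat.not_lt_zero _)⟩
  · obtain ⟨K₀, hK₀⟩ := h.exists_eq_natCast (show n - 1 < n by omega)
    exact ⟨K₀, fun i hi => (ω.2.1 (show i ≤ n - 1 by omega)).trans hK₀.le⟩

/-- A positive particle may be created near the origin. -/
theorem Omega.HasCounts.exists_create (h : ω.HasCounts n m) (hnm : n + m < N) {K : ℕ} (hK : 1 ≤ K)
    (hlt : ∀ i < n, ω.1.1 i ≤ K) :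
    ∃ ω' : Omega N, ω'.HasCounts (n + 1) m ∧ ω'.1.2 = ω.1.2 ∧ ∀ a b,
      config q t a b ω' = Function.update (config q t a b ω) ⟨n, by omega⟩ (a⁻¹ * q ^ K * t ^ n) := by
  have hgt : ∀ i' : ℕ, ((⟨n, by omega⟩ : Fin N) : ℕ) < i' → (K : ℕ∞) ≤ ω.1.1 i' := by
    intro i' hi'
    have : ω.1.1 i' = ⊤ := by
      by_contra h'
      exact absurd ((h.fst _).mp h') (not_lt.mpr hi'.le)
    rw [this]
    exact le_top
  obtain ⟨ω', h1, h2, h3⟩ := h.exists_update (q := q) (t := t) ⟨n, by omega⟩ le_rfl hnm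
    (j := K) hK hlt hgt
  rw [max_eq_right (by simp)] at h1
  exact ⟨ω', h1, h2, h3⟩

/-- A negative particle may be created near the origin. -/
theorem Omega.HasCounts.exists_create_neg (h : ω.HasCounts n m) (hnm : n + m < N) {K : ℕ} (hK : 1 ≤ K)
    (hlt : ∀ i < m, ω.1.2 i ≤ K) :
    ∃ ω' : Omega N, ω'.HasCounts n (m + 1) ∧ ω'.1.1 = ω.1.1 ∧ ∀ a b,
      config q t a b ω' = Function.update (config q t a b ω) (Fin.rev ⟨m, by omega⟩)
        (b⁻¹ * q ^ K * t ^ m) := by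
  obtain ⟨ω', h1, h2, h3⟩ := h.swap.exists_create (q := q) (t := t) (by omega) hK hlt
  refine ⟨ω'.swap, h1.swap, h2, fun a b => ?_⟩
  have h4 := h3 (-b) (-a)
  rw [config_swap] at h4
  have h5 := config_swap (q := q) (t := t) (a := -b) (b := -a) ω'
  rw [neg_neg, neg_neg, h4, reflect_update, reflect_reflect] at h5
  rw [h5]
  congr 1
  rw [inv_neg]
  ring

theorem tendsto_const_mul_pow_nhdsGT (hq : q ∈ Set.Ioo (0 : ℝ) 1) {c : ℝ} (hc : 0 < c) :
    Tendsto (fun K : ℕ => c * q ^ K) atTop (𝓝[>] 0) := by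
  refine tendsto_nhdsWithin_iff.mpr ⟨?_, Eventually.of_forall fun K => mul_pos hc (pow_pos hq.1 K)⟩
  have := (tendsto_pow_atTop_nhds_zero_of_lt_one hq.1.le hq.2).const_mul c
  rwa [mul_zero] at this

theorem update_eq_add_smul_single {X : Fin N → ℝ} {i : Fin N} (hi : X i = 0) (ε y : ℝ) :
    Function.update X i (ε * y) = X + ε • Pi.single i y := by
  funext j
  by_cases hj : j = i
  · subst hj; simp [hi]
  · simp [Function.update_of_ne hj, Pi.single_eq_of_ne hj]

theorem exists_mul_zpow_mem_Ioc (hq : q ∈ Set.Ioo (0 : ℝ) 1) {ρ : ℝ} (hρ : 0 < ρ) :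
    ∃ e : ℤ, ρ * q ^ e ∈ Set.Ioc q 1 := by
  obtain ⟨e, h1, h2⟩ := exists_mem_Ioc_zpow (x := ρ) (y := q⁻¹) hρ ((one_lt_inv₀ hq.1).mpr hq.2)
  have hq0 := hq.1
  refine ⟨e + 1, ?_, ?_⟩
  · rw [inv_zpow, inv_lt_iff_one_lt_mul₀ (zpow_pos hq0 _)] at h1
    rw [zpow_add_one₀ hq0.ne', ← mul_assoc]
    nlinarith
  · rw [inv_zpow, le_inv_comm₀ hρ (zpow_pos hq0 _)] at h2
    calc ρ * q ^ (e + 1) ≤ ρ * ρ⁻¹ := mul_le_mul_of_nonneg_left h2 hρ.le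
      _ = 1 := mul_inv_cancel₀ hρ.ne'

/-- Local second-order behaviour of a symmetric polynomial at a minimum point with particles at
the origin. -/
theorem exists_second_order (hq : q ∈ Set.Ioo (0 : ℝ) 1) (ht : t ∈ Set.Ioo (0 : ℝ) 1) (ha : 0 < a)
    (hb : b < 0) (h : ω.HasCounts n m) (f : SymPoly N)
    (hmin : ∀ ω' : Omega N, f.value (config q t a b ω) ≤ f.value (config q t a b ω'))
    (hnm : n + m < N) :
    ∃ A B : ℝ, (∀ η : Fin N → ℝ, (∀ i, config q t a b ω i ≠ 0 → η i = 0) →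
      Tendsto (fun ε : ℝ => (f.value (config q t a b ω + ε • η) - f.value (config q t a b ω)) / ε ^ 2)
        (𝓝[≠] 0) (𝓝 (A * (∑ i, η i) ^ 2 + B * ∑ i, η i ^ 2))) ∧ 0 ≤ A + B ∧
      (n + m + 1 < N → ∃ s ∈ Set.Ioc q 1, 0 ≤ A * (1 - s) ^ 2 + B * (1 + s ^ 2)) := by
  set X := config q t a b ω with hX
  obtain ⟨f₁, A, B, hexp⟩ := f.exists_expansion X
  set i₁ : Fin N := ⟨n, by omega⟩
  set i₂ : Fin N := Fin.rev ⟨m, by omega⟩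
  have hi₂v : (i₂ : ℕ) = N - (m + 1) := Fin.val_rev _
  have hX₁ : X i₁ = 0 := (h.config_eq_zero_iff hq ht ha hb i₁).mpr ⟨le_rfl, hnm⟩
  have hX₂ : X i₂ = 0 := (h.config_eq_zero_iff hq ht ha hb i₂).mpr
    ⟨by rw [hi₂v]; omega, by rw [hi₂v]; omega⟩
  have hsupp : ∀ {i : Fin N} (y : ℝ), X i = 0 → ∀ j, X j ≠ 0 → Pi.single (M := fun _ => ℝ) i y j = 0 := by
    intro i y hi j hj
    exact Pi.single_eq_of_ne (fun e => hj (by rw [e, hi])) _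
  have hb' : 0 < -b⁻¹ := by rw [neg_pos]; exact inv_lt_zero.mpr hb
  have hc₁ : 0 < a⁻¹ * t ^ n := mul_pos (inv_pos.mpr ha) (pow_pos ht.1 _)
  have hc₂ : 0 < -b⁻¹ * t ^ m := mul_pos hb' (pow_pos ht.1 _)
  -- first and second order conditions along admissible sequences
  have hfirst : ∀ η : Fin N → ℝ, (∀ i, X i ≠ 0 → η i = 0) → ∀ c : ℝ, 0 < c →
      (∀ᶠ K : ℕ in atTop, ∃ ω' : Omega N, config q t a b ω' = X + (c * q ^ K) • η) →
      0 ≤ f₁ * ∑ i, η i := by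
    intro η hη c hc hev
    obtain ⟨R, hR, e⟩ := hexp η hη
    have hcont : Continuous fun ε : ℝ => f₁ * ∑ i, η i +
        ε * (A * (∑ i, η i) ^ 2 + B * ∑ i, η i ^ 2) + ε ^ 2 * R ε := by fun_prop
    have hlim := (hcont.tendsto 0).comp
      ((tendsto_const_mul_pow_nhdsGT hq hc).mono_right nhdsWithin_le_nhds)
    simp only [zero_mul, add_zero, ne_eq, OfNat.ofNat_ne_zero, not_false_eq_true, zero_pow] at hlim
    refine ge_of_tendsto hlim ?_
    filter_upwards [hev] with K hK
    obtain ⟨ω', hω'⟩ := hK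
    have h1 := hmin ω'
    have h2 : 0 < c * q ^ K := mul_pos hc (pow_pos hq.1 K)
    rw [hω', e] at h1
    have h3 : 0 ≤ (c * q ^ K) * (f₁ * ∑ i, η i + (c * q ^ K) *
        (A * (∑ i, η i) ^ 2 + B * ∑ i, η i ^ 2) + (c * q ^ K) ^ 2 * R (c * q ^ K)) := by
      linarith
    exact nonneg_of_mul_nonneg_right h3 h2
  obtain ⟨K₁, hK₁⟩ := h.exists_le_natCast
  obtain ⟨K₂, hK₂⟩ : ∃ K₂ : ℕ, ∀ i < m, ω.1.2 i ≤ K₂ := h.swap.exists_le_natCast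
  have hpos : ∀ᶠ K : ℕ in atTop, ∃ ω' : Omega N,
      config q t a b ω' = X + (a⁻¹ * t ^ n * q ^ K) • Pi.single i₁ 1 := by
    filter_upwards [eventually_ge_atTop (K₁ + 1)] with K hK
    obtain ⟨ω', -, -, hω'⟩ := h.exists_create (q := q) (t := t) hnm (K := K) (by omega)
      fun i hi => (hK₁ i hi).trans (by exact_mod_cast (show K₁ ≤ K by omega))
    refine ⟨ω', ?_⟩
    rw [hω', ← update_eq_add_smul_single hX₁]
    congr 1
    ring
  have hneg : ∀ᶠ K : ℕ in atTop, ∃ ω' : Omega N,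
      config q t a b ω' = X + (-b⁻¹ * t ^ m * q ^ K) • Pi.single i₂ (-1) := by
    filter_upwards [eventually_ge_atTop (K₂ + 1)] with K hK
    obtain ⟨ω', -, -, hω'⟩ := h.exists_create_neg (q := q) (t := t) hnm (K := K) (by omega)
      fun i hi => (hK₂ i hi).trans (by exact_mod_cast (show K₂ ≤ K by omega))
    refine ⟨ω', ?_⟩
    rw [hω', ← update_eq_add_smul_single hX₂]
    congr 1
    ring
  have hf₁ : f₁ = 0 := by
    have h1 := hfirst _ (hsupp 1 hX₁) _ hc₁ hpos
    have h2 := hfirst _ (hsupp (-1) hX₂) _ hc₂ hneg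
    rw [Finset.sum_pi_single'] at h1 h2
    simp only [Finset.mem_univ, if_true] at h1 h2
    linarith
  have hlim : ∀ η : Fin N → ℝ, (∀ i, X i ≠ 0 → η i = 0) →
      Tendsto (fun ε : ℝ => (f.value (X + ε • η) - f.value X) / ε ^ 2)
        (𝓝[≠] 0) (𝓝 (A * (∑ i, η i) ^ 2 + B * ∑ i, η i ^ 2)) := by
    intro η hη
    obtain ⟨R, hR, e⟩ := hexp η hη
    have hcont : Continuous fun ε : ℝ => A * (∑ i, η i) ^ 2 + B * ∑ i, η i ^ 2 + ε * R ε := by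
      fun_prop
    have h1 := (hcont.tendsto 0).mono_left (nhdsWithin_le_nhds (s := {0}ᶜ))
    rw [zero_mul, add_zero] at h1
    refine h1.congr' ?_
    filter_upwards [self_mem_nhdsWithin] with ε hε
    have hε' : ε ≠ 0 := hε
    rw [e, hf₁]
    field_simp
    ring
  have hsecond : ∀ η : Fin N → ℝ, (∀ i, X i ≠ 0 → η i = 0) → ∀ c : ℝ, 0 < c →
      (∀ᶠ K : ℕ in atTop, ∃ ω' : Omega N, config q t a b ω' = X + (c * q ^ K) • η) →
      0 ≤ A * (∑ i, η i) ^ 2 + B * ∑ i, η i ^ 2 := by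
    intro η hη c hc hev
    have h1 := (hlim η hη).comp ((tendsto_const_mul_pow_nhdsGT hq hc).mono_right
      (nhdsWithin_mono _ fun x (hx : 0 < x) => hx.ne'))
    refine ge_of_tendsto h1 ?_
    filter_upwards [hev] with K hK
    obtain ⟨ω', hω'⟩ := hK
    have h2 := hmin ω'
    rw [hω'] at h2
    exact div_nonneg (sub_nonneg.mpr h2) (sq_nonneg _)
  refine ⟨A, B, hlim, ?_, fun hnm' => ?_⟩
  · have h1 := hsecond _ (hsupp 1 hX₁) _ hc₁ hpos
    have h2 : ∑ i, Pi.single (M := fun _ => ℝ) i₁ (1 : ℝ) i ^ 2 = 1 := by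
      rw [Finset.sum_eq_single i₁] <;> simp +contextual
    rw [h2, Finset.sum_pi_single'] at h1
    simpa using h1
  · obtain ⟨e, he⟩ := exists_mul_zpow_mem_Ioc hq (div_pos hc₂ hc₁)
    set s := -b⁻¹ * t ^ m / (a⁻¹ * t ^ n) * q ^ e with hs
    have h12 : i₂ ≠ i₁ := by
      intro e
      have : (i₂ : ℕ) = n := congrArg Fin.val e
      omega
    have hη : ∀ j, X j ≠ 0 → (Pi.single i₁ 1 + Pi.single i₂ (-s) : Fin N → ℝ) j = 0 := by
      intro j hj
      rw [Pi.add_apply, hsupp 1 hX₁ j hj, hsupp (-s) hX₂ j hj, add_zero]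
    have hev : ∀ᶠ K : ℕ in atTop, ∃ ω' : Omega N, config q t a b ω' =
        X + (a⁻¹ * t ^ n * q ^ K) • (Pi.single i₁ 1 + Pi.single i₂ (-s) : Fin N → ℝ) := by
      filter_upwards [eventually_ge_atTop (K₁ + K₂ + 1 + e.natAbs)] with K hK
      obtain ⟨L, hL⟩ : ∃ L : ℕ, (L : ℤ) = K + e := ⟨(K + e).toNat, by omega⟩
      obtain ⟨ω', h1, h2, h3⟩ := h.exists_create_neg (q := q) (t := t) hnm (K := L) (by omega)
        fun i hi => (hK₂ i hi).trans (by exact_mod_cast (show K₂ ≤ L by omega))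
      obtain ⟨ω'', -, -, h4⟩ := h1.exists_create (q := q) (t := t) (by omega) (K := K) (by omega)
        fun i hi => (congrFun h2 i).le.trans
          ((hK₁ i hi).trans (by exact_mod_cast (show K₁ ≤ K by omega)))
      refine ⟨ω'', ?_⟩
      have hqe : q ^ L = q ^ K * q ^ e := by
        rw [← zpow_natCast, hL, zpow_add₀ hq.1.ne', zpow_natCast]
      rw [h4, h3, show b⁻¹ * q ^ L * t ^ m = (a⁻¹ * t ^ n * q ^ K) * -s by
          rw [hs, hqe]
          have := ha.ne'
          have := ht.1.ne'
          field_simp, update_eq_add_smul_single hX₂,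
        show a⁻¹ * q ^ K * t ^ n = (a⁻¹ * t ^ n * q ^ K) * 1 by ring,
        update_eq_add_smul_single, smul_add, add_assoc, add_comm (_ • Pi.single _ 1)]
      change X i₁ + (a⁻¹ * t ^ n * q ^ K) • Pi.single (M := fun _ => ℝ) i₂ (-s) i₁ = 0
      rw [hX₁, Pi.single_eq_of_ne h12.symm, smul_zero, add_zero]
    have h1 := hsecond _ hη _ hc₁ hev
    refine ⟨s, he, ?_⟩
    have h2 : ∑ i, (Pi.single i₁ 1 + Pi.single i₂ (-s) : Fin N → ℝ) i = 1 - s := by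
      simp only [Pi.add_apply, Finset.sum_add_distrib]
      rw [Finset.sum_pi_single', Finset.sum_pi_single']
      simp [sub_eq_add_neg]
    have h3 : ∑ i, (Pi.single i₁ 1 + Pi.single i₂ (-s) : Fin N → ℝ) i ^ 2 = 1 + s ^ 2 := by
      have h4 : ∀ i, (Pi.single i₁ 1 + Pi.single i₂ (-s) : Fin N → ℝ) i ^ 2 =
          (Pi.single i₁ 1 : Fin N → ℝ) i + (Pi.single i₂ (s ^ 2) : Fin N → ℝ) i := by
        intro i
        rw [Pi.add_apply]
        by_cases hi1 : i = i₁
        · subst hi1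
          simp [Pi.single_eq_of_ne h12.symm]
        · by_cases hi2 : i = i₂
          · subst hi2
            simp [Pi.single_eq_of_ne hi1]
          · simp [Pi.single_eq_of_ne hi1, Pi.single_eq_of_ne hi2]
      rw [Finset.sum_congr rfl fun i _ => h4 i, Finset.sum_add_distrib, Finset.sum_pi_single',
        Finset.sum_pi_single']
      simp
    rwa [h2, h3] at h1

theorem eventually_add_smul_ne {x y u v : ℝ} (h : x ≠ y ∨ (x = y ∧ u ≠ v)) :
    ∀ᶠ ε : ℝ in 𝓝[≠] 0, x + ε * u ≠ y + ε * v := by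
  rcases h with h | ⟨rfl, h⟩
  · have hc : Continuous fun ε : ℝ => (x + ε * u) - (y + ε * v) := by fun_prop
    have := (hc.tendsto 0).mono_left (nhdsWithin_le_nhds (s := {0}ᶜ))
    simp only [zero_mul, add_zero] at this
    filter_upwards [this.eventually_ne (sub_ne_zero.mpr h)] with ε hε
    exact sub_ne_zero.mp hε
  · filter_upwards [self_mem_nhdsWithin] with ε hε e
    exact h (mul_left_cancel₀ hε (add_left_cancel e))

/-- The minimum principle for the operator, at all configurations. -/
theorem operator_nonneg_of_minimum (hq : q ∈ Set.Ioo (0 : ℝ) 1) (ht : t ∈ Set.Ioo (0 : ℝ) 1)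
    (ha : 0 < a) (hb : b < 0) {d : ℂ} {D : SymPoly N →ₗ[ℝ] SymPoly N}
    (hD : ∀ f X, (∀ i, X i ≠ 0) → Function.Injective X →
      (D f).value X = qDifferenceRe q t a b d f.value X) (f : SymPoly N) (ω : Omega N)
    (hmin : ∀ ω' : Omega N, f.value (config q t a b ω) ≤ f.value (config q t a b ω')) :
    0 ≤ (D f).value (config q t a b ω) := by
  obtain ⟨n, m, h⟩ := ω.exists_hasCounts
  set X := config q t a b ω with hX
  set Z : Finset (Fin N) := Finset.univ.filter fun i => X i = 0 with hZdef
  have hZ : ∀ i, i ∈ Z ↔ X i = 0 := fun i => by simp [hZdef]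
  set η : Fin N → ℝ := fun i => if X i = 0 then (i : ℝ) + 1 else 0 with hη
  have hη0 : ∀ i ∈ Z, η i ≠ 0 := fun i hi => by
    rw [hη]
    simp only [(hZ i).mp hi, if_true]
    positivity
  have hηs : ∀ i, X i ≠ 0 → η i = 0 := fun i hi => if_neg hi
  have hηinj : Set.InjOn η Z := by
    intro i hi j hj hij
    simp only [hη, (hZ i).mp hi, (hZ j).mp hj, if_true, add_left_inj, Nat.cast_inj] at hij
    exact Fin.ext hij
  have hcontX : Continuous fun ε : ℝ => X + ε • η := by fun_prop
  have hX0 : X + (0 : ℝ) • η = X := by rw [zero_smul, add_zero]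
  have hf : Continuous f.value := MvPolynomial.continuous_eval _
  have hlhs : Tendsto (fun ε : ℝ => (D f).value (X + ε • η)) (𝓝[≠] 0) (𝓝 ((D f).value X)) := by
    have hc : Continuous fun ε : ℝ => (D f).value (X + ε • η) :=
      (MvPolynomial.continuous_eval _).comp hcontX
    have := (hc.tendsto 0).mono_left (nhdsWithin_le_nhds (s := {0}ᶜ))
    rwa [hX0] at this
  have hrhs : Tendsto (fun ε : ℝ => ∑ i ∈ Zᶜ, jump q t a b d f.value i (X + ε • η)) (𝓝[≠] 0)
      (𝓝 (∑ i ∈ Zᶜ, jump q t a b d f.value i X)) := by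
    refine tendsto_finsetSum _ fun i hi => ?_
    have hi0 : X i ≠ 0 := fun e => (Finset.mem_compl.mp hi) ((hZ i).mpr e)
    have h1 := continuousAt_jump q t a b d hf hi0
      fun j hj => config_ne_of_ne_zero hq ht ha hb ω hj hi0
    have h2 : Tendsto (fun ε : ℝ => X + ε • η) (𝓝[≠] 0) (𝓝 X) := by
      have := (hcontX.tendsto 0).mono_left (nhdsWithin_le_nhds (s := {0}ᶜ))
      rwa [hX0] at this
    exact h1.tendsto.comp h2
  have hrhs0 : 0 ≤ ∑ i ∈ Zᶜ, jump q t a b d f.value i X := by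
    refine Finset.sum_nonneg fun i hi => ?_
    exact jump_nonneg hq ht ha hb d f.value ω hmin
      fun e => (Finset.mem_compl.mp hi) ((hZ i).mpr e)
  have hzero : ∃ L : ℝ, 0 ≤ L ∧
      Tendsto (fun ε : ℝ => ∑ i ∈ Z, jump q t a b d f.value i (X + ε • η)) (𝓝[≠] 0) (𝓝 L) := by
    rcases h.le.eq_or_lt with hnm | hnm
    · have hZe : Z = ∅ := by
        rw [Finset.eq_empty_iff_forall_notMem]
        intro i hi
        have := (h.config_eq_zero_iff hq ht ha hb i).mp ((hZ i).mp hi)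
        omega
      refine ⟨0, le_rfl, ?_⟩
      rw [hZe]
      simp
    · obtain ⟨A, B, hlim, hAB, hs⟩ := exists_second_order hq ht ha hb h f hmin hnm
      refine ⟨_, ?_, tendsto_sum_jump_zero hq.1.ne' ht.2.ne a b d hZ hlim hηs hη0 hηinj⟩
      refine mul_nonneg (mul_nonneg (kap_pos hq ht ha hb).le (by linarith [hq.2])) ?_
      have hU : 0 ≤ ∑ k ∈ Finset.range Z.card, t ^ k :=
        Finset.sum_nonneg fun k _ => pow_nonneg ht.1.le k
      by_cases hnm' : n + m + 1 < N
      · obtain ⟨s, hs1, hs2⟩ := hs hnm'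
        exact zero_part_nonneg hq hU (sum_pow_le_sum_inv_pow ht _) hAB hs1 hs2
      · have hcard : Z.card ≤ 1 := by
          rw [Finset.card_le_one]
          intro i hi j hj
          have h1 := (h.config_eq_zero_iff hq ht ha hb i).mp ((hZ i).mp hi)
          have h2 := (h.config_eq_zero_iff hq ht ha hb j).mp ((hZ j).mp hj)
          exact Fin.ext (by omega)
        have hUV : ∑ k ∈ Finset.range Z.card, t⁻¹ ^ k = ∑ k ∈ Finset.range Z.card, t ^ k := by
          refine Finset.sum_congr rfl fun k hk => ?_
          have : k = 0 := by have := Finset.mem_range.mp hk; omega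
          rw [this, pow_zero, pow_zero]
        rw [hUV]
        set U := ∑ k ∈ Finset.range Z.card, t ^ k
        have hq0 := hq.1
        have e : A * ((1 - q) * (U + q⁻¹ * U)) + B * ((1 + q) * (q⁻¹ * U - U)) =
            (A + B) * (q⁻¹ * (1 - q) * (1 + q) * U) := by
          field_simp
          ring
        rw [e]
        have : 0 ≤ 1 - q := by linarith [hq.2]
        positivity
  obtain ⟨L, hL, hzero⟩ := hzero
  have hne : ∀ᶠ ε : ℝ in 𝓝[≠] 0, ∀ i, (X + ε • η) i ≠ 0 := by
    refine eventually_all.mpr fun i => ?_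
    have := eventually_add_smul_ne (x := X i) (y := 0) (u := η i) (v := 0) (by
      by_cases hi : X i = 0
      · exact Or.inr ⟨hi, hη0 i ((hZ i).mpr hi)⟩
      · exact Or.inl hi)
    simpa using this
  have hinj : ∀ᶠ ε : ℝ in 𝓝[≠] 0, ∀ i j, j ≠ i → (X + ε • η) i ≠ (X + ε • η) j := by
    refine eventually_all.mpr fun i => eventually_all.mpr fun j => ?_
    by_cases hij : j = i
    · exact Eventually.of_forall fun ε h => absurd hij h
    · have := eventually_add_smul_ne (x := X i) (y := X j) (u := η i) (v := η j) (by
        by_cases hi : X i = 0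
        · by_cases hj : X j = 0
          · exact Or.inr ⟨hi.trans hj.symm, fun e => hij
              (hηinj ((hZ j).mpr hj) ((hZ i).mpr hi) e.symm)⟩
          · exact Or.inl fun e => hj (e ▸ hi)
        · exact Or.inl (config_ne_of_ne_zero hq ht ha hb ω hij hi))
      filter_upwards [this] with ε hε _
      exact hε
  have hsum : Tendsto (fun ε : ℝ => (D f).value (X + ε • η)) (𝓝[≠] 0)
      (𝓝 (∑ i ∈ Zᶜ, jump q t a b d f.value i X + L)) := by
    refine (hrhs.add hzero).congr' ?_
    filter_upwards [hne, hinj] with ε h1 h2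
    rw [hD f _ h1 fun i j e => by_contra fun hij => h2 i j (fun e' => hij e'.symm) e,
      Finset.sum_compl_add_sum]
    rfl
  rw [tendsto_nhds_unique hlhs hsum]
  exact add_nonneg hrhs0 hL

end QJacobi

theorem theorem5 (N : ℕ) (hN : 2 ≤ N) (q t a b : ℝ) (c d : ℂ)
    (hq : q ∈ Set.Ioo (0 : ℝ) 1) (ht : t ∈ Set.Ioo (0 : ℝ) 1) (hb : b < 0) (ha : 0 < a)
    (hc : c.im ≠ 0) (hd : c = (starRingEnd ℂ) d) :
    -- symmetric polynomials are embedded as a dense subspace of the continuous functions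
    Function.Injective (QJacobi.embed hq t a b N) ∧
    DenseRange (QJacobi.embed hq t a b N) ∧
    -- the operator is correctly and uniquely defined on symmetric polynomials
    ∃ D : QJacobi.SymPoly N →ₗ[ℝ] QJacobi.SymPoly N,
      QJacobi.IsQDifferenceOperator q t a b c d D ∧
      (∀ D' : QJacobi.SymPoly N →ₗ[ℝ] QJacobi.SymPoly N,
        QJacobi.IsQDifferenceOperator q t a b c d D' → D' = D) ∧
      -- the positive maximum principle, at all minimum points
      (∀ (f : QJacobi.SymPoly N) (ω : QJacobi.Omega N),
        (∀ ω', QJacobi.embed hq t a b N f ω ≤ QJacobi.embed hq t a b N f ω') →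
          0 ≤ QJacobi.embed hq t a b N (D f) ω) ∧
      -- triangularity in the monomial basis, with nonpositive diagonal entries
      (∀ lam : Fin N → ℕ, Antitone lam → ∃ μ : ℝ, μ ≤ 0 ∧
        D (QJacobi.monomialSym lam) - μ • QJacobi.monomialSym lam ∈
          Submodule.span ℝ {g | ∃ ν : Fin N → ℕ,
            Antitone ν ∧ toLex ν < toLex lam ∧ g = QJacobi.monomialSym ν}) ∧
      -- the operator with domain the symmetric polynomials is a pre-generator of a Feller
      -- semigroup, which is the semigroup of a Markov process
      ∃ A : C(QJacobi.Omega N, ℝ) →ₗ.[ℝ] C(QJacobi.Omega N, ℝ),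
        (∀ φ ψ, (φ, ψ) ∈ A.graph ↔
          ∃ f, φ = QJacobi.embed hq t a b N f ∧ ψ = QJacobi.embed hq t a b N (D f)) ∧
        ∃ T : QJacobi.ContractionSemigroup C(QJacobi.Omega N, ℝ),
          QJacobi.IsFeller T ∧ QJacobi.IsPregenerator A T ∧
          ∃ p : ℝ≥0 → Kernel (QJacobi.Omega N) (QJacobi.Omega N),
            QJacobi.IsTransitionFunction p T ∧
            ∀ ν : Measure (QJacobi.Omega N), IsProbabilityMeasure ν →
              ∃ (S : Type) (_ : MeasurableSpace S) (P : Measure S)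
                (X : ℝ≥0 → S → QJacobi.Omega N),
                IsProbabilityMeasure P ∧ QJacobi.IsMarkovProcess P X p ν := by
  have hinj := QJacobi.embed_injective (N := N) (b := b) hq ht ha
  have hdense := QJacobi.denseRange_embed (N := N) hq ht ha hb
  obtain ⟨D, hD⟩ := QJacobi.exists_qDifferenceOperator (N := N) hq.1.ne' ht.2.ne a b d
  have hmin : ∀ (f : QJacobi.SymPoly N) (ω : QJacobi.Omega N),
      (∀ ω', QJacobi.embed hq t a b N f ω ≤ QJacobi.embed hq t a b N f ω') →
        0 ≤ QJacobi.embed hq t a b N (D f) ω := fun f ω h =>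
    QJacobi.operator_nonneg_of_minimum hq ht ha hb hD f ω h
  have htri : ∀ lam : Fin N → ℕ, Antitone lam → ∃ μ : ℝ, μ ≤ 0 ∧
      D (QJacobi.monomialSym lam) - μ • QJacobi.monomialSym lam ∈
        Submodule.span ℝ {g | ∃ ν : Fin N → ℕ,
          Antitone ν ∧ toLex ν < toLex lam ∧ g = QJacobi.monomialSym ν} := fun lam hlam =>
    ⟨_, QJacobi.diagEntry_nonpos hq ht ha hb d lam, QJacobi.sub_diagEntry_mem_span hD hlam⟩
  have hop : ∀ f : QJacobi.SymPoly N, ∀ X : Fin N → ℝ, (∀ i, X i ≠ 0) → Function.Injective X →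
      (((D f).value X : ℝ) : ℂ) = QJacobi.qDifference q t a b c d f.value X := fun f X h0 hX => by
    rw [hD f X h0 hX, QJacobi.qDifference_eq q t a b hd _ hX]
  have hone : D 1 = 0 := by
    refine QJacobi.SymPoly.ext_of_value fun X h0 hX => ?_
    rw [hD _ _ h0 hX]
    simp [QJacobi.qDifferenceRe, QJacobi.SymPoly.value]
  have := QJacobi.metrizableSpace_omega N
  let C : QJacobi.FellerCore (QJacobi.Omega N) (QJacobi.SymPoly N) :=
    { ι := (QJacobi.embed hq t a b N).toLinearMap
      inj := hinj
      dense := hdense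
      D := D
      exhaust := QJacobi.exists_finiteDimensional_invariant (by omega)
        fun lam hlam => (htri lam hlam).imp fun _ h => h.2
      one := 1
      ι_one := map_one (QJacobi.embed hq t a b N)
      D_one := hone
      min_principle := hmin }
  obtain ⟨A, hA, hpre⟩ := C.exists_pregenerator
  obtain ⟨p, hp⟩ := QJacobi.exists_isTransitionFunction C.semigroup C.isFeller_semigroup
  refine ⟨hinj, hdense, D, hop, fun D' hD' => ?_, hmin, htri, A, hA, C.semigroup,
    C.isFeller_semigroup, hpre, p, hp, fun ν hν =>
      QJacobi.exists_isMarkovProcess C.isFeller_semigroup hp ν⟩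
  refine LinearMap.ext fun f => QJacobi.SymPoly.ext_of_value fun X h0 hX => ?_
  have := (hD' f X h0 hX).trans (hop f X h0 hX).symm
  exact_mod_cast this
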